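/- **Setting.** For a function or tempered distribution $h$ on $\mathbb R^3$ let $\tilde h(\vec k)=\int e^{-i\vec k\cdot\vec x}h(\vec x)\,d^3x$ and $k=|\vec k|$. Phase space vectors are pairs $\gamma=(g,f)$ with symplectic form $\omega((g_1,f_1),(g_2,f_2))=\int (f_1g_2-g_1f_2)\,d^3x$ (extended by Parseval's formula to $\int\frac{d^3k}{(2\pi)^3}(\tilde f_1(-\vec k)\tilde g_2(\vec k)-\tilde g_1(-\vec k)\tilde f_2(\vec k))$) and Klein–Gordon product $\langle\gamma,\gamma'\rangle=-i\,\omega(\gamma^*,\gamma')$. A compactly supported single-mode subsystem $A$ is the span $\Gamma_A$ of two pairs $(g_i,f_i)$ ($i=1,2$) of real, compactly supported integrable functions with $\int k\,|\tilde g_i|^2d^3k<\infty$, $\int k^{-1}|\tilde f_i|^2d^3k<\infty$ and $\omega((g_1,f_1),(g_2,f_2))=1$. Let $\Pi_A$ be the symplectic-orthogonal projector onto $\Gamma_A$ and $\Pi_A^\perp=1-\Pi_A$. If a pure Gaussian state has complex structure $J$, the partner mode $A_p$ of $A$ is $\Gamma_{A_p}=\Pi_A^\perp[J\Gamma_A]$,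 with complexification $\Gamma_{A_p}^{\mathbb C}$. For a field of mass $m$ and Hubble rate $H$ with $0<m<H$, put $\mu^2=\frac32-\sqrt{\frac94-\frac{m^2}{H^2}}$. The complex structure of the Bunch–Davies vacuum (at scale factor $1$, to leading order in $\mu^2$) is the Fourier multiplier $$J_{BD}=\begin{pmatrix} c & -\frac1k-\frac{c^2}{k}\\ k& -c\end{pmatrix},\qquad c(k)=\frac{2^{1-\mu^2}\sqrt\pi}{\cos(\pi\mu^2)\,\Gamma(-\frac12+\mu^2)}\Big(\frac Hk\Big)^{1-\mu^2}.$$ The complex structure of the Minkowski vacuum of a field of mass $m\ge 0$ is the multiplier $J_M=\begin{pmatrix}0&-1/\sqrt{k^2+m^2}\\ \sqrt{k^2+m^2}&0\end{pmatrix}$. **Proposition 6.** Let $A$ be a compactly supported single-mode subsystem. (1) *Bunch–Davies vacuum, $0<m<H$.* $\Gamma_{A_p}^{\mathbb C}$ contains vectors of unit Klein–Gordon norm, and no nonzero element of it is compactly supported. Let $\gamma_{A_p}=(g_p,f_p)\in\Gamma_{A_p}^{\mathbb C}$ be any vector with $\langle\gamma_{A_p},\gamma_{A_p}\rangle=1$.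 Outside a sufficiently large ball $g_p$ and $f_p$ are continuous functions, and with $r=|\vec x-\vec x_0|$, for any reference point $\vec x_0$, as $r\to\infty$, $$g_p=O(r^{-2\mu^2}),\qquad f_p=O(r^{-1-\mu^2}),\ \text{ and in fact } f_p=O(r^{-2-\mu^2}).$$ If $A$ is not special, i.e. if $\int f\,d^3x\neq0$ for some $(g,f)\in\Gamma_A$, then $g_p$ decays only like $r^{-2\mu^2}$ and $f_p$ like $r^{-2-\mu^2}$: there are nonzero constants $C,D$ with $r^{2\mu^2}g_p\to C$ and $r^{2+\mu^2}f_p\to D$. (2) *Minkowski vacuum, $m=0$.* $\Gamma_{A_p}^{\mathbb C}$ contains vectors of unit Klein–Gordon norm, and each such vector $(g_p,f_p)$ is continuous outside a large ball with $g_p=O(r^{-2})$ and $f_p=O(r^{-4})$. If $\int f\neq0$ for some $(g,f)\in\Gamma_A$, then $r^2g_p$ has a nonzero limit; if $\int g\ne0$ for some $(g,f)\in\Gamma_A$, then $r^4f_p$ has a nonzero limit. (3) *Minkowski vacuum, $m>0$.* $\Gamma_{A_p}^{\mathbb C}$ contains vectors of unit Klein–Gordon norm, and for each such vector both components are continuous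 outside a large ball and $O(e^{-mr})$, and neither of them is $O(e^{-m'r})$ for any $m'>m$. -/

import Mathlib

open MeasureTheory Filter Topology Asymptotics Bornology
open scoped FourierTransform SchwartzMap ComplexConjugate

noncomputable section

namespace BDPartner

/-- Comoving space `ℝ³` (also used for frequency space). -/
abbrev Space : Type := EuclideanSpace ℝ (Fin 3)

/-- An element `(g, f)` of the complexified phase space in its Fourier representation
`ξ ↦ (ĝ ξ, f̂ ξ)`, with `ĥ ξ = ∫ exp (-2πi⟨x, ξ⟩) h x dx`. The wave vector is `k = 2πξ`, so that
`dξ = d³k / (2π)³`. The element is the pair of tempered distributions with these transforms;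
representatives that agree almost everywhere describe the same element. -/
abbrev PhaseVec : Type := Space → ℂ × ℂ

/-- `|k|` for the wave vector `k = 2πξ`. -/
def waveNumber (ξ : Space) : ℝ := 2 * Real.pi * ‖ξ‖

/-- The phase space element given by two real functions on space. -/
def ofFunctions (g f : Space → ℝ) : PhaseVec := fun ξ =>
  (𝓕 (fun x : Space => (g x : ℂ)) ξ, 𝓕 (fun x : Space => (f x : ℂ)) ξ)

/-- The symplectic structure `ω((g₁, f₁), (g₂, f₂)) = ∫ (f₁ g₂ - g₁ f₂) dx`, complex bilinear,
written in Fourier space by Parseval's formula (the form in which it makes sense on the whole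
completed phase space). -/
def sympl (u v : PhaseVec) : ℂ :=
  ∫ ξ, ((u (-ξ)).2 * (v ξ).1 - (u (-ξ)).1 * (v ξ).2)

/-- Complex conjugation of both components in position space. -/
def conjVec (u : PhaseVec) : PhaseVec := fun ξ => (conj (u (-ξ)).1, conj (u (-ξ)).2)

/-- The Klein--Gordon product `⟨u, v⟩ = -i ω(u*, v)`. -/
def kleinGordon (u v : PhaseVec) : ℂ := -Complex.I * sympl (conjVec u) v

/-- The translation invariant operator with matrix symbol `S |k|`. -/
def multiplier (S : ℝ → Matrix (Fin 2) (Fin 2) ℝ) (u : PhaseVec) : PhaseVec := fun ξ =>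
  ((S (waveNumber ξ) 0 0 : ℂ) * (u ξ).1 + (S (waveNumber ξ) 0 1 : ℂ) * (u ξ).2,
   (S (waveNumber ξ) 1 0 : ℂ) * (u ξ).1 + (S (waveNumber ξ) 1 1 : ℂ) * (u ξ).2)

/-- The mass parameter `μ² = 3/2 - √(9/4 - m²/H²)`. -/
def muSq (m H : ℝ) : ℝ := 3 / 2 - √(9 / 4 - m ^ 2 / H ^ 2)

/-- The dimensionless constant `2^(1-μ²) √π / (cos (πμ²) Γ(-1/2 + μ²))`. -/
def bdConst (s : ℝ) : ℝ :=
  2 ^ (1 - s) * √Real.pi / (Real.cos (Real.pi * s) * Real.Gamma (-1 / 2 + s))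

/-- Symbol of the field-momentum correlations, `bdConst μ² * (H / k)^(1 - μ²)`. (It is usually
written as `K (RH)^(1-μ²) k^(-1+μ²)` with `K = bdConst μ² * R^(-1+μ²)`; the reference length `R`
cancels.) -/
def bdCross (m H k : ℝ) : ℝ := bdConst (muSq m H) * (H / k) ^ (1 - muSq m H)

/-- Symbol of the complex structure `J` of the Bunch--Davies vacuum of a light field of mass `m`
with Hubble rate `H`, at scale factor one, to leading order in `μ²`. With `c = bdCross m H k` it is
`!![c, -(1 + c²) / k; k, -c]`. -/
def symbolBD (m H : ℝ) (k : ℝ) : Matrix (Fin 2) (Fin 2) ℝ :=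
  !![bdCross m H k, -(1 / k) - bdCross m H k ^ 2 / k; k, -bdCross m H k]

/-- Symbol of the complex structure of the Minkowski vacuum of a field of mass `m`. -/
def symbolMink (m : ℝ) (k : ℝ) : Matrix (Fin 2) (Fin 2) ℝ :=
  !![0, -(1 / √(k ^ 2 + m ^ 2)); √(k ^ 2 + m ^ 2), 0]

/-- A compactly supported single-mode subsystem: a two-dimensional symplectic subspace of the phase
space, given by a Darboux basis `(g 0, f 0)`, `(g 1, f 1)` of pairs of real, compactly supported
functions with `g` of finite homogeneous Sobolev norm of order `1/2` and `f` of finite homogeneous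
Sobolev norm of order `-1/2`. -/
structure LocalMode where
  g : Fin 2 → Space → ℝ
  f : Fin 2 → Space → ℝ
  integrable_g : ∀ i, Integrable (g i)
  integrable_f : ∀ i, Integrable (f i)
  compact_g : ∀ i, HasCompactSupport (g i)
  compact_f : ∀ i, HasCompactSupport (f i)
  sobolev_g : ∀ i, Integrable fun ξ => waveNumber ξ * ‖(ofFunctions (g i) (f i) ξ).1‖ ^ 2
  sobolev_f : ∀ i, Integrable fun ξ => (waveNumber ξ)⁻¹ * ‖(ofFunctions (g i) (f i) ξ).2‖ ^ 2
  darboux : sympl (ofFunctions (g 0) (f 0)) (ofFunctions (g 1) (f 1)) = 1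

namespace LocalMode

variable (A : LocalMode)

/-- The basis vectors of `Γ_A`. -/
def basis (i : Fin 2) : PhaseVec := ofFunctions (A.g i) (A.f i)

/-- The complexification of `Γ_A`. -/
def complexSpan : Submodule ℂ PhaseVec := Submodule.span ℂ (Set.range A.basis)

/-- The symplectic-orthogonal projector `Π_A` onto `Γ_A`. -/
def proj (u : PhaseVec) : PhaseVec :=
  sympl u (A.basis 1) • A.basis 0 - sympl u (A.basis 0) • A.basis 1

/-- The complexified partner space `Γ_{A_p} = (1 - Π_A) [J Γ_A]`, for the complex structure `J`
with symbol `S`. -/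
def partner (S : ℝ → Matrix (Fin 2) (Fin 2) ℝ) : Set PhaseVec :=
  {v | ∃ u ∈ A.complexSpan, v = multiplier S u - A.proj (multiplier S u)}

end LocalMode

/-- The distribution with Fourier transform `u` is given on the set `U` by the function `h`. -/
def EqualsOn (u : Space → ℂ) (h : Space → ℂ) (U : Set Space) : Prop :=
  ∀ φ : 𝓢(Space, ℂ), HasCompactSupport φ → tsupport φ ⊆ U →
    ∫ ξ, u ξ * (𝓕⁻ φ : 𝓢(Space, ℂ)) ξ = ∫ x, h x * φ x

/-- The region outside the closed ball of radius `ρ`. -/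
def outside (ρ : ℝ) : Set Space := {x | ρ < ‖x‖}

/-- Both components of the phase space element vanish outside some ball. -/
def CompactlySupported (u : PhaseVec) : Prop :=
  ∃ ρ : ℝ, EqualsOn (fun ξ => (u ξ).1) (fun _ => 0) (outside ρ) ∧
    EqualsOn (fun ξ => (u ξ).2) (fun _ => 0) (outside ρ)

/-- Outside some ball, the phase space element `u` is the pair `(g, f)` of continuous functions. -/
def FarField (u : PhaseVec) (g f : Space → ℂ) : Prop :=
  ∃ ρ : ℝ, ContinuousOn g (outside ρ) ∧ ContinuousOn f (outside ρ) ∧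
    EqualsOn (fun ξ => (u ξ).1) g (outside ρ) ∧ EqualsOn (fun ξ => (u ξ).2) f (outside ρ)

end BDPartner

end

noncomputable section

namespace BDPartner

/-! Every partner vector is `J u + p` with `u`, `p` in the complexified span of the mode
(`LocalMode.partnerVec_eq_multiplier_add`). Outside a ball it therefore coincides with `J u`, and
there the entries of `J` act by convolution with radial kernels. The kernels arise by writing a
symbol as a superposition of Gaussians `exp (-τ (k² + m²))`, so that the kernel is a superposition
of heat kernels (`FarKernel.of_superposition`). Up to nonzero constants, scaling turns `k ^ (-2b)`
into `r ^ (2b - 3)` and `k` into `r ^ (-4)`; for positive mass, completing a square gives the bound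
`exp (-m r)`. Convolving `C r ^ (-a)` with a compactly supported `f` gives `C r ^ (-a) ∫ f` to
leading order (`tendsto_rpow_mul_radialConv`), hence the power laws and their nonzero coefficients.

The leading coefficient may vanish, so the absence of compact support and the sharpness of the rate
`m` need another argument, by analyticity. If a distribution decays exponentially outside a ball,
its mollified Fourier transform extends analytically to a strip along each line through the origin
(`FarRep.rayAnalytic`). Transforms of compactly supported sources extend as well, but `|t|`, a
noninteger power of `|t|`, or a square root with a branch point inside the strip do not; the source
they multiply must vanish (`eventually_zero_of_abs_rpow`, `eqOn_zero_of_sqrt_mul`). This rigidity is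
recorded in `IsRigid`.

The Klein–Gordon norm of a partner vector is `1 - det G` times that of `u`, where `G` is the Gram
matrix of `ω(J ·, ·)` (`LocalMode.kleinGordon_partnerVec`). If `det G = 1`, the projection of `J e₀`
off the mode is null for the positive form `ω(J ·, ·)`, hence zero; then `J e₀` is compactly
supported, contrary to rigidity (`LocalMode.gram_det_ne_one`). A nonzero norm also makes the
coordinates of `u` linearly independent of their conjugates, so a real functional that is nonzero on
the mode is nonzero at `u`. -/

lemma waveNumber_pos {ξ : Space} (h : ξ ≠ 0) : 0 < waveNumber ξ := by
  unfold waveNumber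
  have := norm_pos_iff.2 h
  positivity

lemma waveNumber_nonneg (ξ : Space) : 0 ≤ waveNumber ξ := by
  unfold waveNumber
  positivity

lemma waveNumber_neg (ξ : Space) : waveNumber (-ξ) = waveNumber ξ := by
  simp [waveNumber]

lemma continuous_waveNumber : Continuous waveNumber := by
  unfold waveNumber
  fun_prop

lemma one_le_waveNumber {ξ : Space} (h : 1 ≤ ‖ξ‖) : 1 ≤ waveNumber ξ := by
  unfold waveNumber
  nlinarith [Real.pi_gt_three]

lemma ae_ne_zero : ∀ᵐ ξ : Space, ξ ≠ 0 := by
  simp [ae_iff]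

lemma continuousOn_comp_waveNumber {σ : ℝ → ℝ} (h : ContinuousOn σ (Set.Ioi 0)) :
    ContinuousOn (fun ξ => σ (waveNumber ξ)) {0}ᶜ :=
  h.comp continuous_waveNumber.continuousOn fun _ hξ => waveNumber_pos hξ

lemma aestronglyMeasurable_of_continuousOn_compl_zero {E : Type*} [TopologicalSpace E]
    [TopologicalSpace.PseudoMetrizableSpace E] {u : Space → E} (h : ContinuousOn u {0}ᶜ) :
    AEStronglyMeasurable u := by
  have h' := h.aestronglyMeasurable_of_isSeparable (μ := volume)
    (measurableSet_singleton (0 : Space)).compl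
    (TopologicalSpace.IsSeparable.of_separableSpace _)
  rwa [restrict_compl_singleton] at h'

lemma fourier_continuous {f : Space → ℂ} (hf : Integrable f) : Continuous (𝓕 f) :=
  VectorFourier.fourierIntegral_continuous Real.continuous_fourierChar
    (by simpa using continuous_inner) hf

lemma norm_fourier_le (f : Space → ℂ) (ξ : Space) : ‖𝓕 f ξ‖ ≤ ∫ x, ‖f x‖ :=
  VectorFourier.norm_fourierIntegral_le_integral_norm _ _ _ _ _

/-! ### Admissible radial symbols -/

/-- Radial symbols that define multipliers on Schwartz functions. -/
structure IsAdmissible (σ : ℝ → ℝ) : Prop where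
  continuousOn : ContinuousOn σ (Set.Ioi 0)
  integrableOn : IntegrableOn (fun ξ : Space => σ (waveNumber ξ)) (Metric.ball 0 1)
  growth : ∃ C, ∀ k ≥ 1, |σ k| ≤ C * k

namespace IsAdmissible

variable {σ τ : ℝ → ℝ}

lemma congr (h : IsAdmissible σ) (e : ∀ k > 0, τ k = σ k) : IsAdmissible τ where
  continuousOn := h.continuousOn.congr e
  integrableOn := by
    refine h.integrableOn.congr (ae_restrict_of_ae ?_)
    filter_upwards [ae_ne_zero] with ξ hξ
    exact (e _ (waveNumber_pos hξ)).symm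
  growth := by
    obtain ⟨C, hC⟩ := h.growth
    exact ⟨C, fun k hk => by rw [e k (by linarith)]; exact hC k hk⟩

lemma add (h : IsAdmissible σ) (h' : IsAdmissible τ) : IsAdmissible fun k => σ k + τ k where
  continuousOn := h.continuousOn.add h'.continuousOn
  integrableOn := h.integrableOn.add h'.integrableOn
  growth := by
    obtain ⟨C, hC⟩ := h.growth
    obtain ⟨D, hD⟩ := h'.growth
    refine ⟨C + D, fun k hk => (abs_add_le _ _).trans ?_⟩
    linarith [hC k hk, hD k hk]

lemma const_mul (h : IsAdmissible σ) (c : ℝ) : IsAdmissible fun k => c * σ k where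
  continuousOn := continuousOn_const.mul h.continuousOn
  integrableOn := h.integrableOn.const_mul c
  growth := by
    obtain ⟨C, hC⟩ := h.growth
    refine ⟨|c| * C, fun k hk => ?_⟩
    rw [abs_mul, mul_assoc]
    exact mul_le_mul_of_nonneg_left (hC k hk) (abs_nonneg _)

lemma of_continuous (h : Continuous σ) (hg : ∃ C, ∀ k ≥ 1, |σ k| ≤ C * k) : IsAdmissible σ where
  continuousOn := h.continuousOn
  integrableOn := ((h.comp continuous_waveNumber).continuousOn.integrableOn_compact
    (isCompact_closedBall 0 1)).mono_set Metric.ball_subset_closedBall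
  growth := hg

/-- The lower bound on `a` is local integrability at the origin of three-dimensional space, where
the radial density is `r ^ (a + 2)`; the upper one is the linear growth allowed at high frequency.
-/
lemma rpow {a : ℝ} (h₁ : -3 < a) (h₂ : a ≤ 1) : IsAdmissible fun k => k ^ a where
  continuousOn := fun k hk => (Real.continuousAt_rpow_const k a (Or.inl (ne_of_gt hk))).continuousWithinAt
  integrableOn := by
    unfold waveNumber
    refine (integrableOn_fun_norm_addHaar (E := Space) volume
      (f := fun r => (2 * Real.pi * r) ^ a)).2 ?_
    have hi : IntegrableOn (fun r : ℝ => (2 * Real.pi) ^ a * r ^ (a + 2)) (Set.Ioo 0 1) := by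
      refine Integrable.const_mul ?_ _
      exact ((intervalIntegral.intervalIntegrable_rpow' (a := 0) (b := 1)
        (by linarith : -1 < a + 2)).1).mono_set Set.Ioo_subset_Ioc_self
    refine hi.congr_fun (fun r hr => ?_) measurableSet_Ioo
    have hr0 : 0 < r := hr.1
    simp only [finrank_euclideanSpace, Fintype.card_fin, smul_eq_mul]
    rw [Real.mul_rpow (by positivity) hr0.le, Real.rpow_add hr0]
    norm_num
    ring
  growth := ⟨1, fun k hk => by
    rw [abs_of_nonneg (by positivity), one_mul]
    simpa using Real.rpow_le_rpow_of_exponent_le hk h₂⟩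

lemma aestronglyMeasurable (h : IsAdmissible σ) :
    AEStronglyMeasurable fun ξ : Space => (σ (waveNumber ξ) : ℂ) :=
  Complex.continuous_ofReal.comp_aestronglyMeasurable
    (aestronglyMeasurable_of_continuousOn_compl_zero (continuousOn_comp_waveNumber h.continuousOn))

lemma integrable_mul_schwartz (h : IsAdmissible σ) (φ : 𝓢(Space, ℂ)) :
    Integrable fun ξ => (σ (waveNumber ξ) : ℂ) * φ ξ := by
  obtain ⟨C, hC⟩ := h.growth
  obtain ⟨M, hM⟩ : ∃ M, ∀ ξ, ‖φ ξ‖ ≤ M := by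
    obtain ⟨M, hM⟩ := φ.decay 0 0
    exact ⟨M, fun ξ => by simpa using hM.2 ξ⟩
  have hm : AEStronglyMeasurable fun ξ => (σ (waveNumber ξ) : ℂ) * φ ξ :=
    h.aestronglyMeasurable.mul φ.continuous.aestronglyMeasurable
  rw [← integrableOn_univ, ← Set.union_compl_self (Metric.ball (0 : Space) 1), integrableOn_union]
  constructor
  · refine Integrable.mono' (h.integrableOn.norm.mul_const M) hm.restrict (ae_of_all _ fun ξ => ?_)
    rw [norm_mul, Complex.norm_real]
    exact mul_le_mul_of_nonneg_left (hM ξ) (norm_nonneg _)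
  · refine Integrable.mono' (((φ.integrable_pow_mul volume 1).const_mul
      (C * (2 * Real.pi))).integrableOn) hm.restrict ?_
    refine (ae_restrict_iff' Metric.isOpen_ball.measurableSet.compl).2 (ae_of_all _ fun ξ hξ => ?_)
    have h1 : 1 ≤ ‖ξ‖ := by simpa using hξ
    rw [norm_mul, Complex.norm_real, Real.norm_eq_abs]
    have := mul_le_mul_of_nonneg_right (hC _ (one_le_waveNumber h1)) (norm_nonneg (φ ξ))
    refine this.trans_eq ?_
    unfold waveNumber
    ring

/-- Integrability of a symbol against a product of two bounded continuous functions, given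
integrability of a dominating weight at high frequency. -/
lemma integrable_mul_of_dominated (h : IsAdmissible σ) {w : ℝ → ℝ} {C : ℝ}
    (hw : ∀ k ≥ 1, |σ k| ≤ C * w k) {p : Space → ℂ} (hp : Continuous p)
    (hi : Integrable fun ξ => w (waveNumber ξ) * ‖p ξ‖) :
    Integrable fun ξ => (σ (waveNumber ξ) : ℂ) * p ξ := by
  obtain ⟨M, hM⟩ := (isCompact_closedBall (0 : Space) 1).exists_bound_of_continuousOn hp.continuousOn
  have hm : AEStronglyMeasurable fun ξ => (σ (waveNumber ξ) : ℂ) * p ξ :=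
    h.aestronglyMeasurable.mul hp.aestronglyMeasurable
  rw [← integrableOn_univ, ← Set.union_compl_self (Metric.ball (0 : Space) 1), integrableOn_union]
  constructor
  · refine Integrable.mono' (h.integrableOn.norm.mul_const M) hm.restrict
      ((ae_restrict_iff' Metric.isOpen_ball.measurableSet).2 (ae_of_all _ fun ξ hξ => ?_))
    rw [norm_mul, Complex.norm_real]
    exact mul_le_mul_of_nonneg_left (hM ξ (Metric.ball_subset_closedBall hξ)) (norm_nonneg _)
  · refine Integrable.mono' ((hi.const_mul C).integrableOn) hm.restrict ?_
    refine (ae_restrict_iff' Metric.isOpen_ball.measurableSet.compl).2 (ae_of_all _ fun ξ hξ => ?_)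
    have h1 : 1 ≤ ‖ξ‖ := by simpa using hξ
    rw [norm_mul, Complex.norm_real, Real.norm_eq_abs, ← mul_assoc]
    exact mul_le_mul_of_nonneg_right (hw _ (one_le_waveNumber h1)) (norm_nonneg _)

end IsAdmissible

/-! ### Heat kernels and their superpositions -/

lemma integral_fourier_mul_eq {f g : Space → ℂ} (hf : Integrable f) (hg : Integrable g) :
    ∫ ξ, 𝓕 f ξ * g ξ = ∫ x, f x * 𝓕 g x := by
  have h := VectorFourier.integral_fourierIntegral_smul_eq_flip (L := innerₗ Space)
    (μ := volume) (ν := volume) Real.continuous_fourierChar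
    (by simpa using continuous_inner) hf hg
  have e : (innerₗ Space).flip = innerₗ Space := by
    ext x y
    simp
  rw [e] at h
  exact h

/-- The heat kernel at time `τ` with damping `exp (-m² τ)`, as a function of the distance. -/
def heatKernel (m τ r : ℝ) : ℝ :=
  (4 * Real.pi * τ) ^ (-(3 / 2) : ℝ) * Real.exp (-(r ^ 2 / (4 * τ)) - m ^ 2 * τ)

lemma heatKernel_pos (m r : ℝ) {τ : ℝ} (hτ : 0 < τ) : 0 < heatKernel m τ r := by
  unfold heatKernel
  positivity

lemma fourierInv_modulated_gaussian {b : ℝ} (hb : 0 < b) (y x : Space) :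
    𝓕⁻ (fun ξ : Space => (Real.exp (-b * ‖ξ‖ ^ 2) : ℂ) * (𝐞 (-(inner ℝ y ξ)) : ℂ)) x =
      (((Real.pi / b) ^ (3 / 2 : ℝ) * Real.exp (-Real.pi ^ 2 * ‖x - y‖ ^ 2 / b) : ℝ) : ℂ) := by
  have h := fourier_gaussian_innerProductSpace' (V := Space) (b := (b : ℂ)) (by simpa using hb)
    (-y) (-x)
  rw [Real.fourierInv_eq_fourier_neg]
  have e : (fun ξ : Space => (Real.exp (-b * ‖ξ‖ ^ 2) : ℂ) * (𝐞 (-(inner ℝ y ξ)) : ℂ)) =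
      fun v => Complex.exp (-b * (‖v‖ : ℂ) ^ 2 +
        2 * Real.pi * Complex.I * (inner ℝ (-y) v : ℝ)) := by
    funext ξ
    rw [Real.fourierChar_apply, Complex.exp_add]
    push_cast
    congr 2
    simp only [inner_neg_left]
    push_cast
    ring
  rw [e, h, show -y - -x = x - y by abel, finrank_euclideanSpace, Fintype.card_fin]
  push_cast
  rw [Complex.ofReal_cpow (by positivity)]
  push_cast
  rfl

lemma integrable_gaussian {b : ℝ} (hb : 0 < b) :
    Integrable fun ξ : Space => Real.exp (-b * ‖ξ‖ ^ 2) := by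
  have := (GaussianFourier.integrable_cexp_neg_mul_sq_norm_add (V := Space) (b := (b : ℂ))
    (by simpa using hb) 0 0).norm
  refine this.congr (ae_of_all _ fun ξ => ?_)
  simp only [Complex.norm_exp]
  congr 1
  simp
  left
  norm_cast

lemma continuous_char (y : Space) : Continuous fun ξ : Space => (𝐞 (-(inner ℝ y ξ)) : ℂ) :=
  continuous_subtype_val.comp (Real.continuous_fourierChar.comp (by fun_prop))

lemma norm_char (y ξ : Space) : ‖(𝐞 (-(inner ℝ y ξ)) : ℂ)‖ = 1 := Circle.norm_coe _

lemma integral_gaussian_mul_fourierInv (m : ℝ) {τ : ℝ} (hτ : 0 < τ) (y : Space) (φ : 𝓢(Space, ℂ)) :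
    ∫ ξ, (Real.exp (-(τ * (waveNumber ξ ^ 2 + m ^ 2))) : ℂ) *
        ((𝐞 (-(inner ℝ y ξ)) : ℂ) * (𝓕⁻ φ : 𝓢(Space, ℂ)) ξ) =
      ∫ x, (heatKernel m τ ‖x - y‖ : ℂ) * φ x := by
  have hpi := Real.pi_pos
  set b : ℝ := 4 * Real.pi ^ 2 * τ with hb
  have hb0 : 0 < b := by positivity
  set q : Space → ℂ := fun ξ => (Real.exp (-b * ‖ξ‖ ^ 2) : ℂ) * (𝐞 (-(inner ℝ y ξ)) : ℂ) with hq
  have hqi : Integrable q := by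
    refine Integrable.mono' (integrable_gaussian hb0) ?_ (ae_of_all _ fun ξ => ?_)
    · exact (Continuous.mul (by fun_prop) (continuous_char y)).aestronglyMeasurable
    · rw [hq, norm_mul, norm_char, mul_one, Complex.norm_real, Real.norm_eq_abs, Real.abs_exp]
  have h1 : ∫ ξ, q ξ * (𝓕⁻ φ : 𝓢(Space, ℂ)) ξ = ∫ x, 𝓕⁻ q x * φ x := by
    rw [SchwartzMap.fourierInv_coe, Real.fourierInv_eq_fourier_comp_neg,
      ← integral_fourier_mul_eq hqi φ.integrable.comp_neg]
    rw [← integral_neg_eq_self]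
    simp only [neg_neg, Real.fourierInv_eq_fourier_neg]
  have e1 : ∀ ξ : Space, (Real.exp (-(τ * (waveNumber ξ ^ 2 + m ^ 2))) : ℂ) *
        ((𝐞 (-(inner ℝ y ξ)) : ℂ) * (𝓕⁻ φ : 𝓢(Space, ℂ)) ξ) =
      (Real.exp (-(m ^ 2 * τ)) : ℂ) * (q ξ * (𝓕⁻ φ : 𝓢(Space, ℂ)) ξ) := by
    intro ξ
    have : Real.exp (-(τ * (waveNumber ξ ^ 2 + m ^ 2))) =
        Real.exp (-(m ^ 2 * τ)) * Real.exp (-b * ‖ξ‖ ^ 2) := by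
      rw [← Real.exp_add]
      congr 1
      unfold waveNumber
      rw [hb]
      ring
    rw [this, hq]
    push_cast
    ring
  rw [integral_congr_ae (ae_of_all _ e1), integral_const_mul, h1, ← integral_const_mul]
  refine integral_congr_ae (ae_of_all _ fun x => ?_)
  simp only
  rw [hq, fourierInv_modulated_gaussian hb0, ← mul_assoc, ← Complex.ofReal_mul]
  congr 2
  unfold heatKernel
  have e2 : Real.pi / b = (4 * Real.pi * τ)⁻¹ := by
    rw [hb]; field_simp
  have e3 : -Real.pi ^ 2 * ‖x - y‖ ^ 2 / b = -(‖x - y‖ ^ 2 / (4 * τ)) := by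
    rw [hb]; field_simp
  rw [e2, e3, Real.inv_rpow (by positivity), ← Real.rpow_neg (by positivity),
    show ∀ a b : ℝ, a - b = -b + a by intros; ring, Real.exp_add]
  ring

lemma integral_char_mul_fourierInv (y : Space) (φ : 𝓢(Space, ℂ)) :
    ∫ ξ, (𝐞 (-(inner ℝ y ξ)) : ℂ) * (𝓕⁻ φ : 𝓢(Space, ℂ)) ξ = φ y := by
  have h : (𝓕 (𝓕⁻ φ : 𝓢(Space, ℂ)) : 𝓢(Space, ℂ)) y = φ y := by simp
  rw [← h, SchwartzMap.fourier_coe, Real.fourier_eq]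
  refine integral_congr_ae (ae_of_all _ fun ξ => ?_)
  simp [real_inner_comm, Circle.smul_def]

/-- Superposition of heat kernels with weight `τ ^ (b - 1)`. -/
def heatSuperposition (b m r : ℝ) : ℝ := ∫ τ in Set.Ioi (0 : ℝ), τ ^ (b - 1) * heatKernel m τ r

lemma heatKernel_le {m τ r δ : ℝ} (hτ : 0 < τ) (hδ : 0 ≤ δ) (h : δ ≤ r) :
    heatKernel m τ r ≤ heatKernel 0 τ δ := by
  unfold heatKernel
  refine mul_le_mul_of_nonneg_left (Real.exp_le_exp.2 ?_) (by positivity)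
  have h1 : δ ^ 2 / (4 * τ) ≤ r ^ 2 / (4 * τ) := by gcongr
  have : 0 ≤ m ^ 2 * τ := by positivity
  nlinarith

/-- The factor `exp (-δ²/(4τ))` controls small `τ`, while at large `τ` the integrand behaves like `τ
^ (b - 5/2)`, which is where `b < 3/2` enters. The substitution `u = τ⁻¹` reduces this to a Gamma
integral. The massless kernel at a smaller distance later serves as the dominating function for all
masses. -/
lemma integrable_heatKernel {b : ℝ} (hb : b < 3 / 2) {δ : ℝ} (hδ : 0 < δ) :
    IntegrableOn (fun τ => τ ^ (b - 1) * heatKernel 0 τ δ) (Set.Ioi 0) := by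
  have h0 : IntegrableOn (fun u : ℝ => u ^ (1 / 2 - b) * Real.exp (-(δ ^ 2 / 4) * u ^ (1 : ℝ)))
      (Set.Ioi 0) :=
    integrableOn_rpow_mul_exp_neg_mul_rpow (by linarith) one_pos (by positivity)
  have h1 := (integrableOn_Ioi_comp_rpow_iff' (fun u : ℝ => u ^ (1 / 2 - b) *
    Real.exp (-(δ ^ 2 / 4) * u ^ (1 : ℝ))) (p := -1) (by norm_num)).2 h0
  refine IntegrableOn.congr_fun (Integrable.const_mul h1 ((4 * Real.pi) ^ (-(3 / 2) : ℝ)))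
    (fun τ hτ => ?_) measurableSet_Ioi
  have hτ0 : 0 < τ := hτ
  simp only [heatKernel, smul_eq_mul, Real.rpow_one]
  rw [Real.mul_rpow (by positivity) hτ0.le, ← Real.rpow_mul hτ0.le, Real.rpow_neg_one,
    show -(δ ^ 2 / 4) * τ⁻¹ = -(δ ^ 2 / (4 * τ)) - 0 ^ 2 * τ by field_simp; ring]
  have : τ ^ (b - 1) * τ ^ (-(3 / 2) : ℝ) = τ ^ (-1 - 1 : ℝ) * τ ^ (-1 * (1 / 2 - b)) := by
    rw [← Real.rpow_add hτ0, ← Real.rpow_add hτ0]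
    congr 1
    ring
  linear_combination (-(4 * Real.pi) ^ (-(3 / 2) : ℝ) *
    Real.exp (-(δ ^ 2 / (4 * τ)) - 0 ^ 2 * τ)) * this

lemma aestronglyMeasurable_rpow_mul_heatKernel (b m r : ℝ) (μ : Measure ℝ) :
    AEStronglyMeasurable (fun τ => τ ^ (b - 1) * heatKernel m τ r) μ := by
  refine Measurable.aestronglyMeasurable ?_
  unfold heatKernel
  fun_prop

lemma integrable_rpow_mul_heatKernel {b : ℝ} (hb : b < 3 / 2) (m : ℝ) {r : ℝ} (hr : 0 < r) :
    IntegrableOn (fun τ => τ ^ (b - 1) * heatKernel m τ r) (Set.Ioi 0) := by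
  refine Integrable.mono' (integrable_heatKernel hb hr)
    (aestronglyMeasurable_rpow_mul_heatKernel b m r _)
    ((ae_restrict_iff' measurableSet_Ioi).2 (ae_of_all _ fun τ hτ => ?_))
  have hτ0 : 0 < τ := hτ
  have := heatKernel_pos m r hτ0
  rw [Real.norm_of_nonneg (by positivity)]
  exact mul_le_mul_of_nonneg_left (heatKernel_le hτ hr.le le_rfl) (by positivity)

lemma heatSuperposition_pos {b : ℝ} (hb : b < 3 / 2) (m : ℝ) {r : ℝ} (hr : 0 < r) :
    0 < heatSuperposition b m r := by
  unfold heatSuperposition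
  rw [setIntegral_pos_iff_support_of_nonneg_ae _ (integrable_rpow_mul_heatKernel hb m hr)]
  · have : Set.Ioi (0 : ℝ) ⊆
        (Function.support fun τ => τ ^ (b - 1) * heatKernel m τ r) ∩ Set.Ioi 0 := by
      intro τ hτ
      have hτ0 : 0 < τ := hτ
      have := heatKernel_pos m r hτ0
      exact ⟨by simp only [Function.mem_support]; positivity, hτ⟩
    exact lt_of_lt_of_le (by simp) (measure_mono this)
  · refine (ae_restrict_iff' measurableSet_Ioi).2 (ae_of_all _ fun τ hτ => ?_)
    have hτ0 : 0 < τ := hτ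
    have := heatKernel_pos m r hτ0
    simp only [Pi.zero_apply]
    positivity

lemma continuousOn_heatSuperposition {b : ℝ} (hb : b < 3 / 2) (m : ℝ) :
    ContinuousOn (heatSuperposition b m) (Set.Ioi 0) := by
  intro r hr
  have hr0 : 0 < r := hr
  refine ContinuousAt.continuousWithinAt ?_
  refine continuousAt_of_dominated (bound := fun τ => τ ^ (b - 1) * heatKernel 0 τ (r / 2))
    (Eventually.of_forall fun r => aestronglyMeasurable_rpow_mul_heatKernel b m r _) ?_
    (integrable_heatKernel hb (by positivity)) ?_
  · filter_upwards [lt_mem_nhds (half_lt_self hr0)] with r' hr'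
    refine (ae_restrict_iff' measurableSet_Ioi).2 (ae_of_all _ fun τ hτ => ?_)
    have hτ0 : 0 < τ := hτ
    have := heatKernel_pos m r' hτ0
    rw [Real.norm_of_nonneg (by positivity)]
    exact mul_le_mul_of_nonneg_left (heatKernel_le hτ (by positivity) hr'.le) (by positivity)
  · refine ae_of_all _ fun τ => ?_
    unfold heatKernel
    fun_prop

lemma heatSuperposition_le {b : ℝ} (hb : b < 3 / 2) (m : ℝ) {r : ℝ} (hr : 1 ≤ r) :
    |heatSuperposition b m r| ≤ heatSuperposition b 0 1 := by
  rw [abs_of_pos (heatSuperposition_pos hb m (by linarith))]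
  refine setIntegral_mono_on (integrable_rpow_mul_heatKernel hb m (by linarith))
    (integrable_heatKernel hb one_pos) measurableSet_Ioi fun τ hτ => ?_
  have hτ0 : 0 < τ := hτ
  exact mul_le_mul_of_nonneg_left (heatKernel_le hτ zero_le_one hr) (by positivity)

/-! ### Kernels of multipliers away from the diagonal -/

/-- Away from the diagonal, the multiplier with symbol `σ` has the integral kernel `K ‖x - y‖`. -/
structure FarKernel (σ K : ℝ → ℝ) : Prop where
  admissible : IsAdmissible σ
  continuousOn : ContinuousOn K (Set.Ioi 0)
  bounded : ∃ C, ∀ r ≥ 1, |K r| ≤ C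
  repr : ∀ (φ : 𝓢(Space, ℂ)) (y : Space), tsupport φ ⊆ {x | 1 ≤ ‖x - y‖} →
    ∫ ξ, (σ (waveNumber ξ) : ℂ) * ((𝐞 (-(inner ℝ y ξ)) : ℂ) * (𝓕⁻ φ : 𝓢(Space, ℂ)) ξ) =
      ∫ x, (K ‖x - y‖ : ℂ) * φ x

/-- Fubini is applied twice: once to pull the superposition out of the frequency integral, and once
to reassemble the heat kernels in position space. The constant `κ` regularises the integral at `τ =
0` when `b ≤ 0`; it is the symbol of a point mass at `y`, invisible to test functions supported away
from `y`. Hypothesis `hn` says that the integrand has constant sign, so its absolute integral is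
controlled by the symbol itself. -/
lemma FarKernel.of_superposition {σ : ℝ → ℝ} (hσ : IsAdmissible σ) {b m κ c : ℝ} (hb : b < 3 / 2)
    (hc : c ≠ 0)
    (hi : ∀ k > 0, IntegrableOn (fun τ => τ ^ (b - 1) * (Real.exp (-(τ * (k ^ 2 + m ^ 2))) - κ))
      (Set.Ioi 0))
    (hn : ∀ k > 0, ∫ τ in Set.Ioi (0 : ℝ), |τ ^ (b - 1) * (Real.exp (-(τ * (k ^ 2 + m ^ 2))) - κ)| =
      |c| * σ k)
    (he : ∀ k > 0, ∫ τ in Set.Ioi (0 : ℝ), τ ^ (b - 1) * (Real.exp (-(τ * (k ^ 2 + m ^ 2))) - κ) =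
      c * σ k) :
    FarKernel σ fun r => c⁻¹ * heatSuperposition b m r where
  admissible := hσ
  continuousOn := continuousOn_const.mul (continuousOn_heatSuperposition hb m)
  bounded := ⟨|c⁻¹| * heatSuperposition b 0 1, fun r hr => by
    rw [abs_mul]
    exact mul_le_mul_of_nonneg_left (heatSuperposition_le hb m hr) (abs_nonneg _)⟩
  repr := by
    intro φ y hφ
    -- This is what removes the `κ` term: its contribution is a multiple of `φ y`.
    have hy : φ y = 0 := by
      refine image_eq_zero_of_notMem_tsupport fun h => ?_
      have := hφ h
      simp only [Set.mem_ofPred_eq, sub_self, norm_zero] at this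
      linarith
    set p : Space → ℂ := fun ξ => (𝐞 (-(inner ℝ y ξ)) : ℂ) * (𝓕⁻ φ : 𝓢(Space, ℂ)) ξ with hp
    have hpn : ∀ ξ, ‖p ξ‖ = ‖(𝓕⁻ φ : 𝓢(Space, ℂ)) ξ‖ := fun ξ => by
      rw [hp, norm_mul, norm_char, one_mul]
    have hpc : Continuous p := (continuous_char y).mul (𝓕⁻ φ : 𝓢(Space, ℂ)).continuous
    have hpi : Integrable p :=
      ((𝓕⁻ φ : 𝓢(Space, ℂ)).integrable.norm.congr (ae_of_all _ fun ξ => (hpn ξ).symm)).mono'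
        hpc.aestronglyMeasurable (ae_of_all _ fun ξ => le_rfl)
    set h : Space → ℝ → ℝ := fun ξ τ =>
      τ ^ (b - 1) * (Real.exp (-(τ * (waveNumber ξ ^ 2 + m ^ 2))) - κ) with hh
    have hmeas : Measurable fun z : Space × ℝ => h z.1 z.2 := by
      have := continuous_waveNumber.measurable
      simp only [hh]
      fun_prop
    have hF : Integrable (Function.uncurry fun (ξ : Space) (τ : ℝ) => (h ξ τ : ℂ) * p ξ)
        (volume.prod (volume.restrict (Set.Ioi 0))) := by
      rw [integrable_prod_iff]
      · constructor
        · filter_upwards [ae_ne_zero] with ξ hξ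
          exact (Integrable.ofReal (𝕜 := ℂ) (hi _ (waveNumber_pos hξ))).mul_const (p ξ)
        · have := ((hσ.integrable_mul_schwartz (𝓕⁻ φ)).norm).const_mul |c|
          refine this.congr ?_
          filter_upwards [ae_ne_zero] with ξ hξ
          simp only [Function.uncurry_apply_pair, norm_mul, Complex.norm_real, Real.norm_eq_abs,
            hpn]
          rw [integral_mul_const, hn _ (waveNumber_pos hξ)]
          have hσ0 : 0 ≤ σ (waveNumber ξ) := by
            have h1 : 0 ≤ |c| * σ (waveNumber ξ) := by
              rw [← hn _ (waveNumber_pos hξ)]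
              exact integral_nonneg fun _ => abs_nonneg _
            exact nonneg_of_mul_nonneg_right h1 (abs_pos.2 hc)
          rw [abs_of_nonneg hσ0]
          ring
      · exact ((Complex.measurable_ofReal.comp hmeas).mul
          (hpc.measurable.comp measurable_fst)).aestronglyMeasurable
    have e1 : ∫ ξ, (σ (waveNumber ξ) : ℂ) * p ξ =
        (c : ℂ)⁻¹ * ∫ ξ, ∫ τ in Set.Ioi (0 : ℝ), (h ξ τ : ℂ) * p ξ := by
      rw [← integral_const_mul]
      refine integral_congr_ae ?_
      filter_upwards [ae_ne_zero] with ξ hξ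
      rw [integral_mul_const, integral_complex_ofReal, he _ (waveNumber_pos hξ)]
      push_cast
      have : (c : ℂ) ≠ 0 := by exact_mod_cast hc
      field_simp
    have e2 : ∀ τ ∈ Set.Ioi (0 : ℝ), ∫ ξ, (h ξ τ : ℂ) * p ξ =
        ∫ x, ((τ ^ (b - 1) * heatKernel m τ ‖x - y‖ : ℝ) : ℂ) * φ x := by
      intro τ hτ
      have hτ0 : 0 < τ := hτ
      have a1 : ∀ ξ, (h ξ τ : ℂ) * p ξ = ((τ ^ (b - 1) : ℝ) : ℂ) *
          ((Real.exp (-(τ * (waveNumber ξ ^ 2 + m ^ 2))) : ℂ) * p ξ - κ * p ξ) := by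
        intro ξ
        rw [hh]
        push_cast
        ring
      rw [integral_congr_ae (ae_of_all _ a1), integral_const_mul, integral_sub,
        integral_gaussian_mul_fourierInv m hτ0, integral_const_mul, integral_char_mul_fourierInv, hy,
        mul_zero, sub_zero, ← integral_const_mul]
      · refine integral_congr_ae (ae_of_all _ fun x => ?_)
        push_cast
        ring
      · refine hpi.norm.mono' ?_ (ae_of_all _ fun ξ => ?_)
        · have := continuous_waveNumber
          exact Continuous.aestronglyMeasurable (by fun_prop)
        · rw [norm_mul, Complex.norm_real, Real.norm_eq_abs, Real.abs_exp]
          refine mul_le_of_le_one_left (norm_nonneg _) (Real.exp_le_one_iff.2 ?_)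
          have : 0 ≤ τ * (waveNumber ξ ^ 2 + m ^ 2) := by positivity
          linarith
      · exact hpi.const_mul _
    -- On the support of `φ` the distance to `y` is at least `1`, so the massless heat kernel at
    -- distance `1` dominates uniformly in `x`.
    have hG : Integrable (Function.uncurry fun (τ : ℝ) (x : Space) =>
        ((τ ^ (b - 1) * heatKernel m τ ‖x - y‖ : ℝ) : ℂ) * φ x)
        ((volume.restrict (Set.Ioi 0)).prod volume) := by
      have hd := Integrable.mul_prod (integrable_heatKernel hb one_pos)
        (φ.integrable (μ := volume)).norm
      refine Integrable.mono' hd ?_ ?_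
      · refine Measurable.aestronglyMeasurable ?_
        have m1 := φ.continuous.measurable
        have m2 : Measurable fun z : ℝ × Space => heatKernel m z.1 ‖z.2 - y‖ := by
          unfold heatKernel
          fun_prop
        change Measurable fun z : ℝ × Space =>
          ((z.1 ^ (b - 1) * heatKernel m z.1 ‖z.2 - y‖ : ℝ) : ℂ) * φ z.2
        fun_prop
      · have : ∀ᵐ z : ℝ × Space ∂((volume.restrict (Set.Ioi (0 : ℝ))).prod volume),
            z.1 ∈ Set.Ioi (0 : ℝ) := by
          have h0 : ∀ᵐ τ : ℝ ∂volume.restrict (Set.Ioi (0 : ℝ)), τ ∈ Set.Ioi (0 : ℝ) :=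
            ae_restrict_mem measurableSet_Ioi
          exact Measure.quasiMeasurePreserving_fst.ae h0
        filter_upwards [this] with z hz
        have hz0 : 0 < z.1 := hz
        change ‖((z.1 ^ (b - 1) * heatKernel m z.1 ‖z.2 - y‖ : ℝ) : ℂ) * φ z.2‖ ≤
          z.1 ^ (b - 1) * heatKernel 0 z.1 1 * ‖φ z.2‖
        by_cases hx : z.2 ∈ tsupport φ
        · have h1 : 1 ≤ ‖z.2 - y‖ := hφ hx
          have := heatKernel_pos m ‖z.2 - y‖ hz0
          rw [norm_mul, Complex.norm_real, Real.norm_of_nonneg (by positivity)]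
          refine mul_le_mul_of_nonneg_right ?_ (norm_nonneg _)
          exact mul_le_mul_of_nonneg_left (heatKernel_le hz0 zero_le_one h1) (by positivity)
        · simp [image_eq_zero_of_notMem_tsupport hx]
    rw [e1, integral_integral_swap hF, setIntegral_congr_fun measurableSet_Ioi e2,
      integral_integral_swap hG, ← integral_const_mul]
    refine integral_congr_ae (ae_of_all _ fun x => ?_)
    simp only
    rw [integral_mul_const, integral_complex_ofReal]
    unfold heatSuperposition
    push_cast
    ring

/-- Without mass the substitution `τ = r² u` removes `r` from the Gaussian: the weight, the
prefactor and the measure contribute the powers `2(b - 1)`, `-3` and `2`. -/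
lemma heatSuperposition_zero_mass (b : ℝ) {r : ℝ} (hr : 0 < r) :
    heatSuperposition b 0 r = heatSuperposition b 0 1 * r ^ (2 * b - 3) := by
  unfold heatSuperposition
  have h := integral_comp_mul_left_Ioi (fun τ => τ ^ (b - 1) * heatKernel 0 τ r) 0
    (b := r ^ 2) (by positivity)
  rw [mul_zero, smul_eq_mul] at h
  have e : ∫ u in Set.Ioi (0 : ℝ), (r ^ 2 * u) ^ (b - 1) * heatKernel 0 (r ^ 2 * u) r =
      r ^ (2 * b - 5) * ∫ τ in Set.Ioi (0 : ℝ), τ ^ (b - 1) * heatKernel 0 τ 1 := by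
    rw [← integral_const_mul]
    refine setIntegral_congr_fun measurableSet_Ioi fun u hu => ?_
    have hu0 : 0 < u := hu
    simp only [heatKernel]
    rw [Real.mul_rpow (by positivity) hu0.le,
      show 4 * Real.pi * (r ^ 2 * u) = r ^ 2 * (4 * Real.pi * u) by ring,
      Real.mul_rpow (by positivity) (by positivity : 0 ≤ 4 * Real.pi * u),
      show r ^ 2 / (4 * (r ^ 2 * u)) = 1 ^ 2 / (4 * u) by field_simp, ← Real.rpow_natCast r 2,
      ← Real.rpow_mul hr.le, ← Real.rpow_mul hr.le]
    have : r ^ (2 * b - 5) = r ^ (((2 : ℕ) : ℝ) * (b - 1)) * r ^ (((2 : ℕ) : ℝ) * (-(3 / 2))) := by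
      rw [← Real.rpow_add hr]
      congr 1
      push_cast
      ring
    rw [this]
    ring_nf
  rw [e] at h
  have h2 : r ^ (2 * b - 3) = r ^ 2 * r ^ (2 * b - 5) := by
    rw [← Real.rpow_natCast r 2, ← Real.rpow_add hr]
    congr 1
    push_cast
    ring
  have hr2 : r ^ 2 ≠ 0 := by positivity
  rw [h2]
  field_simp at h
  linarith

namespace FarKernel

variable {σ τ K L : ℝ → ℝ}

lemma congr (h : FarKernel σ K) (e : ∀ k > 0, τ k = σ k) (e' : ∀ r > 0, L r = K r) :
    FarKernel τ L where
  admissible := h.admissible.congr e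
  continuousOn := h.continuousOn.congr e'
  bounded := by
    obtain ⟨C, hC⟩ := h.bounded
    exact ⟨C, fun r hr => by rw [e' r (by linarith)]; exact hC r hr⟩
  repr := by
    intro φ y hφ
    have h1 : ∫ x, (L ‖x - y‖ : ℂ) * φ x = ∫ x, (K ‖x - y‖ : ℂ) * φ x := by
      refine integral_congr_ae (ae_of_all _ fun x => ?_)
      by_cases hx : x ∈ tsupport φ
      · have : 1 ≤ ‖x - y‖ := hφ hx
        simp only
        rw [e' _ (by linarith)]
      · simp [image_eq_zero_of_notMem_tsupport hx]
    rw [h1, ← h.repr φ y hφ]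
    refine integral_congr_ae ?_
    filter_upwards [ae_ne_zero] with ξ hξ
    rw [e _ (waveNumber_pos hξ)]

/-- The Gamma integral represents `Γ(b) k ^ (-2b)` as a superposition of Gaussians; no subtraction
is needed because `b > 0`. -/
lemma rpow {b : ℝ} (h₀ : 0 < b) (h₁ : b < 3 / 2) :
    ∃ C : ℝ, C ≠ 0 ∧ FarKernel (fun k => k ^ (-2 * b)) fun r => C * r ^ (2 * b - 3) := by
  have hG := Real.Gamma_pos_of_pos h₀
  have he : ∀ k > (0 : ℝ), ∫ τ in Set.Ioi (0 : ℝ),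
      τ ^ (b - 1) * (Real.exp (-(τ * (k ^ 2 + 0 ^ 2))) - 0) = Real.Gamma b * k ^ (-2 * b) := by
    intro k hk
    have h := Real.integral_rpow_mul_exp_neg_mul_Ioi h₀ (r := k ^ 2) (by positivity)
    have e : (1 / k ^ 2) ^ b = k ^ (-2 * b) := by
      rw [Real.rpow_mul hk.le, Real.rpow_neg hk.le]
      norm_num
    rw [e] at h
    rw [mul_comm (Real.Gamma b), ← h]
    refine setIntegral_congr_fun measurableSet_Ioi fun t _ => ?_
    ring_nf
  refine ⟨(Real.Gamma b)⁻¹ * heatSuperposition b 0 1,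
    mul_ne_zero (inv_ne_zero hG.ne') (heatSuperposition_pos h₁ 0 one_pos).ne', ?_⟩
  refine (of_superposition (IsAdmissible.rpow (by linarith) (by linarith)) (m := 0) (κ := 0)
    (c := Real.Gamma b) h₁ hG.ne' ?_ ?_ he).congr (fun _ _ => rfl) ?_
  · intro k hk
    have := integrableOn_rpow_mul_exp_neg_mul_rpow (s := b - 1) (p := 1) (b := k ^ 2)
      (by linarith) one_pos (by positivity)
    refine this.congr_fun (fun t _ => ?_) measurableSet_Ioi
    simp only [Real.rpow_one]
    ring_nf
  · intro k hk
    rw [abs_of_pos hG, ← he k hk]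
    refine setIntegral_congr_fun measurableSet_Ioi fun t ht => ?_
    have ht0 : 0 < t := ht
    simp only [sub_zero]
    rw [abs_of_pos (by positivity)]
  · intro r hr
    rw [heatSuperposition_zero_mass b hr]
    ring

lemma _root_.BDPartner.IsAdmissible.sqrt (m : ℝ) : IsAdmissible fun k => √(k ^ 2 + m ^ 2) := by
  refine IsAdmissible.of_continuous (by fun_prop) ⟨1 + |m|, fun k hk => ?_⟩
  rw [abs_of_nonneg (Real.sqrt_nonneg _)]
  refine Real.sqrt_le_iff.2 ⟨by positivity, ?_⟩
  have h1 := sq_abs m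
  have h2 := abs_nonneg m
  have h3 : 0 ≤ |m| ^ 2 * (k ^ 2 - 1) := mul_nonneg (by positivity) (by nlinarith)
  have h4 : 0 ≤ |m| * k ^ 2 := by positivity
  nlinarith

lemma _root_.BDPartner.IsAdmissible.inv_sqrt (m : ℝ) :
    IsAdmissible fun k => (√(k ^ 2 + m ^ 2))⁻¹ := by
  have hle : ∀ k > 0, |(√(k ^ 2 + m ^ 2))⁻¹| ≤ k ^ (-1 : ℝ) := by
    intro k hk
    rw [abs_of_nonneg (by positivity), Real.rpow_neg_one]
    refine inv_anti₀ hk (Real.le_sqrt_of_sq_le ?_)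
    nlinarith [sq_nonneg m]
  have hc : ContinuousOn (fun k => (√(k ^ 2 + m ^ 2))⁻¹) (Set.Ioi 0) := by
    refine ContinuousOn.inv₀ (by fun_prop) fun k hk => ?_
    have : 0 < k := hk
    positivity
  refine ⟨hc, ?_, 1, fun k hk => ?_⟩
  · refine Integrable.mono' (IsAdmissible.rpow (a := -1) (by norm_num) (by norm_num)).integrableOn
      (aestronglyMeasurable_of_continuousOn_compl_zero (continuousOn_comp_waveNumber hc)).restrict
      (ae_restrict_of_ae ?_)
    filter_upwards [ae_ne_zero] with ξ hξ
    exact hle _ (waveNumber_pos hξ)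
  · refine (hle k (by linarith)).trans ?_
    rw [Real.rpow_neg_one, one_mul]
    exact (inv_le_one_of_one_le₀ hk).trans hk

/-- Subtracting `1` gains one power of `τ` at the origin, making `τ ^ (-3/2)` into `τ ^ (-1/2)`; at
infinity `τ ^ (-3/2)` is integrable by itself. -/
lemma integrableOn_rpow_mul_exp_sub_one {A : ℝ} (hA : 0 < A) :
    IntegrableOn (fun τ : ℝ => τ ^ (-1 / 2 - 1 : ℝ) * (Real.exp (-(τ * A)) - 1)) (Set.Ioi 0) := by
  have hm : AEStronglyMeasurable (fun τ : ℝ => τ ^ (-1 / 2 - 1 : ℝ) * (Real.exp (-(τ * A)) - 1)) :=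
    Measurable.aestronglyMeasurable (by fun_prop)
  have habs : ∀ t > 0, |Real.exp (-(t * A)) - 1| = 1 - Real.exp (-(t * A)) := fun t ht => by
    rw [abs_of_nonpos, neg_sub]
    have : 0 < t * A := by positivity
    simpa using this.le
  rw [← Set.Ioc_union_Ioi_eq_Ioi zero_le_one, integrableOn_union]
  constructor
  · have h0 : IntegrableOn (fun τ : ℝ => A * τ ^ (-1 / 2 : ℝ)) (Set.Ioc 0 1) :=
      Integrable.const_mul (intervalIntegral.intervalIntegrable_rpow' (a := 0) (b := 1)
        (by norm_num : (-1 : ℝ) < -1 / 2)).1 _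
    refine Integrable.mono' h0 hm.restrict
      ((ae_restrict_iff' measurableSet_Ioc).2 (ae_of_all _ fun t ht => ?_))
    have ht0 : 0 < t := ht.1
    rw [norm_mul, Real.norm_of_nonneg (by positivity), Real.norm_eq_abs, habs t ht0]
    have h1 : 1 - Real.exp (-(t * A)) ≤ t * A := by linarith [Real.add_one_le_exp (-(t * A))]
    refine (mul_le_mul_of_nonneg_left h1 (by positivity)).trans_eq ?_
    rw [Real.rpow_sub_one ht0.ne']
    field_simp
  · refine Integrable.mono' (integrableOn_Ioi_rpow_of_lt (by norm_num : (-1 / 2 - 1 : ℝ) < -1)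
      one_pos) hm.restrict ((ae_restrict_iff' measurableSet_Ioi).2 (ae_of_all _ fun t ht => ?_))
    have ht0 : 0 < t := lt_trans one_pos ht
    rw [norm_mul, Real.norm_of_nonneg (by positivity), Real.norm_eq_abs, habs t ht0]
    exact mul_le_of_le_one_right (by positivity) (by linarith [Real.exp_pos (-(t * A))])

/-- This is the superposition with `b = -1/2` and `κ = 1`. By scaling, the subtracted integral is
proportional to the square root; of the constant only its negative sign is needed. -/
lemma sqrt (m : ℝ) : ∃ C : ℝ, C ≠ 0 ∧ FarKernel (fun k => √(k ^ 2 + m ^ 2)) fun r =>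
    C * heatSuperposition (-1 / 2) m r := by
  set c := ∫ τ in Set.Ioi (0 : ℝ), τ ^ (-1 / 2 - 1 : ℝ) * (Real.exp (-τ) - 1) with hc
  have hneg : ∀ t > (0 : ℝ), ∀ A > 0, t ^ (-1 / 2 - 1 : ℝ) * (Real.exp (-(t * A)) - 1) < 0 := by
    intro t ht A hA
    refine mul_neg_of_pos_of_neg (by positivity) ?_
    have : 0 < t * A := by positivity
    simpa using this
  have hc0 : c < 0 := by
    have hi := (integrableOn_rpow_mul_exp_sub_one one_pos).neg
    rw [← neg_pos, hc, ← integral_neg]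
    have hn : ∀ t > (0 : ℝ), t ^ (-1 / 2 - 1 : ℝ) * (Real.exp (-t) - 1) < 0 := fun t ht => by
      simpa using hneg t ht 1 one_pos
    rw [setIntegral_pos_iff_support_of_nonneg_ae]
    · have : Set.Ioi (0 : ℝ) ⊆ (Function.support fun t : ℝ =>
          -(t ^ (-1 / 2 - 1 : ℝ) * (Real.exp (-t) - 1))) ∩ Set.Ioi 0 :=
        fun t ht => ⟨neg_ne_zero.2 (hn t ht).ne, ht⟩
      exact lt_of_lt_of_le (by simp) (measure_mono this)
    · refine (ae_restrict_iff' measurableSet_Ioi).2 (ae_of_all _ fun t ht => ?_)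
      simpa using (hn t ht).le
    · simpa using hi
  have he : ∀ k > (0 : ℝ), ∫ τ in Set.Ioi (0 : ℝ),
      τ ^ (-1 / 2 - 1 : ℝ) * (Real.exp (-(τ * (k ^ 2 + m ^ 2))) - 1) = c * √(k ^ 2 + m ^ 2) := by
    intro k hk
    set A := k ^ 2 + m ^ 2 with hAd
    have hA : 0 < A := by positivity
    have h := integral_comp_mul_left_Ioi (fun t : ℝ => t ^ (-1 / 2 - 1 : ℝ) * (Real.exp (-t) - 1)) 0
      hA
    rw [mul_zero, ← hc, smul_eq_mul] at h
    have e : ∫ t in Set.Ioi (0 : ℝ), (A * t) ^ (-1 / 2 - 1 : ℝ) * (Real.exp (-(A * t)) - 1) =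
        A ^ (-1 / 2 - 1 : ℝ) *
          ∫ τ in Set.Ioi (0 : ℝ), τ ^ (-1 / 2 - 1 : ℝ) * (Real.exp (-(τ * A)) - 1) := by
      rw [← integral_const_mul]
      refine setIntegral_congr_fun measurableSet_Ioi fun t ht => ?_
      have ht0 : 0 < t := ht
      rw [Real.mul_rpow hA.le ht0.le, mul_comm A t, mul_assoc]
    rw [e] at h
    have h2 : A ^ (-1 / 2 - 1 : ℝ) * √A = A⁻¹ := by
      rw [Real.sqrt_eq_rpow, ← Real.rpow_add hA, ← Real.rpow_neg_one]
      norm_num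
    have h3 : A ^ (-1 / 2 - 1 : ℝ) ≠ 0 := by positivity
    apply mul_left_cancel₀ h3
    rw [h, ← h2]
    ring
  refine ⟨c⁻¹, inv_ne_zero hc0.ne, of_superposition (IsAdmissible.sqrt m) (κ := 1) (by norm_num)
    hc0.ne ?_ ?_ he⟩
  · exact fun k hk => integrableOn_rpow_mul_exp_sub_one (by positivity)
  · intro k hk
    rw [abs_of_neg hc0, neg_mul, ← he k hk, ← integral_neg]
    refine setIntegral_congr_fun measurableSet_Ioi fun t ht => ?_
    exact abs_of_neg (hneg t ht _ (by positivity))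

lemma inv_sqrt (m : ℝ) : ∃ C : ℝ, C ≠ 0 ∧ FarKernel (fun k => (√(k ^ 2 + m ^ 2))⁻¹) fun r =>
    C * heatSuperposition (1 / 2) m r := by
  have hG := Real.Gamma_pos_of_pos (one_half_pos (α := ℝ))
  have he : ∀ k > (0 : ℝ), ∫ τ in Set.Ioi (0 : ℝ),
      τ ^ (1 / 2 - 1 : ℝ) * (Real.exp (-(τ * (k ^ 2 + m ^ 2))) - 0) =
        Real.Gamma (1 / 2) * (√(k ^ 2 + m ^ 2))⁻¹ := by
    intro k hk
    have h := Real.integral_rpow_mul_exp_neg_mul_Ioi (one_half_pos (α := ℝ))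
      (r := k ^ 2 + m ^ 2) (by positivity)
    rw [← Real.sqrt_eq_rpow, one_div (k ^ 2 + m ^ 2), Real.sqrt_inv] at h
    rw [mul_comm (Real.Gamma (1 / 2)), ← h]
    refine setIntegral_congr_fun measurableSet_Ioi fun t _ => ?_
    simp only [sub_zero, mul_comm]
  refine ⟨(Real.Gamma (1 / 2))⁻¹, inv_ne_zero hG.ne',
    of_superposition (IsAdmissible.inv_sqrt m) (κ := 0) (by norm_num) hG.ne' ?_ ?_ he⟩
  · intro k hk
    have := integrableOn_rpow_mul_exp_neg_mul_rpow (s := 1 / 2 - 1) (p := 1) (b := k ^ 2 + m ^ 2)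
      (by norm_num) one_pos (by positivity)
    refine this.congr_fun (fun t _ => ?_) measurableSet_Ioi
    simp only [Real.rpow_one]
    ring_nf
  · intro k hk
    rw [abs_of_pos hG, ← he k hk]
    refine setIntegral_congr_fun measurableSet_Ioi fun t ht => ?_
    have ht0 : 0 < t := ht
    simp only [sub_zero]
    rw [abs_of_pos (by positivity)]

/-- The multiplier `|k|`. -/
lemma id : ∃ C : ℝ, C ≠ 0 ∧ FarKernel (fun k => k) fun r => C * r ^ (-4 : ℝ) := by
  obtain ⟨C, hC, h⟩ := sqrt 0
  refine ⟨C * heatSuperposition (-1 / 2) 0 1,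
    mul_ne_zero hC (heatSuperposition_pos (by norm_num) 0 one_pos).ne', h.congr ?_ ?_⟩
  · intro k hk
    simp [Real.sqrt_sq hk.le]
  · intro r hr
    rw [heatSuperposition_zero_mass _ hr]
    norm_num
    ring

end FarKernel

/-- The exponent equals `-m r - (r - 2mτ)²/(4τ)`. Enough of the square is kept to dominate by the
massless heat kernel at distance `1`. -/
lemma heatSuperposition_le_exp {b m : ℝ} (hb : b < 3 / 2) (hm : 0 < m) :
    ∃ C, ∀ r ≥ 2 * m + 1, |heatSuperposition b m r| ≤ C * Real.exp (-m * r) := by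
  refine ⟨Real.exp (1 / 4) * heatSuperposition b 0 1, fun r hr => ?_⟩
  have hr0 : 0 < r := by linarith
  rw [abs_of_pos (heatSuperposition_pos hb m hr0), mul_right_comm]
  unfold heatSuperposition
  rw [← integral_const_mul]
  refine setIntegral_mono_on (integrable_rpow_mul_heatKernel hb m hr0)
    (Integrable.const_mul (integrable_heatKernel hb one_pos) _) measurableSet_Ioi fun τ hτ => ?_
  have hτ0 : 0 < τ := hτ
  rw [mul_left_comm]
  refine mul_le_mul_of_nonneg_left ?_ (by positivity)
  unfold heatKernel
  rw [mul_left_comm]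
  refine mul_le_mul_of_nonneg_left ?_ (by positivity)
  rw [← Real.exp_add, ← Real.exp_add]
  refine Real.exp_le_exp.2 ?_
  -- For `τ ≥ 1` the left side is nonpositive; for `τ ≤ 1` the condition `r ≥ 2m + 1` gives `r - 2mτ
  -- ≥ 1`. The `1/4` is the source of the factor `exp (1/4)`.
  have key : 1 / (4 * τ) - 1 / 4 ≤ (r - 2 * m * τ) ^ 2 / (4 * τ) := by
    rw [div_sub_div _ _ (by positivity) (by positivity), div_le_div_iff₀ (by positivity)
      (by positivity)]
    rcases le_total 1 τ with h | h
    · have : 0 ≤ (r - 2 * m * τ) ^ 2 * (4 * τ * 4) := by positivity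
      nlinarith
    · have h1 : 1 ≤ r - 2 * m * τ := by nlinarith
      have h2 : 1 ≤ (r - 2 * m * τ) ^ 2 := by nlinarith
      nlinarith
  have e : (r - 2 * m * τ) ^ 2 / (4 * τ) = r ^ 2 / (4 * τ) + m ^ 2 * τ - m * r := by
    field_simp
    ring
  rw [e] at key
  rw [one_pow]
  linarith

/-! ### Far-field representatives of distributions -/

/-- Convolution with a radial kernel. -/
def radialConv (K : ℝ → ℝ) (f : Space → ℂ) (x : Space) : ℂ := ∫ y, (K ‖x - y‖ : ℂ) * f y

/-- The distribution with Fourier transform `u` is a continuous function `h` outside the ball of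
radius `ρ`. -/
structure FarRep (u h : Space → ℂ) (ρ : ℝ) : Prop where
  continuousOn_symbol : ContinuousOn u {0}ᶜ
  integrable : ∀ φ : 𝓢(Space, ℂ), Integrable fun ξ => u ξ * φ ξ
  continuousOn : ContinuousOn h (outside ρ)
  equalsOn : EqualsOn u h (outside ρ)

lemma outside_anti {ρ ρ' : ℝ} (h : ρ ≤ ρ') : outside ρ' ⊆ outside ρ := fun _ hx => lt_of_le_of_lt h hx

lemma integrable_mul_of_tsupport_subset {h φ : Space → ℂ} {U : Set Space} (hh : ContinuousOn h U)
    (hφ : Continuous φ) (hc : HasCompactSupport φ) (hs : tsupport φ ⊆ U) :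
    Integrable fun x => h x * φ x := by
  have h1 : IntegrableOn (fun x => h x * φ x) (tsupport φ) :=
    ((hh.mono hs).mul hφ.continuousOn).integrableOn_compact hc
  refine (integrableOn_iff_integrable_of_support_subset ?_).1 h1
  intro x hx
  exact subset_tsupport _ (right_ne_zero_of_mul hx)

namespace FarRep

variable {u v h k : Space → ℂ} {ρ ρ' : ℝ}

lemma mono (H : FarRep u h ρ) (hρ : ρ ≤ ρ') : FarRep u h ρ' :=
  ⟨H.1, H.2, H.3.mono (outside_anti hρ), fun φ hc hs => H.4 φ hc (hs.trans (outside_anti hρ))⟩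

lemma add (H : FarRep u h ρ) (H' : FarRep v k ρ) :
    FarRep (fun ξ => u ξ + v ξ) (fun x => h x + k x) ρ where
  continuousOn_symbol := H.1.add H'.1
  integrable φ := ((H.2 φ).add (H'.2 φ)).congr (ae_of_all _ fun ξ => (add_mul _ _ _).symm)
  continuousOn := H.3.add H'.3
  equalsOn φ hc hs := by
    simp only [add_mul]
    rw [integral_add (H.2 _) (H'.2 _),
      integral_add (integrable_mul_of_tsupport_subset H.3 φ.continuous hc hs)
        (integrable_mul_of_tsupport_subset H'.3 φ.continuous hc hs), H.4 φ hc hs, H'.4 φ hc hs]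

lemma const_mul (H : FarRep u h ρ) (c : ℂ) : FarRep (fun ξ => c * u ξ) (fun x => c * h x) ρ where
  continuousOn_symbol := continuousOn_const.mul H.1
  integrable φ := by simpa only [mul_assoc] using (H.2 φ).const_mul c
  continuousOn := continuousOn_const.mul H.3
  equalsOn φ hc hs := by
    simp only [mul_assoc]
    rw [integral_const_mul, integral_const_mul, H.4 φ hc hs]

/-- The Fourier transform of a function supported in a ball. -/
lemma of_support {f : Space → ℂ} (hf : Integrable f) {R : ℝ} (hR : ∀ x, f x ≠ 0 → ‖x‖ ≤ R) :
    FarRep (𝓕 f) (fun _ => 0) R where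
  continuousOn_symbol := (fourier_continuous hf).continuousOn
  integrable φ := φ.integrable.bdd_mul (c := ∫ x, ‖f x‖)
    (fourier_continuous hf).aestronglyMeasurable (ae_of_all _ (norm_fourier_le f))
  continuousOn := continuousOn_const
  equalsOn φ hc hs := by
    have e : 𝓕 (⇑(𝓕⁻ φ : 𝓢(Space, ℂ))) = φ := by
      rw [← SchwartzMap.fourier_coe]
      simp
    rw [integral_fourier_mul_eq hf (𝓕⁻ φ : 𝓢(Space, ℂ)).integrable, e]
    refine integral_congr_ae (ae_of_all _ fun x => ?_)
    simp only [zero_mul]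
    by_contra hx
    have h1 := hR x (left_ne_zero_of_mul hx)
    have h2 : R < ‖x‖ := hs (subset_tsupport _ (right_ne_zero_of_mul hx))
    linarith

end FarRep

section Kernel

variable {σ K : ℝ → ℝ} {f : Space → ℂ} {R : ℝ}

lemma one_le_norm_sub {x y : Space} (hx : x ∈ outside (R + 1)) (hy : ‖y‖ ≤ R) : 1 ≤ ‖x - y‖ := by
  have h1 : R + 1 < ‖x‖ := hx
  have h2 := norm_sub_norm_le x y
  linarith

lemma continuousOn_radialConv (H : FarKernel σ K) (hf : Integrable f)
    (hR : ∀ x, f x ≠ 0 → ‖x‖ ≤ R) : ContinuousOn (radialConv K f) (outside (R + 1)) := by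
  obtain ⟨C, hC⟩ := H.bounded
  have hc : ∀ y, f y ≠ 0 → ContinuousOn (fun x => (K ‖x - y‖ : ℂ) * f y) (outside (R + 1)) := by
    intro y hy
    refine ContinuousOn.mul (Complex.continuous_ofReal.comp_continuousOn
      (H.continuousOn.comp (by fun_prop) fun x hx => ?_)) continuousOn_const
    have := one_le_norm_sub hx (hR y hy)
    exact lt_of_lt_of_le one_pos this
  refine continuousOn_of_dominated (bound := fun y => C * ‖f y‖) ?_ ?_ (hf.norm.const_mul C) ?_
  · intro x hx
    -- The kernel is controlled only at positive distances, so measurability is established on the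
    -- ball containing the source and extended by zero.
    have hm : ContinuousOn (fun y => (K ‖x - y‖ : ℂ)) (Metric.closedBall 0 R) := by
      refine Complex.continuous_ofReal.comp_continuousOn
        (H.continuousOn.comp (by fun_prop) fun y hy => ?_)
      have := one_le_norm_sub hx (mem_closedBall_zero_iff.1 hy)
      exact lt_of_lt_of_le one_pos this
    have h1 := (hm.aestronglyMeasurable (μ := volume) Metric.isClosed_closedBall.measurableSet).mul
      hf.aestronglyMeasurable.restrict
    have h2 := (aestronglyMeasurable_indicator_iff
      (Metric.isClosed_closedBall (x := (0 : Space)) (ε := R)).measurableSet).2 h1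
    refine h2.congr (ae_of_all _ fun y => ?_)
    by_cases hy : f y = 0
    · simp [Set.indicator, hy]
    · rw [Set.indicator_of_mem (mem_closedBall_zero_iff.2 (hR y hy))]
      rfl
  · intro x hx
    refine ae_of_all _ fun y => ?_
    by_cases hy : f y = 0
    · simp [hy]
    · rw [norm_mul, Complex.norm_real]
      exact mul_le_mul_of_nonneg_right (hC _ (one_le_norm_sub hx (hR y hy))) (norm_nonneg _)
  · refine ae_of_all _ fun y => ?_
    by_cases hy : f y = 0
    · simp only [hy, mul_zero]
      exact continuousOn_const
    · exact hc y hy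

/-- The transform of `f` is a superposition of characters, one for each source point `y`, so the
kernel formula is integrated against `f y`. The enlarged radius `R + 1` keeps test functions at
distance at least `1` from every source point. -/
lemma FarKernel.farRep (H : FarKernel σ K) (hf : Integrable f) (hR : ∀ x, f x ≠ 0 → ‖x‖ ≤ R) :
    FarRep (fun ξ => (σ (waveNumber ξ) : ℂ) * 𝓕 f ξ) (radialConv K f) (R + 1) where
  continuousOn_symbol := (Complex.continuous_ofReal.comp_continuousOn
    (continuousOn_comp_waveNumber H.admissible.continuousOn)).mul (fourier_continuous hf).continuousOn
  integrable φ := by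
    have := (H.admissible.integrable_mul_schwartz φ).bdd_mul (c := ∫ x, ‖f x‖)
      (fourier_continuous hf).aestronglyMeasurable (ae_of_all _ (norm_fourier_le f))
    refine this.congr (ae_of_all _ fun ξ => ?_)
    ring
  continuousOn := continuousOn_radialConv H hf hR
  equalsOn := by
    intro φ hc hs
    obtain ⟨C, hC⟩ := H.bounded
    set ψ := (𝓕⁻ φ : 𝓢(Space, ℂ)) with hψ
    have hI : Integrable (Function.uncurry fun (ξ y : Space) =>
        ((σ (waveNumber ξ) : ℂ) * ψ ξ) * ((𝐞 (-(inner ℝ y ξ)) : ℂ) * f y))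
        (volume.prod volume) := by
      refine (Integrable.mul_prod (H.admissible.integrable_mul_schwartz ψ) hf).mono ?_ ?_
      · refine AEStronglyMeasurable.mul ?_ (AEStronglyMeasurable.mul ?_ ?_)
        · exact (H.admissible.integrable_mul_schwartz ψ).aestronglyMeasurable.comp_fst
        · refine Continuous.aestronglyMeasurable ?_
          exact continuous_subtype_val.comp (Real.continuous_fourierChar.comp (by fun_prop))
        · exact hf.aestronglyMeasurable.comp_snd
      · refine ae_of_all _ fun z => le_of_eq ?_
        simp only [Function.uncurry, norm_mul, norm_char, one_mul]
    have e1 : ∀ ξ, (σ (waveNumber ξ) : ℂ) * 𝓕 f ξ * ψ ξ =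
        ∫ y, ((σ (waveNumber ξ) : ℂ) * ψ ξ) * ((𝐞 (-(inner ℝ y ξ)) : ℂ) * f y) := by
      intro ξ
      rw [integral_const_mul, Real.fourier_eq]
      simp only [Circle.smul_def, smul_eq_mul]
      ring
    have e2 : ∀ y, ∫ ξ, ((σ (waveNumber ξ) : ℂ) * ψ ξ) * ((𝐞 (-(inner ℝ y ξ)) : ℂ) * f y) =
        ∫ x, (K ‖x - y‖ : ℂ) * f y * φ x := by
      intro y
      by_cases hy : f y = 0
      · simp [hy]
      · have := H.repr φ y fun x hx => one_le_norm_sub (hs hx) (hR y hy)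
        have a1 : ∀ ξ, ((σ (waveNumber ξ) : ℂ) * ψ ξ) * ((𝐞 (-(inner ℝ y ξ)) : ℂ) * f y) =
            ((σ (waveNumber ξ) : ℂ) * ((𝐞 (-(inner ℝ y ξ)) : ℂ) * ψ ξ)) * f y := fun ξ => by ring
        rw [integral_congr_ae (ae_of_all _ a1), integral_mul_const, this, ← integral_mul_const]
        refine integral_congr_ae (ae_of_all _ fun x => ?_)
        ring
    have hJ : Integrable (Function.uncurry fun (y x : Space) => (K ‖x - y‖ : ℂ) * f y * φ x)
        (volume.prod volume) := by
      have hm : AEStronglyMeasurable (fun z : Space × Space => (K ‖z.2 - z.1‖ : ℂ))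
          ((volume.prod volume).restrict {z | 0 < ‖z.2 - z.1‖}) := by
        refine ContinuousOn.aestronglyMeasurable ?_
          (isOpen_lt continuous_const (by fun_prop)).measurableSet
        exact Complex.continuous_ofReal.comp_continuousOn
          (H.continuousOn.comp (by fun_prop) fun z hz => hz)
      have hS : MeasurableSet {z : Space × Space | 0 < ‖z.2 - z.1‖} :=
        (isOpen_lt continuous_const (by fun_prop)).measurableSet
      have hm2 := (aestronglyMeasurable_indicator_iff hS).2 hm
      have hd := (Integrable.mul_prod hf (φ.integrable (μ := volume))).norm.const_mul C
      have key : ∀ z : Space × Space, f z.1 * φ z.2 ≠ 0 → 1 ≤ ‖z.2 - z.1‖ := fun z hz =>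
        one_le_norm_sub (hs (subset_tsupport _ (right_ne_zero_of_mul hz)))
          (hR _ (left_ne_zero_of_mul hz))
      refine Integrable.mono' hd ?_ (ae_of_all _ fun z => ?_)
      · have := hm2.mul (Integrable.mul_prod hf (φ.integrable (μ := volume))).aestronglyMeasurable
        refine this.congr (ae_of_all _ fun z => ?_)
        change Set.indicator _ _ z * (f z.1 * φ z.2) = (K ‖z.2 - z.1‖ : ℂ) * f z.1 * φ z.2
        by_cases hz : f z.1 * φ z.2 = 0
        · rw [mul_assoc, hz, mul_zero, mul_zero]
        · rw [Set.indicator_of_mem, mul_assoc]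
          exact lt_of_lt_of_le one_pos (key z hz)
      · change ‖(K ‖z.2 - z.1‖ : ℂ) * f z.1 * φ z.2‖ ≤ C * ‖f z.1 * φ z.2‖
        by_cases hz : f z.1 * φ z.2 = 0
        · rw [mul_assoc, hz]
          simp
        · rw [mul_assoc, norm_mul, Complex.norm_real]
          exact mul_le_mul_of_nonneg_right (hC _ (key z hz)) (norm_nonneg _)
    rw [integral_congr_ae (ae_of_all _ e1), integral_integral_swap hI,
      integral_congr_ae (ae_of_all _ e2), integral_integral_swap hJ]
    refine integral_congr_ae (ae_of_all _ fun x => ?_)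
    simp only [radialConv]
    rw [← integral_mul_const]

end Kernel

/-! ### Asymptotics of radial convolutions -/

section Asymptotics

variable {f : Space → ℂ} {R : ℝ}

instance : (cobounded Space).IsCountablyGenerated := by
  rw [← comap_norm_atTop]
  infer_instance

lemma tendsto_norm_sub_cobounded (x₀ : Space) :
    Tendsto (fun x => ‖x - x₀‖) (cobounded Space) atTop :=
  tendsto_norm_cobounded_atTop.comp (tendsto_sub_const_cobounded x₀)

lemma tendsto_norm_sub_div (x₀ y : Space) :
    Tendsto (fun x => ‖x - x₀‖ / ‖x - y‖) (cobounded Space) (𝓝 1) := by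
  have h := tendsto_norm_sub_cobounded y
  have h1 : Tendsto (fun x => ‖y - x₀‖ / ‖x - y‖) (cobounded Space) (𝓝 0) :=
    tendsto_const_nhds.div_atTop h
  rw [tendsto_iff_dist_tendsto_zero]
  refine squeeze_zero' (Eventually.of_forall fun _ => dist_nonneg) ?_ h1
  filter_upwards [h.eventually_gt_atTop 0] with x hx
  rw [Real.dist_eq, div_sub_one hx.ne', abs_div, abs_of_pos hx]
  gcongr
  have := abs_norm_sub_norm_le (x - x₀) (x - y)
  rwa [show x - x₀ - (x - y) = y - x₀ by abel] at this

/-- After rescaling, the integrand is `C (‖x - x₀‖ / ‖x - y‖) ^ a * f y`, and the ratio tends to `1`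
for each `y`. Dominated convergence does the rest, so the limit does not depend on `x₀`. -/
lemma tendsto_rpow_mul_radialConv {a C : ℝ} (ha : 0 ≤ a) (hf : Integrable f)
    (hR : ∀ x, f x ≠ 0 → ‖x‖ ≤ R) (x₀ : Space) :
    Tendsto (fun x => ((‖x - x₀‖ ^ a : ℝ) : ℂ) * radialConv (fun r => C * r ^ (-a)) f x)
      (cobounded Space) (𝓝 (C * ∫ y, f y)) := by
  have e : ∀ x, ((‖x - x₀‖ ^ a : ℝ) : ℂ) * radialConv (fun r => C * r ^ (-a)) f x =
      ∫ y, ((C * (‖x - x₀‖ / ‖x - y‖) ^ a : ℝ) : ℂ) * f y := by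
    intro x
    rw [radialConv, ← integral_const_mul]
    refine integral_congr_ae (ae_of_all _ fun y => ?_)
    simp only
    rw [← mul_assoc, ← Complex.ofReal_mul, Real.div_rpow (norm_nonneg _) (norm_nonneg _),
      Real.rpow_neg (norm_nonneg _)]
    congr 2
    ring
  simp only [e]
  rw [← integral_const_mul]
  refine tendsto_integral_filter_of_dominated_convergence (fun y => |C| * 2 ^ a * ‖f y‖) ?_ ?_
    (hf.norm.const_mul _) ?_
  · refine Eventually.of_forall fun x => AEStronglyMeasurable.mul ?_ hf.aestronglyMeasurable
    exact Measurable.aestronglyMeasurable (by fun_prop)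
  · have h1 := (tendsto_norm_sub_cobounded (0 : Space)).eventually_ge_atTop (2 * R + ‖x₀‖ + 1)
    filter_upwards [h1] with x hx
    rw [sub_zero] at hx
    refine ae_of_all _ fun y => ?_
    by_cases hy : f y = 0
    · simp [hy]
    · have hyR := hR y hy
      have h2 := norm_sub_norm_le x y
      have h3 := norm_sub_le x x₀
      have hR0 := norm_nonneg y
      have h4 : 0 < ‖x - y‖ := by linarith [norm_nonneg x₀]
      rw [norm_mul, Complex.norm_real, norm_mul, Real.norm_eq_abs,
        Real.norm_of_nonneg (by positivity)]
      gcongr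
      rw [div_le_iff₀ h4]
      linarith
  · refine ae_of_all _ fun y => ?_
    have h1 : Tendsto (fun x => (‖x - x₀‖ / ‖x - y‖) ^ a) (cobounded Space) (𝓝 1) := by
      simpa using (tendsto_norm_sub_div x₀ y).rpow_const (p := a) (Or.inl one_ne_zero)
    have h2 := (Complex.continuous_ofReal.tendsto _).comp (h1.const_mul C)
    rw [mul_one] at h2
    exact h2.mul_const (f y)

lemma tendsto_rpow_mul_radialConv_zero {a b C : ℝ} (hb : b < a) (ha : 0 ≤ a) (hf : Integrable f)
    (hR : ∀ x, f x ≠ 0 → ‖x‖ ≤ R) (x₀ : Space) :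
    Tendsto (fun x => ((‖x - x₀‖ ^ b : ℝ) : ℂ) * radialConv (fun r => C * r ^ (-a)) f x)
      (cobounded Space) (𝓝 0) := by
  have h1 : Tendsto (fun x => ((‖x - x₀‖ ^ (-(a - b)) : ℝ) : ℂ)) (cobounded Space) (𝓝 0) := by
    have := (tendsto_rpow_neg_atTop (sub_pos.2 hb)).comp (tendsto_norm_sub_cobounded x₀)
    have h0 := (Complex.continuous_ofReal.tendsto _).comp this
    rwa [Complex.ofReal_zero] at h0
  have h2 := h1.mul (tendsto_rpow_mul_radialConv (C := C) ha hf hR x₀)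
  rw [zero_mul] at h2
  refine h2.congr' ?_
  filter_upwards [(tendsto_norm_sub_cobounded x₀).eventually_gt_atTop 0] with x hx
  rw [← mul_assoc, ← Complex.ofReal_mul, ← Real.rpow_add hx]
  congr 3
  ring

lemma isBigO_rpow_of_tendsto {h : Space → ℂ} {a : ℝ} {c : ℂ} {x₀ : Space}
    (H : Tendsto (fun x => ((‖x - x₀‖ ^ a : ℝ) : ℂ) * h x) (cobounded Space) (𝓝 c)) :
    h =O[cobounded Space] fun x => ‖x - x₀‖ ^ (-a) := by
  have h1 := H.isBigO_one ℝ
  have h2 : (fun x => ‖x - x₀‖ ^ (-a)) =O[cobounded Space] fun x => ‖x - x₀‖ ^ (-a) :=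
    isBigO_refl _ _
  have h3 := h2.smul h1
  refine (h3.congr' ?_ ?_)
  · filter_upwards [(tendsto_norm_sub_cobounded x₀).eventually_gt_atTop 0] with x hx
    rw [Complex.real_smul, ← mul_assoc, ← Complex.ofReal_mul, ← Real.rpow_add hx]
    simp
  · exact Eventually.of_forall fun x => by simp

lemma radialConv_isBigO_exp {K : ℝ → ℝ} {m C r₀ : ℝ} (hm : 0 ≤ m)
    (hK : ∀ r ≥ r₀, |K r| ≤ C * Real.exp (-m * r)) (hf : Integrable f)
    (hR : ∀ x, f x ≠ 0 → ‖x‖ ≤ R) (x₀ : Space) :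
    radialConv K f =O[cobounded Space] fun x => Real.exp (-m * ‖x - x₀‖) := by
  have hC : 0 ≤ C := by
    have := (abs_nonneg _).trans (hK r₀ le_rfl)
    exact nonneg_of_mul_nonneg_left this (Real.exp_pos _)
  refine IsBigO.of_bound (C * Real.exp (m * (R + ‖x₀‖)) * ∫ y, ‖f y‖) ?_
  have h1 := (tendsto_norm_sub_cobounded (0 : Space)).eventually_ge_atTop (r₀ + R)
  filter_upwards [h1] with x hx
  rw [sub_zero] at hx
  rw [Real.norm_of_nonneg (Real.exp_pos _).le, radialConv, mul_right_comm, ← integral_const_mul]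
  refine norm_integral_le_of_norm_le (hf.norm.const_mul _) (ae_of_all _ fun y => ?_)
  by_cases hy : f y = 0
  · simp [hy]
  · have hyR := hR y hy
    have h2 := norm_sub_norm_le x y
    rw [norm_mul, Complex.norm_real]
    refine mul_le_mul_of_nonneg_right ((hK _ (by linarith)).trans ?_) (norm_nonneg _)
    rw [mul_assoc, ← Real.exp_add]
    refine mul_le_mul_of_nonneg_left (Real.exp_le_exp.2 ?_) hC
    have h3 := norm_sub_le x x₀
    nlinarith

end Asymptotics

/-! ### Analytic continuation along lines in frequency space -/

section AnalyticRays

lemma tendsto_ofReal_pos : Tendsto (fun t : ℝ => (t : ℂ)) (𝓝[>] 0) (𝓝[≠] 0) := by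
  refine tendsto_nhdsWithin_iff.2 ⟨?_, ?_⟩
  · exact (Complex.continuous_ofReal.tendsto' 0 0 (by simp)).mono_left nhdsWithin_le_nhds
  · filter_upwards [self_mem_nhdsWithin] with t ht
    have : (0 : ℝ) < t := ht
    simpa using this.ne'

/-- Small positive reals accumulate at the origin, so the identity theorem applies even though
nothing is known for other arguments. -/
lemma eventually_eq_of_pos {F G : ℂ → ℂ} (hF : AnalyticAt ℂ F 0) (hG : AnalyticAt ℂ G 0)
    (h : ∀ᶠ t : ℝ in 𝓝[>] 0, F t = G t) : F =ᶠ[𝓝 0] G :=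
  (hF.frequently_eq_iff_eventually_eq hG).1 (tendsto_ofReal_pos.frequently h.frequently)

/-- Noninteger powers are independent of analytic functions. -/
lemma eventually_zero_of_rpow_mul {F L : ℂ → ℂ} (hF : AnalyticAt ℂ F 0) (hL : AnalyticAt ℂ L 0)
    {s : ℝ} (hs : 0 < s) (hs1 : s < 1) (h : ∀ t : ℝ, 0 < t → L t = ((t ^ s : ℝ) : ℂ) * F t) :
    F =ᶠ[𝓝 0] 0 := by
  by_contra hne
  have hLne : ¬ ∀ᶠ z in 𝓝 0, L z = 0 := by
    intro hL0
    refine hne (eventually_eq_of_pos hF analyticAt_const ?_)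
    filter_upwards [(tendsto_ofReal_pos.mono_right nhdsWithin_le_nhds).eventually hL0,
      self_mem_nhdsWithin] with t ht htp
    have h1 := h t htp
    rw [ht, eq_comm, mul_eq_zero] at h1
    refine h1.resolve_left ?_
    have : (0 : ℝ) < t := htp
    exact_mod_cast (by positivity : t ^ s ≠ 0)
  obtain ⟨n, F₁, hF₁, hF₁0, hFe⟩ := hF.exists_eventuallyEq_pow_smul_nonzero_iff.2 hne
  obtain ⟨p, L₁, hL₁, hL₁0, hLe⟩ := hL.exists_eventuallyEq_pow_smul_nonzero_iff.2 hLne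
  have hlim : Tendsto (fun t : ℝ => (t : ℂ)) (𝓝[>] 0) (𝓝 0) :=
    tendsto_ofReal_pos.mono_right nhdsWithin_le_nhds
  have tF : Tendsto (fun t : ℝ => F₁ t) (𝓝[>] 0) (𝓝 (F₁ 0)) := hF₁.continuousAt.tendsto.comp hlim
  have tL : Tendsto (fun t : ℝ => L₁ t) (𝓝[>] 0) (𝓝 (L₁ 0)) := hL₁.continuousAt.tendsto.comp hlim
  -- Leading orders are compared: `p` and `n` are integers while `0 < s < 1`, so the exponents
  -- differ, and the side with the smaller exponent is forced to have a zero leading coefficient.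
  have key : ∀ᶠ t : ℝ in 𝓝[>] 0, ((t ^ (p : ℝ) : ℝ) : ℂ) * L₁ t = ((t ^ (s + n) : ℝ) : ℂ) * F₁ t := by
    filter_upwards [hlim.eventually hFe, hlim.eventually hLe, self_mem_nhdsWithin] with t h1 h2 htp
    have ht0 : 0 < t := htp
    have h3 := h t htp
    rw [h1, h2] at h3
    simp only [sub_zero, smul_eq_mul] at h3
    rw [Real.rpow_add ht0, Real.rpow_natCast, Real.rpow_natCast]
    push_cast
    rw [h3]
    ring
  have tpow : ∀ q : ℝ, 0 < q → Tendsto (fun t : ℝ => ((t ^ q : ℝ) : ℂ)) (𝓝[>] 0) (𝓝 0) := by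
    intro q hq
    refine Complex.continuous_ofReal.tendsto' 0 0 (by simp) |>.comp ?_
    have := (Real.continuousAt_rpow_const 0 q (Or.inr hq.le)).tendsto
    rw [Real.zero_rpow hq.ne'] at this
    exact this.mono_left nhdsWithin_le_nhds
  rcases Nat.lt_or_ge n p with hnp | hnp
  · have hq : 0 < (p : ℝ) - (s + n) := by
      have : (n : ℝ) + 1 ≤ p := by exact_mod_cast hnp
      linarith
    have h1 := (tpow _ hq).mul tL
    rw [zero_mul] at h1
    refine hF₁0 (tendsto_nhds_unique (tF.congr' ?_) h1)
    filter_upwards [key, self_mem_nhdsWithin] with t h2 htp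
    have ht0 : 0 < t := htp
    have h3 : ((t ^ (s + n) : ℝ) : ℂ) ≠ 0 := by exact_mod_cast (by positivity : t ^ (s + n) ≠ 0)
    apply mul_left_cancel₀ h3
    rw [← h2, ← mul_assoc, ← Complex.ofReal_mul, ← Real.rpow_add ht0]
    congr 3
    ring
  · have hq : 0 < (s + n) - (p : ℝ) := by
      have : (p : ℝ) ≤ n := by exact_mod_cast hnp
      linarith
    have h1 := (tpow _ hq).mul tF
    rw [zero_mul] at h1
    refine hL₁0 (tendsto_nhds_unique (tL.congr' ?_) h1)
    filter_upwards [key, self_mem_nhdsWithin] with t h2 htp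
    have ht0 : 0 < t := htp
    have h3 : ((t ^ (p : ℝ) : ℝ) : ℂ) ≠ 0 := by exact_mod_cast (by positivity : t ^ (p : ℝ) ≠ 0)
    apply mul_left_cancel₀ h3
    rw [h2, ← mul_assoc, ← Complex.ofReal_mul, ← Real.rpow_add ht0]
    congr 3
    ring

/-- Continuation from positive `t` gives `P = 2πz G` near the origin, whereas negative `t` gives the
opposite sign; hence `G` vanishes. -/
lemma eventually_zero_of_abs_mul {G P : ℂ → ℂ} (hG : AnalyticAt ℂ G 0) (hP : AnalyticAt ℂ P 0)
    (h : ∀ᶠ t : ℝ in 𝓝 0, t ≠ 0 → P t = ((2 * Real.pi * |t| : ℝ) : ℂ) * G t) : G =ᶠ[𝓝 0] 0 := by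
  have h1 : P =ᶠ[𝓝 0] fun z => 2 * Real.pi * z * G z := by
    refine eventually_eq_of_pos hP (by fun_prop) ?_
    filter_upwards [self_mem_nhdsWithin, nhdsWithin_le_nhds h] with t ht h
    have ht0 : 0 < t := ht
    rw [h ht0.ne', abs_of_pos ht0]
    push_cast
    ring
  have hneg : Tendsto (fun t : ℝ => ((-t : ℝ) : ℂ)) (𝓝[>] 0) (𝓝 0) := by
    have := (tendsto_ofReal_pos.mono_right nhdsWithin_le_nhds).neg
    simpa using this
  have h2 : (fun z => G (-z)) =ᶠ[𝓝 0] 0 := by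
    have hG' : AnalyticAt ℂ (fun z => G (-z)) 0 :=
      AnalyticAt.fun_comp (g := G) (f := fun z => -z) (by simpa using hG) analyticAt_id.neg
    refine eventually_eq_of_pos hG' analyticAt_const ?_
    have hn : ∀ᶠ t : ℝ in 𝓝 0, -t ≠ 0 → P (-t : ℝ) = ((2 * Real.pi * |-t| : ℝ) : ℂ) * G (-t : ℝ) :=
      (continuous_neg.tendsto' (0 : ℝ) 0 neg_zero).eventually h
    filter_upwards [hneg.eventually h1, self_mem_nhdsWithin, nhdsWithin_le_nhds hn] with t h3 ht h
    have ht0 : 0 < t := ht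
    rw [h (by linarith), abs_neg, abs_of_pos ht0] at h3
    push_cast at h3
    have : (4 * Real.pi * t : ℂ) * G (-t) = 0 := by linear_combination h3
    rcases mul_eq_zero.1 this with h4 | h4
    · exfalso
      have h5 : (4 * Real.pi * t : ℝ) ≠ 0 := by positivity
      exact h5 (by exact_mod_cast h4)
    · exact h4
  have h3 := (continuous_neg.tendsto' (0 : ℂ) 0 neg_zero).eventually h2
  filter_upwards [h3] with z hz
  simpa using hz

lemma eventually_zero_of_abs_rpow {F G P : ℂ → ℂ} (hF : AnalyticAt ℂ F 0) (hG : AnalyticAt ℂ G 0)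
    (hP : AnalyticAt ℂ P 0) {s c : ℝ} (hs : 0 < s) (hs1 : s < 1) (hc : c ≠ 0)
    (h : ∀ t : ℝ, t ≠ 0 → P t = ((2 * Real.pi * |t| : ℝ) : ℂ) * G t -
      ((c * (2 * Real.pi * |t|) ^ (s - 1) : ℝ) : ℂ) * F t) : F =ᶠ[𝓝 0] 0 ∧ G =ᶠ[𝓝 0] 0 := by
  have hF0 : F =ᶠ[𝓝 0] 0 := by
    have h1 : (fun z => ((c * (2 * Real.pi) ^ s : ℝ) : ℂ) * F z) =ᶠ[𝓝 0] 0 := by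
      -- Multiplying the relation by `2πt` for `t > 0` clears the negative exponent `s - 1` and
      -- isolates `t ^ s * F` against an analytic function.
      refine eventually_zero_of_rpow_mul (L := fun z => (2 * Real.pi * z) ^ 2 * G z -
        2 * Real.pi * z * P z) (by fun_prop) (by fun_prop) hs hs1 fun t ht => ?_
      rw [h t ht.ne', abs_of_pos ht]
      have e : (2 * Real.pi * t) ^ (s - 1) = (2 * Real.pi) ^ s * t ^ s / (2 * Real.pi * t) := by
        rw [Real.rpow_sub_one (by positivity), Real.mul_rpow (by positivity) ht.le]
      have ht' : (t : ℂ) ≠ 0 := by exact_mod_cast ht.ne'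
      have hpi : (Real.pi : ℂ) ≠ 0 := by exact_mod_cast Real.pi_ne_zero
      rw [e]
      push_cast
      field_simp
      ring
    filter_upwards [h1] with z hz
    refine (mul_eq_zero.1 hz).resolve_left ?_
    exact_mod_cast mul_ne_zero hc (by positivity)
  refine ⟨hF0, eventually_zero_of_abs_mul hG hP ?_⟩
  filter_upwards [(Complex.continuous_ofReal.tendsto' 0 0 (by simp)).eventually hF0] with t ht ht0
  rw [h t ht0, ht]
  simp

/-- The horizontal strip of half-width `a` around the real axis. -/
def strip (a : ℝ) : Set ℂ := {z | |z.im| < a}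

lemma isOpen_strip (a : ℝ) : IsOpen (strip a) :=
  isOpen_lt (by fun_prop) continuous_const

lemma isPreconnected_strip (a : ℝ) : IsPreconnected (strip a) := by
  have e : strip a = Complex.imLm ⁻¹' Set.Ioo (-a) a := by
    ext z
    simp [strip, abs_lt]
  rw [e]
  exact ((convex_Ioo (-a) a).linear_preimage Complex.imLm).isPreconnected

lemma ofReal_mem_strip {a : ℝ} (ha : 0 < a) (t : ℝ) : (t : ℂ) ∈ strip a := by
  simpa [strip] using ha

/-- Squaring gives `F² = Q P²` with `Q` analytic, an identity that persists on the whole strip. The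
strip contains the simple zero `i m / (2π)` of `Q`, and there the two sides would vanish to orders
of opposite parity unless both vanish identically. -/
lemma eqOn_zero_of_sqrt_mul {F P : ℂ → ℂ} {a m : ℝ} (hm : 0 < m) (ha : m < 2 * Real.pi * a)
    (hF : AnalyticOnNhd ℂ F (strip a)) (hP : AnalyticOnNhd ℂ P (strip a))
    (h : ∀ t : ℝ, t ≠ 0 → F t = (√((2 * Real.pi * |t|) ^ 2 + m ^ 2) : ℂ) * P t) :
    Set.EqOn F 0 (strip a) ∧ Set.EqOn P 0 (strip a) := by
  have hpi := Real.pi_pos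
  have ha0 : 0 < a := by
    by_contra hn
    have : 2 * Real.pi * a ≤ 0 := mul_nonpos_of_nonneg_of_nonpos (by positivity) (not_lt.1 hn)
    linarith
  set Q : ℂ → ℂ := fun z => (2 * Real.pi * z) ^ 2 + m ^ 2 with hQ
  have hQa : ∀ z, AnalyticAt ℂ Q z := fun z => by fun_prop
  have h0 : (0 : ℂ) ∈ strip a := by simpa using ofReal_mem_strip ha0 0
  have hsq : Set.EqOn (F ^ 2) (Q * P ^ 2) (strip a) := by
    refine (hF.pow 2).eqOn_of_preconnected_of_frequently_eq
      (AnalyticOnNhd.mul (fun z _ => hQa z) (hP.pow 2)) (isPreconnected_strip a) h0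
      (tendsto_ofReal_pos.frequently (Eventually.frequently ?_))
    filter_upwards [self_mem_nhdsWithin] with t ht
    have ht0 : (0 : ℝ) < t := ht
    simp only [Pi.pow_apply, Pi.mul_apply, hQ]
    rw [h t ht0.ne', mul_pow, ← Complex.ofReal_pow, Real.sq_sqrt (by positivity), mul_pow, sq_abs]
    push_cast
    ring
  set w : ℂ := ((m / (2 * Real.pi) : ℝ) : ℂ) * Complex.I with hw
  have hws : w ∈ strip a := by
    simp only [strip, Set.mem_ofPred_eq, hw, Complex.im_ofReal_mul,
      Complex.I_im, mul_one]
    rw [abs_of_pos (by positivity), div_lt_iff₀ (by positivity)]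
    linarith
  have hw2 : 2 * Real.pi * w = m * Complex.I := by
    rw [hw]
    push_cast
    field_simp
  have hQw : Q w = 0 := by
    simp only [hQ]
    rw [hw2, mul_pow, Complex.I_sq]
    ring
  have hQd : deriv Q w ≠ 0 := by
    have hd : HasDerivAt Q (2 * (2 * Real.pi * w) * (2 * Real.pi)) w := by
      have h1 : HasDerivAt (fun z : ℂ => 2 * Real.pi * z) (2 * Real.pi) w := by
        simpa using (hasDerivAt_id w).const_mul (2 * Real.pi : ℂ)
      exact ((h1.pow 2).add_const ((m : ℂ) ^ 2)).congr_deriv (by simp)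
    rw [hd.deriv, hw2]
    have : (Real.pi : ℂ) ≠ 0 := by exact_mod_cast hpi.ne'
    have : (m : ℂ) ≠ 0 := by exact_mod_cast hm.ne'
    simp [*]
  have hQ1 : analyticOrderAt Q w = 1 :=
    (hQa w).analyticOrderAt_eq_one_of_zero_deriv_ne_zero hQw hQd
  -- No finite orders satisfy this, by parity, so both are infinite.
  have hord : 2 • analyticOrderAt F w = 1 + 2 • analyticOrderAt P w := by
    rw [← analyticOrderAt_pow (hF w hws), ← analyticOrderAt_pow (hP w hws), ← hQ1,
      ← analyticOrderAt_mul (hQa w) ((hP w hws).pow 2)]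
    exact analyticOrderAt_congr (hsq.eventuallyEq_of_mem ((isOpen_strip a).mem_nhds hws))
  have htop : analyticOrderAt F w = ⊤ ∧ analyticOrderAt P w = ⊤ := by
    generalize analyticOrderAt F w = x at hord
    generalize analyticOrderAt P w = y at hord
    induction x using ENat.recTopCoe with
    | top =>
      induction y using ENat.recTopCoe with
      | top => simp
      | coe y =>
        exfalso
        have : (1 + 2 • (y : ℕ∞)) = ((1 + 2 * y : ℕ) : ℕ∞) := by simp
        rw [this, show (2 : ℕ) • (⊤ : ℕ∞) = ⊤ by simp] at hord
        exact ENat.top_ne_natCast _ hord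
    | coe x =>
      exfalso
      induction y using ENat.recTopCoe with
      | top =>
        have : (2 • (x : ℕ∞)) = ((2 * x : ℕ) : ℕ∞) := by simp
        rw [this, show 1 + (2 : ℕ) • (⊤ : ℕ∞) = ⊤ by simp] at hord
        exact ENat.natCast_ne_top _ hord
      | coe y =>
        have h1 : (1 + 2 • (y : ℕ∞)) = ((1 + 2 * y : ℕ) : ℕ∞) := by simp
        have h2 : (2 • (x : ℕ∞)) = ((2 * x : ℕ) : ℕ∞) := by simp
        rw [h1, h2] at hord
        have := Nat.cast_injective (R := ℕ∞) hord
        omega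
  exact ⟨hF.eqOn_zero_of_preconnected_of_eventuallyEq_zero (isPreconnected_strip a) hws
      (analyticOrderAt_eq_top.1 htop.1),
    hP.eqOn_zero_of_preconnected_of_eventuallyEq_zero (isPreconnected_strip a) hws
      (analyticOrderAt_eq_top.1 htop.2)⟩

/-- The restriction of a Fourier transform to the line through `θ`, at complex argument. -/
def rayTransform (h : Space → ℂ) (θ : Space) (z : ℂ) : ℂ :=
  ∫ x, Complex.exp (-2 * Real.pi * Complex.I * z * (inner ℝ x θ : ℝ)) * h x

lemma rayTransform_ofReal (h : Space → ℂ) (θ : Space) (t : ℝ) :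
    rayTransform h θ t = 𝓕 h (t • θ) := by
  rw [rayTransform, Real.fourier_eq']
  refine integral_congr_ae (ae_of_all _ fun x => ?_)
  simp only [smul_eq_mul, inner_smul_right]
  congr 2
  push_cast
  ring

/-- Differentiation under the integral is done on a slightly smaller strip, whose margin absorbs the
factor `2π‖x‖` coming from the derivative. -/
lemma analyticOnNhd_rayTransform {h : Space → ℂ} {a : ℝ} (hm : AEStronglyMeasurable h)
    (hi : Integrable fun x => Real.exp (2 * Real.pi * a * ‖x‖) * ‖h x‖) {θ : Space} (hθ : ‖θ‖ = 1) :
    AnalyticOnNhd ℂ (rayTransform h θ) (strip a) := by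
  have hpi := Real.pi_pos
  refine DifferentiableOn.analyticOnNhd (fun w hw => ?_) (isOpen_strip a)
  have hw' : |w.im| < a := hw
  obtain ⟨b, hwb, hba⟩ := exists_between hw'
  have hb0 : 0 < b := (abs_nonneg _).trans_lt hwb
  have hbound : ∀ z ∈ strip b, ∀ x : Space,
      ‖Complex.exp (-2 * Real.pi * Complex.I * z * (inner ℝ x θ : ℝ))‖ ≤
        Real.exp (2 * Real.pi * b * ‖x‖) := by
    intro z hz x
    have hz' : |z.im| < b := hz
    rw [Complex.norm_exp]
    refine Real.exp_le_exp.2 ?_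
    have e : (-2 * Real.pi * Complex.I * z * (inner ℝ x θ : ℝ)).re =
        2 * Real.pi * (z.im * inner ℝ x θ) := by
      simp [Complex.mul_re, Complex.mul_im]
      ring
    rw [e, mul_assoc (2 * Real.pi) b]
    refine mul_le_mul_of_nonneg_left ?_ (by positivity)
    refine (le_abs_self _).trans ?_
    rw [abs_mul]
    have h1 := abs_real_inner_le_norm x θ
    rw [hθ, mul_one] at h1
    exact mul_le_mul hz'.le h1 (abs_nonneg _) hb0.le
  have hmeas : ∀ z : ℂ, AEStronglyMeasurable fun x : Space =>
      Complex.exp (-2 * Real.pi * Complex.I * z * (inner ℝ x θ : ℝ)) * h x := fun z =>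
    AEStronglyMeasurable.mul (Continuous.aestronglyMeasurable (by fun_prop)) hm
  have hexp : ∀ x : Space, Real.exp (2 * Real.pi * b * ‖x‖) ≤ Real.exp (2 * Real.pi * a * ‖x‖) :=
    fun x => Real.exp_le_exp.2 (by gcongr)
  refine (hasDerivAt_integral_of_dominated_loc_of_deriv_le
    (F := fun z x => Complex.exp (-2 * Real.pi * Complex.I * z * (inner ℝ x θ : ℝ)) * h x)
    (F' := fun z x => Complex.exp (-2 * Real.pi * Complex.I * z * (inner ℝ x θ : ℝ)) *
      (-2 * Real.pi * Complex.I * (inner ℝ x θ : ℝ)) * h x)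
    (bound := fun x => (a - b)⁻¹ * (Real.exp (2 * Real.pi * a * ‖x‖) * ‖h x‖))
    ((isOpen_strip b).mem_nhds (show w ∈ strip b from hwb)) (Eventually.of_forall hmeas) ?_ ?_ ?_
    (hi.const_mul _) ?_).2.differentiableAt.differentiableWithinAt
  · refine hi.mono' (hmeas w) (ae_of_all _ fun x => ?_)
    rw [norm_mul]
    exact mul_le_mul_of_nonneg_right ((hbound w hwb x).trans (hexp x)) (norm_nonneg _)
  · exact AEStronglyMeasurable.mul (Continuous.aestronglyMeasurable (by fun_prop)) hm
  · refine ae_of_all _ fun x z hz => ?_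
    rw [norm_mul, norm_mul, ← mul_assoc]
    refine mul_le_mul_of_nonneg_right ?_ (norm_nonneg _)
    have h1 : ‖(-2 * Real.pi * Complex.I * (inner ℝ x θ : ℝ) : ℂ)‖ ≤ 2 * Real.pi * ‖x‖ := by
      have h2 := abs_real_inner_le_norm x θ
      rw [hθ, mul_one] at h2
      simp only [norm_mul, norm_neg, Complex.norm_real, Complex.norm_I, mul_one,
        Real.norm_of_nonneg hpi.le, Real.norm_eq_abs]
      simp only [Complex.norm_ofNat]
      gcongr
    have hab : 0 < a - b := sub_pos.2 hba
    -- This is `t ≤ exp t` at `t = 2π(a - b)‖x‖`, divided by the margin `a - b`.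
    have h3 : 2 * Real.pi * ‖x‖ ≤ (a - b)⁻¹ * Real.exp (2 * Real.pi * (a - b) * ‖x‖) := by
      rw [inv_mul_eq_div, le_div_iff₀ hab]
      have := Real.add_one_le_exp (2 * Real.pi * (a - b) * ‖x‖)
      nlinarith
    calc _ ≤ Real.exp (2 * Real.pi * b * ‖x‖) *
          ((a - b)⁻¹ * Real.exp (2 * Real.pi * (a - b) * ‖x‖)) :=
        mul_le_mul (hbound z hz x) (h1.trans h3) (norm_nonneg _) (Real.exp_pos _).le
      _ = _ := by
        rw [mul_left_comm, ← Real.exp_add]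
        congr 2
        ring
  · refine ae_of_all _ fun x z _ => ?_
    have h1 : HasDerivAt (fun z : ℂ => -2 * Real.pi * Complex.I * z * (inner ℝ x θ : ℝ))
        (-2 * Real.pi * Complex.I * (inner ℝ x θ : ℝ)) z := by
      simpa using ((hasDerivAt_id z).const_mul (-2 * Real.pi * Complex.I)).mul_const
        ((inner ℝ x θ : ℝ) : ℂ)
    exact h1.cexp.mul_const _

/-- Along every line through the origin, `u` extends analytically to the strip of half-width `a`. -/
def RayAnalytic (a : ℝ) (u : Space → ℂ) : Prop :=
  ∀ θ : Space, ‖θ‖ = 1 → ∃ U : ℂ → ℂ, AnalyticOnNhd ℂ U (strip a) ∧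
    ∀ t : ℝ, t ≠ 0 → U t = u (t • θ)

namespace RayAnalytic

variable {a : ℝ} {u v : Space → ℂ}

lemma congr (h : RayAnalytic a u) (e : ∀ ξ ≠ 0, v ξ = u ξ) : RayAnalytic a v := fun θ hθ => by
  obtain ⟨U, hU, hUe⟩ := h θ hθ
  refine ⟨U, hU, fun t ht => ?_⟩
  rw [hUe t ht, e]
  have : θ ≠ 0 := by
    rintro rfl
    simp at hθ
  exact smul_ne_zero ht this

lemma add (h : RayAnalytic a u) (h' : RayAnalytic a v) : RayAnalytic a fun ξ => u ξ + v ξ :=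
  fun θ hθ => by
    obtain ⟨U, hU, hUe⟩ := h θ hθ
    obtain ⟨V, hV, hVe⟩ := h' θ hθ
    exact ⟨fun z => U z + V z, hU.add hV, fun t ht => by simp only [hUe t ht, hVe t ht]⟩

lemma mul (h : RayAnalytic a u) (h' : RayAnalytic a v) : RayAnalytic a fun ξ => u ξ * v ξ :=
  fun θ hθ => by
    obtain ⟨U, hU, hUe⟩ := h θ hθ
    obtain ⟨V, hV, hVe⟩ := h' θ hθ
    exact ⟨fun z => U z * V z, hU.mul hV, fun t ht => by simp only [hUe t ht, hVe t ht]⟩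

lemma const_mul (h : RayAnalytic a u) (c : ℂ) : RayAnalytic a fun ξ => c * u ξ :=
  fun θ hθ => by
    obtain ⟨U, hU, hUe⟩ := h θ hθ
    exact ⟨fun z => c * U z, analyticOnNhd_const.mul hU, fun t ht => by simp only [hUe t ht]⟩

lemma fourier {h : Space → ℂ} (hm : AEStronglyMeasurable h)
    (hi : Integrable fun x => Real.exp (2 * Real.pi * a * ‖x‖) * ‖h x‖) : RayAnalytic a (𝓕 h) :=
  fun θ hθ => ⟨rayTransform h θ, analyticOnNhd_rayTransform hm hi hθ,
    fun t _ => rayTransform_ofReal h θ t⟩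

end RayAnalytic

/-- Integrable functions of compact support. -/
structure Source (f : Space → ℂ) : Prop where
  integrable : Integrable f
  compact : HasCompactSupport f

namespace Source

variable {f η : Space → ℂ}

lemma exists_radius (h : Source f) : ∃ R, 0 ≤ R ∧ ∀ x, f x ≠ 0 → ‖x‖ ≤ R := by
  obtain ⟨R, hR⟩ := h.compact.isBounded.subset_closedBall 0
  refine ⟨max R 0, le_max_right _ _, fun x hx => ?_⟩
  exact (mem_closedBall_zero_iff.1 (hR (subset_tsupport _ hx))).trans (le_max_left _ _)

lemma integrable_exp (h : Source f) (a : ℝ) :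
    Integrable fun x => Real.exp (2 * Real.pi * a * ‖x‖) * ‖f x‖ := by
  obtain ⟨R, hR0, hR⟩ := h.exists_radius
  refine (h.integrable.norm.const_mul (Real.exp (2 * Real.pi * |a| * R))).mono' ?_
    (ae_of_all _ fun x => ?_)
  · exact AEStronglyMeasurable.mul (Continuous.aestronglyMeasurable (by fun_prop))
      h.integrable.aestronglyMeasurable.norm
  · by_cases hx : f x = 0
    · simp [hx]
    · rw [Real.norm_of_nonneg (by positivity)]
      refine mul_le_mul_of_nonneg_right (Real.exp_le_exp.2 ?_) (norm_nonneg _)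
      have h1 := hR x hx
      have h2 := le_abs_self a
      have hpi := Real.pi_pos
      calc 2 * Real.pi * a * ‖x‖ ≤ 2 * Real.pi * |a| * ‖x‖ := by gcongr
        _ ≤ _ := by gcongr

lemma rayAnalytic (h : Source f) (a : ℝ) : RayAnalytic a (𝓕 f) :=
  RayAnalytic.fourier h.integrable.aestronglyMeasurable (h.integrable_exp a)

lemma analyticOnNhd (h : Source f) (a : ℝ) {θ : Space} (hθ : ‖θ‖ = 1) :
    AnalyticOnNhd ℂ (rayTransform f θ) (strip a) :=
  analyticOnNhd_rayTransform h.integrable.aestronglyMeasurable (h.integrable_exp a) hθ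

/-- A source is zero in frequency space if its product with a mollifier vanishes near the origin on
every line. -/
lemma fourier_eq_zero (hf : Source f) (hη : Source η) (h0 : 𝓕 η 0 ≠ 0)
    (h : ∀ θ : Space, ‖θ‖ = 1 → (fun z => rayTransform f θ z * rayTransform η θ z) =ᶠ[𝓝 0] 0) (ξ : Space) :
    𝓕 f ξ = 0 := by
  have main : ∀ θ : Space, ‖θ‖ = 1 → ∀ t : ℝ, 𝓕 f (t • θ) = 0 := by
    intro θ hθ t
    have m0 : (0 : ℂ) ∈ strip 1 := by simpa using ofReal_mem_strip one_pos 0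
    have hη0 : rayTransform η θ 0 ≠ 0 := by
      have := rayTransform_ofReal η θ 0
      rw [Complex.ofReal_zero, zero_smul] at this
      rwa [this]
    have h1 : ∀ᶠ z in 𝓝 (0 : ℂ), rayTransform η θ z ≠ 0 :=
      (hη.analyticOnNhd 1 hθ 0 m0).continuousAt.eventually_ne hη0
    have h2 : rayTransform f θ =ᶠ[𝓝 0] 0 := by
      filter_upwards [h θ hθ, h1] with z hz hz1
      exact (mul_eq_zero.1 hz).resolve_right hz1
    have h3 := (hf.analyticOnNhd 1 hθ).eqOn_zero_of_preconnected_of_eventuallyEq_zero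
      (isPreconnected_strip 1) m0 h2 (ofReal_mem_strip one_pos t)
    rw [← rayTransform_ofReal]
    exact h3
  by_cases hξ : ξ = 0
  · obtain ⟨θ, hθ⟩ := exists_norm_eq Space zero_le_one
    simpa [hξ] using main θ hθ 0
  · have := main (‖ξ‖⁻¹ • ξ) (by rw [norm_smul, norm_inv, norm_norm, inv_mul_cancel₀ (norm_ne_zero_iff.2 hξ)]) ‖ξ‖
    rwa [smul_smul, mul_inv_cancel₀ (norm_ne_zero_iff.2 hξ), one_smul] at this

end Source

end AnalyticRays

/-! ### From exponential decay to analyticity of the mollified transform -/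

section Mollifier

lemma exists_mollifier : ∃ η : Space → ℂ, ContDiff ℝ (⊤ : ℕ∞) η ∧ Source η ∧ 𝓕 η 0 ≠ 0 ∧
    tsupport η ⊆ Metric.closedBall 0 1 := by
  let b : ContDiffBump (0 : Space) := ⟨1 / 2, 1, by norm_num, by norm_num⟩
  have hc : ContDiff ℝ (⊤ : ℕ∞) fun x => (b x : ℂ) := Complex.ofRealCLM.contDiff.comp b.contDiff
  have hs : tsupport (fun x => (b x : ℂ)) ⊆ Metric.closedBall 0 1 := by
    refine closure_minimal (fun x hx => ?_) Metric.isClosed_closedBall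
    have h1 : b x ≠ 0 := fun h => hx (by simp [h])
    have h2 : x ∈ Function.support b := h1
    rw [b.support_eq] at h2
    exact Metric.ball_subset_closedBall h2
  have hcs : HasCompactSupport fun x => (b x : ℂ) :=
    (isCompact_closedBall 0 1).of_isClosed_subset (isClosed_tsupport _) hs
  refine ⟨fun x => (b x : ℂ), hc, ⟨hc.continuous.integrable_of_hasCompactSupport hcs, hcs⟩, ?_, hs⟩
  rw [Real.fourier_eq]
  simp only [inner_zero_right, neg_zero, AddChar.map_zero_eq_one, one_smul]
  rw [integral_complex_ofReal]
  exact_mod_cast (b.integral_pos (μ := volume)).ne'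

lemma integrable_exp_neg_norm {c : ℝ} (hc : 0 < c) :
    Integrable fun x : Space => Real.exp (-c * ‖x‖) := by
  refine (integrable_fun_norm_addHaar (volume : Measure Space)
    (f := fun r => Real.exp (-c * r))).2 ?_
  have := integrableOn_rpow_mul_exp_neg_mul_rpow (s := 2) (p := 1) (b := c) (by norm_num) one_pos hc
  refine this.congr_fun (fun t _ => ?_) measurableSet_Ioi
  simp

/-- Multiplication by `𝓕 η` is convolution with `η` in position space, whose value at `x` is the
pairing with the reflected translate of `η`. Mollification thus turns pairings into pointwise
values. -/
lemma mollified_apply {u : Space → ℂ} {η : Space → ℂ} (hη : ContDiff ℝ (⊤ : ℕ∞) η)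
    (hc : HasCompactSupport η) (x : Space) :
    ∃ φ : 𝓢(Space, ℂ), (∀ y, φ y = η (x - y)) ∧
      𝓕⁻ (fun ξ => u ξ * 𝓕 η ξ) x = ∫ ξ, u ξ * (𝓕⁻ φ : 𝓢(Space, ℂ)) ξ := by
  have h1 : ContDiff ℝ (⊤ : ℕ∞) fun y => η (x - y) := hη.comp (contDiff_const.sub contDiff_id)
  have h2 : HasCompactSupport fun y => η (x - y) :=
    hc.comp_homeomorph (Homeomorph.subLeft x)
  refine ⟨h2.toSchwartzMap h1, fun y => rfl, ?_⟩
  rw [Real.fourierInv_eq]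
  refine integral_congr_ae (ae_of_all _ fun ξ => ?_)
  simp only
  rw [SchwartzMap.fourierInv_coe, Real.fourierInv_eq, Real.fourier_eq, Circle.smul_def, smul_eq_mul,
    mul_left_comm, ← integral_const_mul]
  congr 1
  rw [← integral_sub_left_eq_self _ volume x]
  refine integral_congr_ae (ae_of_all _ fun y => ?_)
  simp only [Circle.smul_def, smul_eq_mul]
  change _ = _ * η (x - y)
  rw [← mul_assoc]
  congr 1
  rw [← Circle.coe_mul, ← AddChar.map_add_eq_mul]
  congr 2
  rw [inner_sub_left, real_inner_comm]
  ring

/-- If a distribution decays exponentially outside a ball, then its Fourier transform, mollified,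
extends analytically to a strip. -/
lemma FarRep.rayAnalytic {u h : Space → ℂ} {ρ a b : ℝ} (H : FarRep u h ρ)
    (hh : h =O[cobounded Space] fun x => Real.exp (-a * ‖x‖)) (ha : 0 < a)
    (hb : 2 * Real.pi * b < a) :
    ∃ η, Source η ∧ 𝓕 η 0 ≠ 0 ∧ RayAnalytic b fun ξ => u ξ * 𝓕 η ξ := by
  obtain ⟨η, hη, hηs, hη0, hηt⟩ := exists_mollifier
  refine ⟨η, hηs, hη0, ?_⟩
  set w : Space → ℂ := fun ξ => u ξ * 𝓕 η ξ with hw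
  -- The rapid decay of `𝓕 η` makes the product integrable, so the mollified distribution is a
  -- bounded continuous function also near the sources.
  have hwi : Integrable w := by
    have := H.integrable (𝓕 (hηs.compact.toSchwartzMap hη) : 𝓢(Space, ℂ))
    rw [SchwartzMap.fourier_coe] at this
    exact this
  have hwc : ∀ ξ ≠ 0, ContinuousAt w ξ := fun ξ hξ =>
    ((H.continuousOn_symbol.mul (fourier_continuous hηs.integrable).continuousOn).continuousAt
      (isOpen_compl_singleton.mem_nhds hξ))
  set W : Space → ℂ := 𝓕⁻ w with hW
  have hWn : ∀ x, W x = 𝓕 w (-x) := fun x => Real.fourierInv_eq_fourier_neg w x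
  have hWc : Continuous W := by
    have : W = fun x => 𝓕 w (-x) := funext hWn
    rw [this]
    exact (fourier_continuous hwi).comp continuous_neg
  obtain ⟨C, hC⟩ := hh.bound
  obtain ⟨r, hr⟩ : ∃ r, ∀ x, r ≤ ‖x‖ → ‖h x‖ ≤ C * Real.exp (-a * ‖x‖) := by
    rw [← comap_norm_atTop, eventually_comap, eventually_atTop] at hC
    obtain ⟨r, hr⟩ := hC
    refine ⟨r, fun x hx => ?_⟩
    have := hr _ hx x rfl
    rwa [Real.norm_of_nonneg (Real.exp_pos _).le] at this
  have hCn : ∀ x, r ≤ ‖x‖ → 0 ≤ C := fun x hx =>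
    nonneg_of_mul_nonneg_left ((norm_nonneg _).trans (hr x hx)) (Real.exp_pos _)
  -- Beyond this radius the unit ball around `x` stays where the decay bound for `h` holds and
  -- strictly outside the ball of radius `ρ`.
  set r' := max r ρ + 2 with hr'
  obtain ⟨D, hD⟩ : ∃ D, ∀ x, ‖W x‖ ≤ D * Real.exp (-a * ‖x‖) := by
    refine ⟨max (C * Real.exp a * ∫ y, ‖η y‖) ((∫ ξ, ‖w ξ‖) * Real.exp (a * r')), fun x => ?_⟩
    rcases le_total r' ‖x‖ with hx | hx
    · refine le_trans ?_ (mul_le_mul_of_nonneg_right (le_max_left _ _) (Real.exp_pos _).le)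
      obtain ⟨φ, hφ, hφe⟩ := mollified_apply (u := u) hη hηs.compact x
      have hdist : ∀ y, ‖x - y‖ ≤ 1 → max r ρ + 1 ≤ ‖y‖ := fun y hy => by
        have := norm_sub_norm_le x y
        linarith
      have hts : tsupport φ ⊆ Metric.closedBall x 1 := by
        refine closure_minimal (fun y hy => ?_) Metric.isClosed_closedBall
        have h1 : η (x - y) ≠ 0 := by
          rw [← hφ]
          exact hy
        have h2 := hηt (subset_tsupport _ h1)
        rw [mem_closedBall_zero_iff] at h2
        rwa [Metric.mem_closedBall, dist_comm, dist_eq_norm]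
      have hcs : HasCompactSupport φ :=
        (isCompact_closedBall x 1).of_isClosed_subset (isClosed_tsupport _) hts
      have hin : tsupport φ ⊆ outside ρ := fun y hy => by
        have h1 := hts hy
        rw [Metric.mem_closedBall, dist_comm, dist_eq_norm] at h1
        have := hdist y h1
        have : ρ < ‖y‖ := by linarith [le_max_right r ρ]
        exact this
      have e : W x = ∫ y, h y * φ y := by
        rw [hW, hφe]
        exact H.equalsOn φ hcs hin
      rw [e]
      have hint : Integrable fun y => ‖η (x - y)‖ := (hηs.integrable.comp_sub_left x).norm
      have e2 : C * Real.exp a * (∫ y, ‖η y‖) * Real.exp (-a * ‖x‖) =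
          ∫ y, C * Real.exp (a - a * ‖x‖) * ‖η (x - y)‖ := by
        rw [integral_const_mul, integral_sub_left_eq_self (fun y => ‖η y‖) volume x, sub_eq_add_neg,
          Real.exp_add, neg_mul]
        ring
      rw [e2]
      refine norm_integral_le_of_norm_le (hint.const_mul _) (ae_of_all _ fun y => ?_)
      rw [hφ, norm_mul]
      by_cases hy : η (x - y) = 0
      · simp [hy]
      · refine mul_le_mul_of_nonneg_right ?_ (norm_nonneg _)
        have h1 := mem_closedBall_zero_iff.1 (hηt (subset_tsupport _ hy))
        have h2 := hdist y h1
        have h3 : r ≤ ‖y‖ := by linarith [le_max_left r ρ]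
        refine (hr y h3).trans (mul_le_mul_of_nonneg_left (Real.exp_le_exp.2 ?_) (hCn y h3))
        have := norm_sub_norm_le x y
        nlinarith
    · refine le_trans ?_ (mul_le_mul_of_nonneg_right (le_max_right _ _) (Real.exp_pos _).le)
      rw [mul_assoc, ← Real.exp_add, hWn]
      refine (norm_fourier_le w _).trans (le_mul_of_one_le_right
        (integral_nonneg fun _ => norm_nonneg _) (Real.one_le_exp ?_))
      nlinarith
  have hexp : Integrable fun x => Real.exp (2 * Real.pi * b * ‖x‖) * ‖W x‖ := by
    refine ((integrable_exp_neg_norm (sub_pos.2 hb)).const_mul D).mono'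
      (Continuous.aestronglyMeasurable (by fun_prop)) (ae_of_all _ fun x => ?_)
    rw [Real.norm_of_nonneg (by positivity)]
    refine (mul_le_mul_of_nonneg_left (hD x) (Real.exp_pos _).le).trans_eq ?_
    rw [mul_left_comm, ← Real.exp_add]
    congr 2
    ring
  have hWi : Integrable W :=
    ((integrable_exp_neg_norm ha).const_mul D).mono' hWc.aestronglyMeasurable (ae_of_all _ hD)
  have hFi : Integrable (𝓕 w) := by
    have := hWi.comp_neg
    refine this.congr (ae_of_all _ fun x => ?_)
    simp [hWn]
  refine (RayAnalytic.fourier hWc.aestronglyMeasurable hexp).congr fun ξ hξ => ?_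
  -- Fourier inversion holds at points of continuity of `w`, hence off the origin, where the symbol
  -- may be singular.
  exact (hwi.fourier_fourierInv_eq hFi (hwc ξ hξ)).symm

end Mollifier

/-! ### Vanishing of sources multiplied by nonanalytic symbols -/

section RayArguments

variable {f g η : Space → ℂ} {a : ℝ}

lemma waveNumber_smul {θ : Space} (hθ : ‖θ‖ = 1) (t : ℝ) :
    waveNumber (t • θ) = 2 * Real.pi * |t| := by
  simp [waveNumber, norm_smul, hθ]

lemma ray_mul_analytic (hf : Source f) (hη : Source η) (a : ℝ) {θ : Space} (hθ : ‖θ‖ = 1) :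
    AnalyticOnNhd ℂ (fun z => rayTransform f θ z * rayTransform η θ z) (strip a) :=
  (hf.analyticOnNhd a hθ).mul (hη.analyticOnNhd a hθ)

lemma fourier_eq_zero_of_abs_rpow (hf : Source f) (hg : Source g) (hη : Source η) (h0 : 𝓕 η 0 ≠ 0)
    (ha : 0 < a) {s c : ℝ} (hs : 0 < s) (hs1 : s < 1) (hc : c ≠ 0)
    (h : RayAnalytic a fun ξ => ((waveNumber ξ : ℂ) * 𝓕 g ξ -
      ((c * waveNumber ξ ^ (s - 1) : ℝ) : ℂ) * 𝓕 f ξ) * 𝓕 η ξ) :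
    (∀ ξ, 𝓕 f ξ = 0) ∧ ∀ ξ, 𝓕 g ξ = 0 := by
  have m0 : (0 : ℂ) ∈ strip a := by simpa using ofReal_mem_strip ha 0
  have key : ∀ θ : Space, ‖θ‖ = 1 →
      (fun z => rayTransform f θ z * rayTransform η θ z) =ᶠ[𝓝 0] 0 ∧
      (fun z => rayTransform g θ z * rayTransform η θ z) =ᶠ[𝓝 0] 0 := by
    intro θ hθ
    obtain ⟨P, hP, hPe⟩ := h θ hθ
    refine eventually_zero_of_abs_rpow (ray_mul_analytic hf hη a hθ 0 m0)
      (ray_mul_analytic hg hη a hθ 0 m0) (hP 0 m0) hs hs1 hc fun t ht => ?_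
    rw [hPe t ht]
    beta_reduce
    rw [waveNumber_smul hθ, rayTransform_ofReal, rayTransform_ofReal, rayTransform_ofReal]
    ring
  exact ⟨hf.fourier_eq_zero hη h0 fun θ hθ => (key θ hθ).1,
    hg.fourier_eq_zero hη h0 fun θ hθ => (key θ hθ).2⟩

lemma fourier_eq_zero_of_abs (hg : Source g) (hη : Source η) (h0 : 𝓕 η 0 ≠ 0) (ha : 0 < a)
    (h : RayAnalytic a fun ξ => (waveNumber ξ : ℂ) * 𝓕 g ξ * 𝓕 η ξ) : ∀ ξ, 𝓕 g ξ = 0 := by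
  have m0 : (0 : ℂ) ∈ strip a := by simpa using ofReal_mem_strip ha 0
  refine hg.fourier_eq_zero hη h0 fun θ hθ => ?_
  obtain ⟨P, hP, hPe⟩ := h θ hθ
  refine eventually_zero_of_abs_mul (ray_mul_analytic hg hη a hθ 0 m0) (hP 0 m0)
    (Eventually.of_forall fun t ht => ?_)
  rw [hPe t ht]
  beta_reduce
  rw [waveNumber_smul hθ, rayTransform_ofReal, rayTransform_ofReal, mul_assoc]

lemma fourier_eq_zero_of_sqrt (hg : Source g) (hη : Source η) (h0 : 𝓕 η 0 ≠ 0) {m : ℝ} (hm : 0 < m)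
    (ha : m < 2 * Real.pi * a)
    (h : RayAnalytic a fun ξ => (√(waveNumber ξ ^ 2 + m ^ 2) : ℂ) * 𝓕 g ξ * 𝓕 η ξ) :
    ∀ ξ, 𝓕 g ξ = 0 := by
  have ha0 : 0 < a := by
    have : 0 < 2 * Real.pi * a := hm.trans ha
    exact (mul_pos_iff_of_pos_left (by positivity)).1 this
  have m0 : (0 : ℂ) ∈ strip a := by simpa using ofReal_mem_strip ha0 0
  refine hg.fourier_eq_zero hη h0 fun θ hθ => ?_
  obtain ⟨P, hP, hPe⟩ := h θ hθ
  refine (eqOn_zero_of_sqrt_mul hm ha hP (ray_mul_analytic hg hη a hθ) fun t ht => ?_).2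
    |>.eventuallyEq_of_mem ((isOpen_strip a).mem_nhds m0)
  rw [hPe t ht]
  beta_reduce
  rw [waveNumber_smul hθ, rayTransform_ofReal, rayTransform_ofReal, mul_assoc]

/-- The inverse root is the same relation with the roles exchanged: the source is the root times the
analytic extension. -/
lemma fourier_eq_zero_of_inv_sqrt (hg : Source g) (hη : Source η) (h0 : 𝓕 η 0 ≠ 0) {m : ℝ}
    (hm : 0 < m) (ha : m < 2 * Real.pi * a)
    (h : RayAnalytic a fun ξ => ((√(waveNumber ξ ^ 2 + m ^ 2))⁻¹ : ℂ) * 𝓕 g ξ * 𝓕 η ξ) :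
    ∀ ξ, 𝓕 g ξ = 0 := by
  have ha0 : 0 < a := by
    have : 0 < 2 * Real.pi * a := hm.trans ha
    exact (mul_pos_iff_of_pos_left (by positivity)).1 this
  have m0 : (0 : ℂ) ∈ strip a := by simpa using ofReal_mem_strip ha0 0
  refine hg.fourier_eq_zero hη h0 fun θ hθ => ?_
  obtain ⟨P, hP, hPe⟩ := h θ hθ
  refine (eqOn_zero_of_sqrt_mul hm ha (ray_mul_analytic hg hη a hθ) hP fun t ht => ?_).1
    |>.eventuallyEq_of_mem ((isOpen_strip a).mem_nhds m0)
  rw [hPe t ht]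
  beta_reduce
  rw [waveNumber_smul hθ, rayTransform_ofReal, rayTransform_ofReal]
  have : (√((2 * Real.pi * |t|) ^ 2 + m ^ 2) : ℂ) ≠ 0 := by
    exact_mod_cast (by positivity : √((2 * Real.pi * |t|) ^ 2 + m ^ 2) ≠ 0)
  rw [← mul_assoc, ← mul_assoc, mul_inv_cancel₀ this, one_mul]

end RayArguments

/-! ### Symplectic form and positive complex structures -/

/-- The phase space element given by two complex functions on space. -/
def pair (g f : Space → ℂ) : PhaseVec := fun ξ => (𝓕 g ξ, 𝓕 f ξ)

/-- Integrand of the symplectic form. -/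
def symplDensity (u v : PhaseVec) (ξ : Space) : ℂ := (u (-ξ)).2 * (v ξ).1 - (u (-ξ)).1 * (v ξ).2

lemma sympl_eq (u v : PhaseVec) : sympl u v = ∫ ξ, symplDensity u v ξ := rfl

lemma sympl_antisymm (u v : PhaseVec) : sympl u v = -sympl v u := by
  rw [sympl_eq, sympl_eq, ← integral_neg, ← integral_neg_eq_self]
  refine integral_congr_ae (ae_of_all _ fun ξ => ?_)
  simp only [symplDensity, neg_neg]
  ring

lemma sympl_self (u : PhaseVec) : sympl u u = 0 := self_eq_neg.1 (sympl_antisymm u u)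

lemma sympl_sum {ι : Type*} [Fintype ι] (e : ι → PhaseVec)
    (h : ∀ i j, Integrable (symplDensity (e i) (e j))) (a b : ι → ℂ) :
    Integrable (symplDensity (∑ i, a i • e i) (∑ j, b j • e j)) ∧
    sympl (∑ i, a i • e i) (∑ j, b j • e j) = ∑ i, ∑ j, a i * b j * sympl (e i) (e j) := by
  have e1 : symplDensity (∑ i, a i • e i) (∑ j, b j • e j) =
      fun ξ => ∑ i, ∑ j, a i * b j * symplDensity (e i) (e j) ξ := by
    funext ξ
    simp only [symplDensity, Finset.sum_apply, Prod.snd_sum, Prod.fst_sum, Pi.smul_apply,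
      Prod.smul_fst, Prod.smul_snd, smul_eq_mul, Finset.sum_mul_sum, ← Finset.sum_sub_distrib]
    refine Finset.sum_congr rfl fun i _ => Finset.sum_congr rfl fun j _ => ?_
    ring
  have h1 : ∀ i j, Integrable fun ξ => a i * b j * symplDensity (e i) (e j) ξ := fun i j =>
    (h i j).const_mul _
  constructor
  · rw [e1]
    exact integrable_finsetSum _ fun i _ => integrable_finsetSum _ fun j _ => h1 i j
  · rw [sympl_eq, e1, integral_finsetSum _ fun i _ => integrable_finsetSum _ fun j _ => h1 i j]
    refine Finset.sum_congr rfl fun i _ => ?_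
    rw [integral_finsetSum _ fun j _ => h1 i j]
    refine Finset.sum_congr rfl fun j _ => ?_
    rw [integral_const_mul, sympl_eq]

/-- Phase space elements that are real in position space. -/
def IsRealVec (u : PhaseVec) : Prop := conjVec u = u

lemma IsRealVec.fst {u : PhaseVec} (h : IsRealVec u) (ξ : Space) :
    (u (-ξ)).1 = conj (u ξ).1 := by
  have := congrArg Prod.fst (congrFun h ξ)
  simp only [conjVec] at this
  rw [← this, Complex.conj_conj]

lemma IsRealVec.snd {u : PhaseVec} (h : IsRealVec u) (ξ : Space) :
    (u (-ξ)).2 = conj (u ξ).2 := by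
  have := congrArg Prod.snd (congrFun h ξ)
  simp only [conjVec] at this
  rw [← this, Complex.conj_conj]

lemma IsRealVec.sympl {u v : PhaseVec} (hu : IsRealVec u) (hv : IsRealVec v) :
    conj (sympl u v) = sympl u v := by
  rw [sympl_eq, ← integral_conj, ← integral_neg_eq_self]
  refine integral_congr_ae (ae_of_all _ fun ξ => ?_)
  simp only [symplDensity, neg_neg, map_sub, map_mul, hu.fst, hu.snd, hv.fst, hv.snd,
    Complex.conj_conj]

lemma conj_fourier_ofReal (h : Space → ℝ) (ξ : Space) :
    conj (𝓕 (fun x => (h x : ℂ)) (-ξ)) = 𝓕 (fun x => (h x : ℂ)) ξ := by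
  rw [Real.fourier_eq, Real.fourier_eq, ← integral_conj]
  refine integral_congr_ae (ae_of_all _ fun x => ?_)
  simp only [Circle.smul_def, smul_eq_mul, map_mul, Complex.conj_ofReal, inner_neg_right, neg_neg]
  rw [← Circle.coe_inv_eq_conj, ← AddChar.map_neg_eq_inv]

lemma isRealVec_ofFunctions (g f : Space → ℝ) : IsRealVec (ofFunctions g f) := by
  funext ξ
  simp only [conjVec, ofFunctions, conj_fourier_ofReal]

/-- Symbols of positive complex structures with the bounds that make the pairings of a local mode
finite. -/
structure IsComplexStructure (S : ℝ → Matrix (Fin 2) (Fin 2) ℝ) : Prop where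
  admissible : ∀ i j, IsAdmissible fun k => S k i j
  trace_eq : ∀ k > 0, S k 1 1 = -S k 0 0
  det_eq : ∀ k > 0, S k 0 1 * S k 1 0 = -(1 + S k 0 0 ^ 2)
  pos : ∀ k > 0, 0 < S k 1 0
  bound_diag : ∃ C, ∀ k ≥ 1, |S k 0 0| ≤ C * 1
  bound_upper : ∃ C, ∀ k ≥ 1, |S k 0 1| ≤ C * k⁻¹
  bound_lower : ∃ C, ∀ k ≥ 1, |S k 1 0| ≤ C * k

/-- No nonzero pair of sources is mapped to a pair that is analytic on lines, even after
mollification. -/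
def IsRigid (S : ℝ → Matrix (Fin 2) (Fin 2) ℝ) : Prop :=
  ∃ a > 0, ∀ g f η η' : Space → ℂ, Source g → Source f → Source η → 𝓕 η 0 ≠ 0 → Source η' →
    𝓕 η' 0 ≠ 0 →
    RayAnalytic a (fun ξ => (multiplier S (pair g f) ξ).1 * 𝓕 η ξ) →
    RayAnalytic a (fun ξ => (multiplier S (pair g f) ξ).2 * 𝓕 η' ξ) →
    (∀ ξ, 𝓕 f ξ = 0) ∧ ∀ ξ, 𝓕 g ξ = 0

namespace IsComplexStructure

variable {S : ℝ → Matrix (Fin 2) (Fin 2) ℝ}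

/-- Cayley–Hamilton: off the origin the symbol has trace `0` and determinant `1`. -/
lemma multiplier_multiplier (hS : IsComplexStructure S) (u : PhaseVec) {ξ : Space} (hξ : ξ ≠ 0) :
    multiplier S (multiplier S u) ξ = -u ξ := by
  have hk := waveNumber_pos hξ
  have h1 : (S (waveNumber ξ) 1 1 : ℂ) = -S (waveNumber ξ) 0 0 := by
    exact_mod_cast hS.trace_eq _ hk
  have h2 : (S (waveNumber ξ) 0 1 : ℂ) * S (waveNumber ξ) 1 0 = -(1 + S (waveNumber ξ) 0 0 ^ 2) := by
    exact_mod_cast hS.det_eq _ hk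
  ext
  · simp only [multiplier, h1, Prod.fst_neg]
    linear_combination (u ξ).1 * h2
  · simp only [multiplier, h1, Prod.snd_neg]
    linear_combination (u ξ).2 * h2

/-- A trace-free symbol belongs to the symplectic Lie algebra; radiality makes it agree at `ξ` and
`-ξ`. -/
lemma symplDensity_multiplier_left (hS : IsComplexStructure S) (u v : PhaseVec) {ξ : Space} (hξ : ξ ≠ 0) :
    symplDensity (multiplier S u) v ξ = -symplDensity u (multiplier S v) ξ := by
  have h1 : (S (waveNumber ξ) 1 1 : ℂ) = -S (waveNumber ξ) 0 0 := by
    exact_mod_cast hS.trace_eq _ (waveNumber_pos hξ)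
  simp only [symplDensity, multiplier, waveNumber_neg, h1]
  ring

lemma symplDensity_multiplier (hS : IsComplexStructure S) (u v : PhaseVec) {ξ : Space} (hξ : ξ ≠ 0) :
    symplDensity (multiplier S u) (multiplier S v) ξ = symplDensity u v ξ := by
  rw [hS.symplDensity_multiplier_left _ _ hξ]
  simp only [symplDensity]
  rw [hS.multiplier_multiplier v hξ]
  simp only [Prod.fst_neg, Prod.snd_neg]
  ring

lemma sympl_multiplier_left (hS : IsComplexStructure S) (u v : PhaseVec) :
    sympl (multiplier S u) v = -sympl u (multiplier S v) := by
  rw [sympl_eq, sympl_eq, ← integral_neg]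
  refine integral_congr_ae ?_
  filter_upwards [ae_ne_zero] with ξ hξ
  exact hS.symplDensity_multiplier_left u v hξ

lemma sympl_multiplier (hS : IsComplexStructure S) (u v : PhaseVec) :
    sympl (multiplier S u) (multiplier S v) = sympl u v := by
  rw [sympl_eq, sympl_eq]
  refine integral_congr_ae ?_
  filter_upwards [ae_ne_zero] with ξ hξ
  exact hS.symplDensity_multiplier u v hξ

lemma isRealVec_multiplier {u : PhaseVec} (hu : IsRealVec u) : IsRealVec (multiplier S u) := by
  funext ξ
  ext
  · simp only [conjVec, multiplier, waveNumber_neg, hu.fst, hu.snd, map_add, map_mul,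
      Complex.conj_ofReal, Complex.conj_conj]
  · simp only [conjVec, multiplier, waveNumber_neg, hu.fst, hu.snd, map_add, map_mul,
      Complex.conj_ofReal, Complex.conj_conj]

/-- Positivity of the complex structure. -/
lemma symplDensity_multiplier_self (hS : IsComplexStructure S) {u : PhaseVec} (hu : IsRealVec u) {ξ : Space} (hξ : ξ ≠ 0) :
    symplDensity (multiplier S u) u ξ =
      (((‖(S (waveNumber ξ) 1 0 : ℂ) * (u ξ).1 - (S (waveNumber ξ) 0 0 : ℂ) * (u ξ).2‖ ^ 2 +
        ‖(u ξ).2‖ ^ 2) / S (waveNumber ξ) 1 0 : ℝ) : ℂ) := by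
  have hk := waveNumber_pos hξ
  have h1 : (S (waveNumber ξ) 1 1 : ℂ) = -S (waveNumber ξ) 0 0 := by
    exact_mod_cast hS.trace_eq _ hk
  have h2 : (S (waveNumber ξ) 0 1 : ℂ) * S (waveNumber ξ) 1 0 = -(1 + S (waveNumber ξ) 0 0 ^ 2) := by
    exact_mod_cast hS.det_eq _ hk
  have h3 : (S (waveNumber ξ) 1 0 : ℂ) ≠ 0 := by exact_mod_cast (hS.pos _ hk).ne'
  push_cast
  rw [eq_div_iff h3, ← Complex.conj_mul', ← Complex.conj_mul']
  simp only [symplDensity, multiplier, waveNumber_neg, h1, hu.fst, hu.snd, map_sub, map_mul,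
    Complex.conj_ofReal]
  linear_combination (-conj (u ξ).2 * (u ξ).2) * h2

end IsComplexStructure

/-! ### The local mode, its Gram matrix and its partner -/

namespace LocalMode

variable (A : LocalMode)

lemma source_g (i : Fin 2) : Source fun x => (A.g i x : ℂ) :=
  ⟨(A.integrable_g i).ofReal, (A.compact_g i).comp_left Complex.ofReal_zero⟩

lemma source_f (i : Fin 2) : Source fun x => (A.f i x : ℂ) :=
  ⟨(A.integrable_f i).ofReal, (A.compact_f i).comp_left Complex.ofReal_zero⟩

lemma isRealVec_basis (i : Fin 2) : IsRealVec (A.basis i) := isRealVec_ofFunctions _ _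

lemma continuous_basis_fst (i : Fin 2) : Continuous fun ξ => (A.basis i ξ).1 :=
  fourier_continuous (A.source_g i).integrable

lemma continuous_basis_snd (i : Fin 2) : Continuous fun ξ => (A.basis i ξ).2 :=
  fourier_continuous (A.source_f i).integrable

lemma norm_basis_neg_fst (i : Fin 2) (ξ : Space) : ‖(A.basis i (-ξ)).1‖ = ‖(A.basis i ξ).1‖ := by
  rw [(A.isRealVec_basis i).fst, RCLike.norm_conj]

lemma norm_basis_neg_snd (i : Fin 2) (ξ : Space) : ‖(A.basis i (-ξ)).2‖ = ‖(A.basis i ξ).2‖ := by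
  rw [(A.isRealVec_basis i).snd, RCLike.norm_conj]

lemma integrable_weight {w w₁ w₂ : Space → ℝ} {p q : Space → ℂ} (hp : Continuous p)
    (hq : Continuous q) (hw : AEStronglyMeasurable w) (hw0 : ∀ᵐ ξ, 0 ≤ w ξ)
    (h₁ : Integrable fun ξ => w₁ ξ * ‖p ξ‖ ^ 2) (h₂ : Integrable fun ξ => w₂ ξ * ‖q ξ‖ ^ 2)
    (hle : ∀ᵐ ξ, ∀ x y : ℝ, 2 * (w ξ * (x * y)) ≤ w₁ ξ * x ^ 2 + w₂ ξ * y ^ 2) :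
    Integrable fun ξ => w ξ * (‖p ξ‖ * ‖q ξ‖) := by
  refine (h₁.add h₂).mono' ?_ ?_
  · exact hw.mul (hp.norm.mul hq.norm).aestronglyMeasurable
  · filter_upwards [hw0, hle] with ξ h0 hξ
    have h3 : 0 ≤ w ξ * (‖p ξ‖ * ‖q ξ‖) := by positivity
    rw [Real.norm_of_nonneg h3]
    have := hξ ‖p ξ‖ ‖q ξ‖
    simp only [Pi.add_apply]
    linarith

lemma integrable_gg (i j : Fin 2) :
    Integrable fun ξ => waveNumber ξ * ‖(A.basis i (-ξ)).1 * (A.basis j ξ).1‖ := by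
  simp only [norm_mul, norm_basis_neg_fst]
  refine integrable_weight (A.continuous_basis_fst i) (A.continuous_basis_fst j)
    continuous_waveNumber.aestronglyMeasurable (ae_of_all _ waveNumber_nonneg)
    (A.sobolev_g i) (A.sobolev_g j) (ae_of_all _ fun ξ x y => ?_)
  have := waveNumber_nonneg ξ
  nlinarith [mul_nonneg this (sq_nonneg (x - y))]

lemma aestronglyMeasurable_inv_waveNumber : AEStronglyMeasurable fun ξ => (waveNumber ξ)⁻¹ :=
  (continuous_waveNumber.measurable.inv).aestronglyMeasurable

lemma integrable_ff (i j : Fin 2) :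
    Integrable fun ξ => (waveNumber ξ)⁻¹ * ‖(A.basis i (-ξ)).2 * (A.basis j ξ).2‖ := by
  simp only [norm_mul, norm_basis_neg_snd]
  refine integrable_weight (A.continuous_basis_snd i) (A.continuous_basis_snd j)
    aestronglyMeasurable_inv_waveNumber (ae_of_all _ fun ξ => inv_nonneg.2 (waveNumber_nonneg ξ))
    (A.sobolev_f i) (A.sobolev_f j) (ae_of_all _ fun ξ x y => ?_)
  have := inv_nonneg.2 (waveNumber_nonneg ξ)
  nlinarith [mul_nonneg this (sq_nonneg (x - y))]

/-- The weight `1` is the geometric mean of `k` and `k⁻¹`, so the two Sobolev norms are exactly what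
the symplectic form needs. -/
lemma integrable_gf_norm (i j : Fin 2) :
    Integrable fun ξ => (1 : ℝ) * (‖(A.basis i ξ).1‖ * ‖(A.basis j ξ).2‖) := by
  refine integrable_weight (w := fun _ => 1) (A.continuous_basis_fst i) (A.continuous_basis_snd j)
    aestronglyMeasurable_const (ae_of_all _ fun _ => zero_le_one) (A.sobolev_g i) (A.sobolev_f j) ?_
  filter_upwards [ae_ne_zero] with ξ hξ x y
  have hk := waveNumber_pos hξ
  have h1 : 0 ≤ (waveNumber ξ)⁻¹ * (waveNumber ξ * x - y) ^ 2 := by positivity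
  have h2 : (waveNumber ξ)⁻¹ * (waveNumber ξ * x - y) ^ 2 =
      waveNumber ξ * x ^ 2 + (waveNumber ξ)⁻¹ * y ^ 2 - 2 * (1 * (x * y)) := by
    field_simp
    ring
  linarith

lemma integrable_gf (i j : Fin 2) :
    Integrable fun ξ => (1 : ℝ) * ‖(A.basis i (-ξ)).1 * (A.basis j ξ).2‖ := by
  simp only [norm_mul, norm_basis_neg_fst]
  exact A.integrable_gf_norm i j

lemma integrable_fg (i j : Fin 2) :
    Integrable fun ξ => (1 : ℝ) * ‖(A.basis i (-ξ)).2 * (A.basis j ξ).1‖ := by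
  simp only [norm_mul, norm_basis_neg_snd]
  refine (A.integrable_gf_norm j i).congr (ae_of_all _ fun ξ => ?_)
  simp only
  ring

variable {A} in
lemma continuous_fg (i j : Fin 2) : Continuous fun ξ => (A.basis i (-ξ)).2 * (A.basis j ξ).1 :=
  ((A.continuous_basis_snd i).comp continuous_neg).mul (A.continuous_basis_fst j)

variable {A} in
lemma continuous_gf (i j : Fin 2) : Continuous fun ξ => (A.basis i (-ξ)).1 * (A.basis j ξ).2 :=
  ((A.continuous_basis_fst i).comp continuous_neg).mul (A.continuous_basis_snd j)

lemma integrable_density (i j : Fin 2) : Integrable (symplDensity (A.basis i) (A.basis j)) := by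
  refine Integrable.sub ?_ ?_
  · exact (A.integrable_fg i j).mono' (continuous_fg i j).aestronglyMeasurable
      (ae_of_all _ fun ξ => by rw [one_mul])
  · exact (A.integrable_gf i j).mono' (continuous_gf i j).aestronglyMeasurable
      (ae_of_all _ fun ξ => by rw [one_mul])

variable {S : ℝ → Matrix (Fin 2) (Fin 2) ℝ}

/-- At high frequency each entry of the symbol meets the product with matching weight: `k` for two
field components, `k⁻¹` for two momenta, `1` for mixed terms. At low frequency local integrability
suffices, since the transforms are continuous. -/
lemma integrable_density_multiplier (hS : IsComplexStructure S) (i j : Fin 2) :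
    Integrable (symplDensity (multiplier S (A.basis i)) (A.basis j)) := by
  obtain ⟨C₀, h₀⟩ := hS.bound_diag
  obtain ⟨C₁, h₁⟩ := hS.bound_upper
  obtain ⟨C₂, h₂⟩ := hS.bound_lower
  have h₃ : ∀ k ≥ 1, |S k 1 1| ≤ C₀ * 1 := fun k hk => by
    rw [hS.trace_eq k (by linarith), abs_neg]
    exact h₀ k hk
  have cgg : Continuous fun ξ => (A.basis i (-ξ)).1 * (A.basis j ξ).1 :=
    ((A.continuous_basis_fst i).comp continuous_neg).mul (A.continuous_basis_fst j)
  have cff : Continuous fun ξ => (A.basis i (-ξ)).2 * (A.basis j ξ).2 :=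
    ((A.continuous_basis_snd i).comp continuous_neg).mul (A.continuous_basis_snd j)
  have i1 := (hS.admissible 1 0).integrable_mul_of_dominated (w := fun k => k) h₂ cgg
    (A.integrable_gg i j)
  have i2 := (hS.admissible 1 1).integrable_mul_of_dominated (w := fun _ => 1) h₃
    (continuous_fg i j) (A.integrable_fg i j)
  have i3 := (hS.admissible 0 0).integrable_mul_of_dominated (w := fun _ => 1) h₀
    (continuous_gf i j) (A.integrable_gf i j)
  have i4 := (hS.admissible 0 1).integrable_mul_of_dominated (w := fun k => k⁻¹) h₁ cff
    (A.integrable_ff i j)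
  refine ((i1.add i2).sub (i3.add i4)).congr (ae_of_all _ fun ξ => ?_)
  simp only [symplDensity, multiplier, waveNumber_neg, Pi.sub_apply, Pi.add_apply]
  ring

/-- The basis of `Γ_A` and its image under the complex structure. -/
def frame (S : ℝ → Matrix (Fin 2) (Fin 2) ℝ) : Fin 4 → PhaseVec :=
  ![A.basis 0, A.basis 1, multiplier S (A.basis 0), multiplier S (A.basis 1)]

lemma integrable_frame (hS : IsComplexStructure S) (i j : Fin 4) :
    Integrable (symplDensity (A.frame S i) (A.frame S j)) := by
  have hbb := A.integrable_density
  have hpb := A.integrable_density_multiplier hS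
  have hbp : ∀ i j, Integrable (symplDensity (A.basis i) (multiplier S (A.basis j))) := fun i j => by
    refine (hpb i j).neg.congr ?_
    filter_upwards [ae_ne_zero] with ξ hξ
    simp only [Pi.neg_apply]
    rw [hS.symplDensity_multiplier_left _ _ hξ, neg_neg]
  have hpp : ∀ i j, Integrable (symplDensity (multiplier S (A.basis i))
      (multiplier S (A.basis j))) := fun i j => by
    refine (hbb i j).congr ?_
    filter_upwards [ae_ne_zero] with ξ hξ
    exact (hS.symplDensity_multiplier _ _ hξ).symm
  fin_cases i <;> fin_cases j
  exacts [hbb 0 0, hbb 0 1, hbp 0 0, hbp 0 1, hbb 1 0, hbb 1 1, hbp 1 0, hbp 1 1,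
    hpb 0 0, hpb 0 1, hpp 0 0, hpp 0 1, hpb 1 0, hpb 1 1, hpp 1 0, hpp 1 1]

/-- The matrix of `ω(J ·, ·)` on `Γ_A`. -/
def gram (S : ℝ → Matrix (Fin 2) (Fin 2) ℝ) (i j : Fin 2) : ℂ :=
  sympl (multiplier S (A.basis i)) (A.basis j)

lemma gram_symm (hS : IsComplexStructure S) (i j : Fin 2) : A.gram S i j = A.gram S j i := by
  rw [gram, hS.sympl_multiplier_left, ← sympl_antisymm, gram]

/-- Element of the span of the frame. -/
def comb (S : ℝ → Matrix (Fin 2) (Fin 2) ℝ) (a : Fin 4 → ℂ) : PhaseVec := ∑ i, a i • A.frame S i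

lemma comb_eq (S : ℝ → Matrix (Fin 2) (Fin 2) ℝ) (a : Fin 4 → ℂ) : A.comb S a =
    a 0 • A.basis 0 + a 1 • A.basis 1 + a 2 • multiplier S (A.basis 0) +
      a 3 • multiplier S (A.basis 1) := by
  rw [comb, Fin.sum_univ_four]
  rfl

lemma sympl_comb (hS : IsComplexStructure S) (a b : Fin 4 → ℂ) :
    sympl (A.comb S a) (A.comb S b) = a 0 * b 1 - a 1 * b 0 + (a 2 * b 3 - a 3 * b 2) +
      A.gram S 0 0 * (a 2 * b 0 - a 0 * b 2) + A.gram S 1 1 * (a 3 * b 1 - a 1 * b 3) +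
      A.gram S 0 1 * (a 2 * b 1 + a 3 * b 0 - a 0 * b 3 - a 1 * b 2) := by
  rw [comb, comb, (sympl_sum _ (A.integrable_frame hS) a b).2]
  have d01 : sympl (A.basis 0) (A.basis 1) = 1 := A.darboux
  have d10 : sympl (A.basis 1) (A.basis 0) = -1 := by rw [sympl_antisymm, d01]
  have hbp : ∀ i j, sympl (A.basis i) (multiplier S (A.basis j)) = -A.gram S j i := fun i j => by
    rw [sympl_antisymm, gram]
  have f01 : sympl (A.frame S 0) (A.frame S 1) = 1 := d01
  have f10 : sympl (A.frame S 1) (A.frame S 0) = -1 := d10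
  have f23 : sympl (A.frame S 2) (A.frame S 3) = 1 := (hS.sympl_multiplier _ _).trans d01
  have f32 : sympl (A.frame S 3) (A.frame S 2) = -1 := (hS.sympl_multiplier _ _).trans d10
  have f02 : sympl (A.frame S 0) (A.frame S 2) = -A.gram S 0 0 := hbp 0 0
  have f03 : sympl (A.frame S 0) (A.frame S 3) = -A.gram S 0 1 :=
    (hbp 0 1).trans (by rw [A.gram_symm hS])
  have f12 : sympl (A.frame S 1) (A.frame S 2) = -A.gram S 0 1 := hbp 1 0
  have f13 : sympl (A.frame S 1) (A.frame S 3) = -A.gram S 1 1 := hbp 1 1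
  have f20 : sympl (A.frame S 2) (A.frame S 0) = A.gram S 0 0 := rfl
  have f21 : sympl (A.frame S 2) (A.frame S 1) = A.gram S 0 1 := rfl
  have f30 : sympl (A.frame S 3) (A.frame S 0) = A.gram S 0 1 := A.gram_symm hS 1 0
  have f31 : sympl (A.frame S 3) (A.frame S 1) = A.gram S 1 1 := rfl
  simp only [Fin.sum_univ_four, sympl_self, f01, f10, f23, f32, f02, f03, f12, f13, f20, f21, f30,
    f31]
  ring

lemma gram_real (i j : Fin 2) : conj (A.gram S i j) = A.gram S i j :=
  (IsComplexStructure.isRealVec_multiplier (A.isRealVec_basis i)).sympl (A.isRealVec_basis j)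

lemma conjVec_comb (S : ℝ → Matrix (Fin 2) (Fin 2) ℝ) (a : Fin 4 → ℂ) :
    conjVec (A.comb S a) = A.comb S fun i => conj (a i) := by
  have hb := A.isRealVec_basis
  have hp : ∀ i, IsRealVec (multiplier S (A.basis i)) := fun i =>
    IsComplexStructure.isRealVec_multiplier (hb i)
  funext ξ
  simp only [comb_eq]
  ext
  · simp only [conjVec, Pi.add_apply, Pi.smul_apply, Prod.fst_add, Prod.smul_fst, smul_eq_mul,
      map_add, map_mul, (hb _).fst, (hp _).fst, Complex.conj_conj]
  · simp only [conjVec, Pi.add_apply, Pi.smul_apply, Prod.snd_add, Prod.smul_snd, smul_eq_mul,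
      map_add, map_mul, (hb _).snd, (hp _).snd, Complex.conj_conj]

lemma multiplier_comb_zero (S : ℝ → Matrix (Fin 2) (Fin 2) ℝ) (α β : ℂ) :
    multiplier S (α • A.basis 0 + β • A.basis 1) = A.comb S ![0, 0, α, β] := by
  rw [comb_eq]
  funext ξ
  ext
  · simp [multiplier]
    ring
  · simp [multiplier]
    ring

/-- The projection of `J u` onto the orthogonal complement of `Γ_A`, for `u` with the given
coordinates. -/
def partnerVec (S : ℝ → Matrix (Fin 2) (Fin 2) ℝ) (α β : ℂ) : PhaseVec :=
  A.comb S ![-(A.gram S 0 1 * α + A.gram S 1 1 * β), A.gram S 0 0 * α + A.gram S 0 1 * β, α, β]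

lemma partnerVec_eq (hS : IsComplexStructure S) (α β : ℂ) :
    multiplier S (α • A.basis 0 + β • A.basis 1) -
      A.proj (multiplier S (α • A.basis 0 + β • A.basis 1)) = A.partnerVec S α β := by
  have b0 : A.basis 0 = A.comb S ![1, 0, 0, 0] := by simp [comb_eq]
  have b1 : A.basis 1 = A.comb S ![0, 1, 0, 0] := by simp [comb_eq]
  have s0 : sympl (A.comb S ![0, 0, α, β]) (A.basis 0) = A.gram S 0 0 * α + A.gram S 0 1 * β := by
    rw [b0, A.sympl_comb hS]
    simp
  have s1 : sympl (A.comb S ![0, 0, α, β]) (A.basis 1) = A.gram S 0 1 * α + A.gram S 1 1 * β := by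
    rw [b1, A.sympl_comb hS]
    simp
    ring
  rw [multiplier_comb_zero, proj, s0, s1, partnerVec, comb_eq, comb_eq]
  simp only [Matrix.cons_val]
  module

lemma mem_partner_iff (hS : IsComplexStructure S) (v : PhaseVec) :
    v ∈ A.partner S ↔ ∃ α β : ℂ, v = A.partnerVec S α β := by
  constructor
  · rintro ⟨u, hu, rfl⟩
    obtain ⟨c, rfl⟩ := (Submodule.mem_span_range_iff_exists_fun ℂ).1 hu
    refine ⟨c 0, c 1, ?_⟩
    rw [Fin.sum_univ_two, A.partnerVec_eq hS]
  · rintro ⟨α, β, rfl⟩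
    refine ⟨α • A.basis 0 + β • A.basis 1, ?_, (A.partnerVec_eq hS α β).symm⟩
    exact Submodule.add_mem _ (Submodule.smul_mem _ _ (Submodule.subset_span ⟨0, rfl⟩))
      (Submodule.smul_mem _ _ (Submodule.subset_span ⟨1, rfl⟩))

/-- The last factor is the Klein–Gordon norm of the vector in the mode. `J` preserves it, and
removing the projection subtracts the part inside the mode, which is `det G` times the same
quantity. -/
lemma kleinGordon_partnerVec (hS : IsComplexStructure S) (α β : ℂ) :
    kleinGordon (A.partnerVec S α β) (A.partnerVec S α β) =
      (1 - (A.gram S 0 0 * A.gram S 1 1 - A.gram S 0 1 ^ 2)) *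
        (-Complex.I * (conj α * β - conj β * α)) := by
  rw [kleinGordon, partnerVec, conjVec_comb, A.sympl_comb hS]
  simp only [Matrix.cons_val, map_add, map_mul, map_neg, gram_real]
  ring

lemma not_forall_basis_eq_zero (i : Fin 2)
    (h : (∀ ξ, (A.basis i ξ).2 = 0) ∧ ∀ ξ, (A.basis i ξ).1 = 0) : False := by
  have d01 : sympl (A.basis 0) (A.basis 1) = 1 := A.darboux
  have : sympl (A.basis 0) (A.basis 1) = 0 := by
    rw [sympl_eq]
    refine integral_eq_zero_of_ae (ae_of_all _ fun ξ => ?_)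
    fin_cases i
    · simp only [Fin.zero_eta] at h
      simp [symplDensity, h.1, h.2]
    · simp only [Fin.mk_one] at h
      simp [symplDensity, h.1, h.2]
  rw [d01] at this
  exact one_ne_zero this

lemma continuousOn_multiplier_basis (hS : IsComplexStructure S) (i : Fin 2) :
    ContinuousOn (fun ξ => multiplier S (A.basis i) ξ) {0}ᶜ := by
  have hc : ∀ i j, ContinuousOn (fun ξ : Space => (S (waveNumber ξ) i j : ℂ)) {0}ᶜ := fun i j =>
    Complex.continuous_ofReal.comp_continuousOn
      (continuousOn_comp_waveNumber (hS.admissible i j).continuousOn)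
  have h1 := (A.continuous_basis_fst i).continuousOn (s := {0}ᶜ)
  have h2 := (A.continuous_basis_snd i).continuousOn (s := {0}ᶜ)
  exact (((hc 0 0).mul h1).add ((hc 0 1).mul h2)).prodMk (((hc 1 0).mul h1).add ((hc 1 1).mul h2))

/-- The correlations of a local mode are never those of a pure state. -/
lemma gram_det_ne_one (hS : IsComplexStructure S) (hr : IsRigid S) :
    A.gram S 0 0 * A.gram S 1 1 - A.gram S 0 1 ^ 2 ≠ 1 := by
  intro hdet
  set a := A.gram S 0 0 with ha
  set b := A.gram S 0 1 with hb
  set d := A.gram S 1 1 with hd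
  have haR : conj a = a := A.gram_real 0 0
  have hbR : conj b = b := A.gram_real 0 1
  -- This is `J e₀` minus its projection onto the mode; `y` below is its image under `J`, computed
  -- with `J² = -1`.
  set x := A.comb S ![-b, a, 1, 0] with hx
  have hxR : IsRealVec x := by
    unfold IsRealVec
    rw [hx, conjVec_comb]
    congr 1
    funext i
    fin_cases i <;> simp [haR, hbR]
  have hxe : x = (-b) • A.basis 0 + a • A.basis 1 + multiplier S (A.basis 0) := by
    rw [hx, comb_eq]
    simp
  set y := A.comb S ![-1, 0, -b, a] with hy
  have hye : y = (-1 : ℂ) • A.basis 0 + (-b) • multiplier S (A.basis 0) +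
      a • multiplier S (A.basis 1) := by
    rw [hy, comb_eq]
    simp
  have hJx : ∀ ξ ≠ 0, multiplier S x ξ = y ξ := by
    intro ξ hξ
    have h1 := hS.multiplier_multiplier (A.basis 0) hξ
    have h2 : multiplier S x ξ = (-b) • multiplier S (A.basis 0) ξ + a • multiplier S (A.basis 1) ξ +
        multiplier S (multiplier S (A.basis 0)) ξ := by
      rw [hxe]
      ext
      · simp [multiplier]
        ring
      · simp [multiplier]
        ring
    rw [h2, h1, hye]
    simp only [Pi.add_apply, Pi.smul_apply]
    module
  have hden : ∀ ξ ≠ 0, symplDensity y x ξ = symplDensity (multiplier S x) x ξ := by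
    intro ξ hξ
    simp only [symplDensity]
    rw [hJx (-ξ) (neg_ne_zero.2 hξ)]
  -- The pairing equals `a (det G - 1)`, which is why the assumed determinant makes `x` a null
  -- vector.
  have hzero : sympl y x = 0 := by
    rw [hy, hx, A.sympl_comb hS]
    simp only [Matrix.cons_val, ← ha, ← hb, ← hd]
    linear_combination a * hdet
  set q : Space → ℝ := fun ξ =>
    (‖(S (waveNumber ξ) 1 0 : ℂ) * (x ξ).1 - (S (waveNumber ξ) 0 0 : ℂ) * (x ξ).2‖ ^ 2 +
        ‖(x ξ).2‖ ^ 2) / S (waveNumber ξ) 1 0 with hq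
  have hyq : symplDensity y x =ᵐ[volume] fun ξ => (q ξ : ℂ) := by
    filter_upwards [ae_ne_zero] with ξ hξ
    rw [hden ξ hξ, hS.symplDensity_multiplier_self hxR hξ]
  have hint : Integrable fun ξ => (q ξ : ℂ) :=
    (sympl_sum _ (A.integrable_frame hS) _ _).1.congr hyq
  have hq0 : ∫ ξ, q ξ = 0 := by
    rw [sympl_eq, integral_congr_ae hyq, integral_complex_ofReal] at hzero
    exact_mod_cast hzero
  have hqn : 0 ≤ᵐ[volume] q := by
    filter_upwards [ae_ne_zero] with ξ hξ
    have := hS.pos _ (waveNumber_pos hξ)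
    simp only [hq, Pi.zero_apply]
    positivity
  have hqi : Integrable q := by
    have := hint.re
    simpa using this
  have hx0 : x =ᵐ[volume] 0 := by
    filter_upwards [(integral_eq_zero_iff_of_nonneg_ae hqn hqi).1 hq0, ae_ne_zero] with ξ h0 hξ
    have hp := hS.pos _ (waveNumber_pos hξ)
    have h1 : ‖(S (waveNumber ξ) 1 0 : ℂ) * (x ξ).1 - (S (waveNumber ξ) 0 0 : ℂ) * (x ξ).2‖ ^ 2 +
        ‖(x ξ).2‖ ^ 2 = 0 := by
      have h2 : q ξ = 0 := h0
      rw [hq] at h2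
      simpa [hp.ne'] using h2
    have h2 : ‖(x ξ).2‖ ^ 2 = 0 := ((add_eq_zero_iff_of_nonneg (sq_nonneg _) (sq_nonneg _)).1 h1).2
    have h3 : (x ξ).2 = 0 := by simpa using h2
    rw [h3] at h1
    have hp' : (S (waveNumber ξ) 1 0 : ℂ) ≠ 0 := by exact_mod_cast hp.ne'
    have h4 : (x ξ).1 = 0 := by simpa [hp.ne'] using h1
    exact Prod.ext h4 h3
  have hxc : ContinuousOn x {0}ᶜ := by
    have hc : ∀ i, ContinuousOn (A.basis i) {0}ᶜ := fun i =>
      ((A.continuous_basis_fst i).prodMk (A.continuous_basis_snd i)).continuousOn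
    rw [hxe]
    exact (((hc 0).const_smul (-b)).add ((hc 1).const_smul a)).add
      (A.continuousOn_multiplier_basis hS 0)
  -- Continuity upgrades the almost everywhere statement to all nonzero frequencies, as restriction
  -- to individual lines requires.
  have hx0' : Set.EqOn x 0 {0}ᶜ :=
    Measure.eqOn_open_of_ae_eq (ae_restrict_of_ae hx0) isOpen_compl_singleton hxc continuousOn_const
  have hp0 : ∀ ξ ≠ 0, multiplier S (A.basis 0) ξ = b • A.basis 0 ξ + (-a) • A.basis 1 ξ := by
    intro ξ hξ
    have h1 := hx0' hξ
    rw [hxe] at h1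
    simp only [Pi.add_apply, Pi.smul_apply, Pi.zero_apply] at h1
    have h2 : multiplier S (A.basis 0) ξ = ((-b) • A.basis 0 ξ + a • A.basis 1 ξ +
        multiplier S (A.basis 0) ξ) + (b • A.basis 0 ξ + (-a) • A.basis 1 ξ) := by module
    rw [h2, h1, zero_add]
  obtain ⟨r, -, hrig⟩ := hr
  obtain ⟨η, -, hη, hη0, -⟩ := exists_mollifier
  refine A.not_forall_basis_eq_zero 0 (hrig _ _ η η (A.source_g 0) (A.source_f 0) hη hη0 hη hη0 ?_ ?_)
  · refine (((((A.source_g 0).rayAnalytic r).const_mul b).add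
      (((A.source_g 1).rayAnalytic r).const_mul (-a))).mul (hη.rayAnalytic r)).congr fun ξ hξ => ?_
    have := congrArg Prod.fst (hp0 ξ hξ)
    exact congrArg (· * 𝓕 η ξ) this
  · refine (((((A.source_f 0).rayAnalytic r).const_mul b).add
      (((A.source_f 1).rayAnalytic r).const_mul (-a))).mul (hη.rayAnalytic r)).congr fun ξ hξ => ?_
    have := congrArg Prod.snd (hp0 ξ hξ)
    exact congrArg (· * 𝓕 η ξ) this

end LocalMode

/-! ### The Bunch–Davies and Minkowski symbols -/

section Symbols

variable {m H : ℝ}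

lemma muSq_pos (hm : 0 < m) (hH : m < H) : 0 < muSq m H := by
  have hq : 0 < m ^ 2 / H ^ 2 := by
    have : 0 < H := hm.trans hH
    positivity
  have : √(9 / 4 - m ^ 2 / H ^ 2) < 3 / 2 := (Real.sqrt_lt' (by norm_num)).2 (by linarith)
  unfold muSq
  linarith

lemma muSq_lt_half (hm : 0 < m) (hH : m < H) : muSq m H < 1 / 2 := by
  have hq : m ^ 2 / H ^ 2 < 1 := by
    have : 0 < H := hm.trans hH
    rw [div_lt_one (by positivity)]
    nlinarith
  have : 1 < √(9 / 4 - m ^ 2 / H ^ 2) := Real.lt_sqrt_of_sq_lt (by linarith)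
  unfold muSq
  linarith

/-- For `0 < s < 1/2` the cosine is positive and the argument of `Γ` lies strictly between the poles
at `-1` and `0`. -/
lemma bdConst_ne_zero {s : ℝ} (h₀ : 0 < s) (h₁ : s < 1 / 2) : bdConst s ≠ 0 := by
  have hpi := Real.pi_pos
  have hcos : 0 < Real.cos (Real.pi * s) :=
    Real.cos_pos_of_mem_Ioo ⟨by nlinarith, by nlinarith⟩
  have hG : Real.Gamma (-1 / 2 + s) ≠ 0 := by
    refine Real.Gamma_ne_zero fun n hn => ?_
    rcases Nat.eq_zero_or_pos n with rfl | h
    · simp only [Nat.cast_zero, neg_zero] at hn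
      linarith
    · have : (1 : ℝ) ≤ n := by exact_mod_cast h
      linarith
  unfold bdConst
  have h2 : (2 : ℝ) ^ (1 - s) ≠ 0 := by positivity
  have h3 : √Real.pi ≠ 0 := by positivity
  exact div_ne_zero (mul_ne_zero h2 h3) (mul_ne_zero hcos.ne' hG)

/-- Coefficient of `k ^ (μ² - 1)` in `bdCross`. -/
def bdCoeff (m H : ℝ) : ℝ := bdConst (muSq m H) * H ^ (1 - muSq m H)

lemma bdCoeff_ne_zero (hm : 0 < m) (hH : m < H) : bdCoeff m H ≠ 0 := by
  have : 0 < H := hm.trans hH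
  exact mul_ne_zero (bdConst_ne_zero (muSq_pos hm hH) (muSq_lt_half hm hH)) (by positivity)

lemma bdCross_eq (hm : 0 < m) (hH : m < H) {k : ℝ} (hk : 0 < k) :
    bdCross m H k = bdCoeff m H * k ^ (muSq m H - 1) := by
  have hH0 : 0 < H := hm.trans hH
  rw [bdCross, bdCoeff, Real.div_rpow hH0.le hk.le, show muSq m H - 1 = -(1 - muSq m H) by ring,
    Real.rpow_neg hk.le]
  ring

lemma symbolBD_upper_eq (hm : 0 < m) (hH : m < H) {k : ℝ} (hk : 0 < k) :
    symbolBD m H k 0 1 =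
      -1 * k ^ (-1 : ℝ) + -(bdCoeff m H ^ 2) * k ^ (2 * muSq m H - 3) := by
  have e : k ^ (2 * muSq m H - 3) = (k ^ (muSq m H - 1)) ^ 2 / k := by
    rw [← Real.rpow_natCast, ← Real.rpow_mul hk.le, ← Real.rpow_sub_one hk.ne']
    congr 1
    push_cast
    ring
  simp only [symbolBD, Matrix.of_apply, Matrix.cons_val', Matrix.cons_val]
  rw [bdCross_eq hm hH hk, Real.rpow_neg_one, e]
  ring

lemma symbolBD_isComplexStructure (hm : 0 < m) (hH : m < H) : IsComplexStructure (symbolBD m H) := by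
  have hs0 := muSq_pos hm hH
  have hs1 := muSq_lt_half hm hH
  set s := muSq m H with hs
  set B := bdCoeff m H with hB
  have e00 : ∀ k > 0, symbolBD m H k 0 0 = B * k ^ (s - 1) := fun k hk => by
    simpa [symbolBD] using bdCross_eq hm hH hk
  have e11 : ∀ k, symbolBD m H k 1 1 = -symbolBD m H k 0 0 := fun k => by simp [symbolBD]
  have e10 : ∀ k, symbolBD m H k 1 0 = k := fun k => by simp [symbolBD]
  have a00 : IsAdmissible fun k => symbolBD m H k 0 0 :=
    ((IsAdmissible.rpow (a := s - 1) (by linarith) (by linarith)).const_mul B).congr e00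
  have hpow : ∀ k ≥ (1 : ℝ), ∀ p : ℝ, p ≤ 0 → k ^ p ≤ 1 := fun k hk p hp =>
    Real.rpow_le_one_of_one_le_of_nonpos hk hp
  refine ⟨?_, fun k _ => e11 k, fun k hk => ?_, fun k hk => by rw [e10]; exact hk, ?_, ?_, ?_⟩
  · intro i j
    fin_cases i <;> fin_cases j
    · exact a00
    · exact (((IsAdmissible.rpow (a := -1) (by norm_num) (by norm_num)).const_mul (-1)).add
        ((IsAdmissible.rpow (a := 2 * s - 3) (by linarith) (by linarith)).const_mul
          (-(B ^ 2)))).congr fun k hk => symbolBD_upper_eq hm hH hk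
    · exact (IsAdmissible.of_continuous continuous_id
        ⟨1, fun k hk => by simp [abs_of_nonneg (zero_le_one.trans hk)]⟩).congr fun k _ => e10 k
    · exact (a00.const_mul (-1)).congr fun k _ => by
        simpa using e11 k
  · have : k ≠ 0 := ne_of_gt hk
    simp [symbolBD]
    field_simp
    ring
  · refine ⟨|B|, fun k hk => ?_⟩
    have hk0 : 0 < k := by linarith
    rw [e00 k hk0, abs_mul, abs_of_nonneg (by positivity : 0 ≤ k ^ (s - 1))]
    exact mul_le_mul_of_nonneg_left (hpow k hk _ (by linarith)) (abs_nonneg _)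
  · refine ⟨1 + B ^ 2, fun k hk => ?_⟩
    have hk0 : 0 < k := by linarith
    rw [symbolBD_upper_eq hm hH hk0, show -1 * k ^ (-1 : ℝ) + -(bdCoeff m H ^ 2) * k ^ (2 * s - 3) =
      -(k ^ (-1 : ℝ) + B ^ 2 * k ^ (2 * s - 3)) by ring, abs_neg, abs_of_nonneg (by positivity),
      add_mul, one_mul, ← Real.rpow_neg_one]
    gcongr
    linarith
  · exact ⟨1, fun k hk => by rw [e10, abs_of_nonneg (by linarith), one_mul]⟩

lemma symbolMink_isComplexStructure (m : ℝ) : IsComplexStructure (symbolMink m) := by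
  have e00 : ∀ k, symbolMink m k 0 0 = 0 := fun k => by simp [symbolMink]
  have e11 : ∀ k, symbolMink m k 1 1 = 0 := fun k => by simp [symbolMink]
  have e01 : ∀ k, symbolMink m k 0 1 = -1 * (√(k ^ 2 + m ^ 2))⁻¹ := fun k => by simp [symbolMink]
  have e10 : ∀ k, symbolMink m k 1 0 = √(k ^ 2 + m ^ 2) := fun k => by simp [symbolMink]
  have az : IsAdmissible fun _ => 0 :=
    IsAdmissible.of_continuous continuous_const ⟨0, fun k _ => by simp⟩
  have hpos : ∀ k > 0, 0 < √(k ^ 2 + m ^ 2) := fun k hk => by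
    have : 0 < k := hk
    positivity
  refine ⟨?_, fun k _ => by rw [e00, e11, neg_zero], fun k hk => ?_,
    fun k hk => by rw [e10]; exact hpos k hk, ⟨0, fun k _ => by simp [e00]⟩, ⟨1, fun k hk => ?_⟩, ?_⟩
  · intro i j
    fin_cases i <;> fin_cases j
    · exact az.congr fun k _ => e00 k
    · exact ((IsAdmissible.inv_sqrt m).const_mul (-1)).congr fun k _ => e01 k
    · exact (IsAdmissible.sqrt m).congr fun k _ => e10 k
    · exact az.congr fun k _ => e11 k
  · rw [e00, e01, e10]
    have := (hpos k hk).ne'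
    field_simp
    norm_num
  · have hk0 : 0 < k := by linarith
    rw [e01, neg_one_mul, abs_neg, abs_of_pos (inv_pos.2 (hpos k hk0)), one_mul]
    exact inv_anti₀ hk0 (Real.le_sqrt_of_sq_le (by nlinarith [sq_nonneg m]))
  · obtain ⟨C, hC⟩ := (IsAdmissible.sqrt m).growth
    exact ⟨C, fun k hk => by rw [e10]; exact hC k hk⟩

lemma multiplier_symbolBD_snd (hm : 0 < m) (hH : m < H) (u : PhaseVec) {ξ : Space} (hξ : ξ ≠ 0) :
    (multiplier (symbolBD m H) u ξ).2 = (waveNumber ξ : ℂ) * (u ξ).1 -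
      ((bdCoeff m H * waveNumber ξ ^ (muSq m H - 1) : ℝ) : ℂ) * (u ξ).2 := by
  rw [← bdCross_eq hm hH (waveNumber_pos hξ)]
  simp [multiplier, symbolBD]
  ring

lemma multiplier_symbolBD_fst (hm : 0 < m) (hH : m < H) (u : PhaseVec) {ξ : Space} (hξ : ξ ≠ 0) :
    (multiplier (symbolBD m H) u ξ).1 =
      bdCoeff m H * (((waveNumber ξ ^ (muSq m H - 1) : ℝ) : ℂ) * (u ξ).1) +
      -1 * (((waveNumber ξ ^ (-1 : ℝ) : ℝ) : ℂ) * (u ξ).2) +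
      -(bdCoeff m H ^ 2) * (((waveNumber ξ ^ (2 * muSq m H - 3) : ℝ) : ℂ) * (u ξ).2) := by
  have h1 := bdCross_eq hm hH (waveNumber_pos hξ)
  have h2 : symbolBD m H (waveNumber ξ) 0 0 = bdCross m H (waveNumber ξ) := by simp [symbolBD]
  simp only [multiplier, h2, h1, symbolBD_upper_eq hm hH (waveNumber_pos hξ)]
  push_cast
  ring

lemma multiplier_symbolMink_fst (m : ℝ) (u : PhaseVec) (ξ : Space) :
    (multiplier (symbolMink m) u ξ).1 =
      -1 * (((√(waveNumber ξ ^ 2 + m ^ 2))⁻¹ : ℝ) * (u ξ).2 : ℂ) := by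
  simp [multiplier, symbolMink]

lemma multiplier_symbolMink_snd (m : ℝ) (u : PhaseVec) (ξ : Space) :
    (multiplier (symbolMink m) u ξ).2 = (√(waveNumber ξ ^ 2 + m ^ 2) : ℝ) * (u ξ).1 := by
  simp [multiplier, symbolMink]

/-- The momentum row alone suffices: it mixes `k` with `k ^ (μ² - 1)`, and these two nonanalytic
factors are independent over analytic functions. -/
lemma symbolBD_isRigid (hm : 0 < m) (hH : m < H) : IsRigid (symbolBD m H) := by
  refine ⟨1, one_pos, fun g f η η' hg hf _ _ hη' hη0' _ h => ?_⟩
  refine fourier_eq_zero_of_abs_rpow hf hg hη' hη0' one_pos (muSq_pos hm hH)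
    (by linarith [muSq_lt_half hm hH]) (bdCoeff_ne_zero hm hH) (h.congr fun ξ hξ => ?_)
  rw [multiplier_symbolBD_snd hm hH _ hξ]
  rfl

lemma fourier_eq_zero_of_inv_abs {f η : Space → ℂ} (hf : Source f) (hη : Source η) (h0 : 𝓕 η 0 ≠ 0)
    {a : ℝ} (ha : 0 < a) (h : RayAnalytic a fun ξ => ((waveNumber ξ)⁻¹ : ℂ) * 𝓕 f ξ * 𝓕 η ξ) :
    ∀ ξ, 𝓕 f ξ = 0 := by
  have m0 : (0 : ℂ) ∈ strip a := by simpa using ofReal_mem_strip ha 0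
  refine hf.fourier_eq_zero hη h0 fun θ hθ => ?_
  obtain ⟨P, hP, hPe⟩ := h θ hθ
  have hrel : ∀ t : ℝ, t ≠ 0 → rayTransform f θ t * rayTransform η θ t =
      ((2 * Real.pi * |t| : ℝ) : ℂ) * P t := by
    intro t ht
    rw [hPe t ht]
    beta_reduce
    rw [waveNumber_smul hθ, rayTransform_ofReal, rayTransform_ofReal]
    have : ((2 * Real.pi * |t| : ℝ) : ℂ) ≠ 0 := by
      exact_mod_cast (by positivity : 2 * Real.pi * |t| ≠ 0)
    rw [← mul_assoc, ← mul_assoc, mul_inv_cancel₀ this, one_mul]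
  have hP0 := eventually_zero_of_abs_mul (hP 0 m0) (ray_mul_analytic hf hη a hθ 0 m0)
    (Eventually.of_forall hrel)
  refine eventually_eq_of_pos (ray_mul_analytic hf hη a hθ 0 m0) analyticAt_const ?_
  filter_upwards [(tendsto_ofReal_pos.mono_right nhdsWithin_le_nhds).eventually hP0,
    self_mem_nhdsWithin] with t ht htp
  have ht0 : 0 < t := htp
  rw [hrel t ht0.ne', ht]
  simp

lemma symbolMink_zero_isRigid : IsRigid (symbolMink 0) := by
  refine ⟨1, one_pos, fun g f η η' hg hf hη hη0 hη' hη0' h h' => ⟨?_, ?_⟩⟩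
  · refine fourier_eq_zero_of_inv_abs hf hη hη0 one_pos ((h.const_mul (-1)).congr fun ξ hξ => ?_)
    rw [multiplier_symbolMink_fst]
    simp [Real.sqrt_sq (waveNumber_nonneg ξ), pair]
  · refine fourier_eq_zero_of_abs hg hη' hη0' one_pos (h'.congr fun ξ hξ => ?_)
    rw [multiplier_symbolMink_snd]
    simp [Real.sqrt_sq (waveNumber_nonneg ξ), pair]

lemma symbolMink_isRigid (hm : 0 < m) : IsRigid (symbolMink m) := by
  have hpi := Real.pi_gt_three
  have ha : m < 2 * Real.pi * m := by nlinarith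
  refine ⟨m, hm, fun g f η η' hg hf hη hη0 hη' hη0' h h' => ⟨?_, ?_⟩⟩
  · refine fourier_eq_zero_of_inv_sqrt hf hη hη0 hm ha ((h.const_mul (-1)).congr fun ξ hξ => ?_)
    rw [multiplier_symbolMink_fst]
    simp [pair]
  · refine fourier_eq_zero_of_sqrt hg hη' hη0' hm ha (h'.congr fun ξ hξ => ?_)
    rw [multiplier_symbolMink_snd]
    simp [pair]

end Symbols

/-! ### Coordinates of partner vectors -/

section Linear

variable {f g : Space → ℂ}

lemma Source.linear (hf : Source f) (hg : Source g) (a b : ℂ) : Source fun x => a * f x + b * g x :=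
  ⟨(hf.integrable.const_mul a).add (hg.integrable.const_mul b),
    (hf.compact.mul_left (f := fun _ => a)).add (hg.compact.mul_left (f := fun _ => b))⟩

lemma fourier_linear (hf : Integrable f) (hg : Integrable g) (a b : ℂ) (ξ : Space) :
    𝓕 (fun x => a * f x + b * g x) ξ = a * 𝓕 f ξ + b * 𝓕 g ξ := by
  simp only [Real.fourier_eq]
  rw [← integral_const_mul, ← integral_const_mul, ← integral_add]
  · refine integral_congr_ae (ae_of_all _ fun x => ?_)
    simp only [Circle.smul_def, smul_eq_mul]
    ring
  · exact ((Real.fourierIntegral_convergent_iff ξ).2 hf).const_mul a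
  · exact ((Real.fourierIntegral_convergent_iff ξ).2 hg).const_mul b

end Linear

namespace LocalMode

variable (A : LocalMode)

/-- First component of the element of the complexification of `Γ_A` with the given coordinates. -/
def gSum (α β : ℂ) (x : Space) : ℂ := α * (A.g 0 x : ℂ) + β * (A.g 1 x : ℂ)

/-- Second component of the element of the complexification of `Γ_A` with the given coordinates. -/
def fSum (α β : ℂ) (x : Space) : ℂ := α * (A.f 0 x : ℂ) + β * (A.f 1 x : ℂ)

lemma source_gSum (α β : ℂ) : Source (A.gSum α β) := (A.source_g 0).linear (A.source_g 1) α β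

lemma source_fSum (α β : ℂ) : Source (A.fSum α β) := (A.source_f 0).linear (A.source_f 1) α β

lemma pair_sum (α β : ℂ) : pair (A.gSum α β) (A.fSum α β) = α • A.basis 0 + β • A.basis 1 := by
  funext ξ
  ext
  · exact fourier_linear (A.source_g 0).integrable (A.source_g 1).integrable α β ξ
  · exact fourier_linear (A.source_f 0).integrable (A.source_f 1).integrable α β ξ

lemma integral_fSum (α β : ℂ) :
    ∫ x, A.fSum α β x = α * ((∫ x, A.f 0 x : ℝ) : ℂ) + β * ((∫ x, A.f 1 x : ℝ) : ℂ) := by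
  unfold fSum
  rw [integral_add ((A.source_f 0).integrable.const_mul α) ((A.source_f 1).integrable.const_mul β),
    integral_const_mul, integral_const_mul, integral_complex_ofReal, integral_complex_ofReal]

lemma integral_gSum (α β : ℂ) :
    ∫ x, A.gSum α β x = α * ((∫ x, A.g 0 x : ℝ) : ℂ) + β * ((∫ x, A.g 1 x : ℝ) : ℂ) := by
  unfold gSum
  rw [integral_add ((A.source_g 0).integrable.const_mul α) ((A.source_g 1).integrable.const_mul β),
    integral_const_mul, integral_const_mul, integral_complex_ofReal, integral_complex_ofReal]

lemma exists_common_radius (α β α' β' : ℂ) : ∃ R, (∀ x, A.gSum α β x ≠ 0 → ‖x‖ ≤ R) ∧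
    (∀ x, A.fSum α β x ≠ 0 → ‖x‖ ≤ R) ∧ (∀ x, A.gSum α' β' x ≠ 0 → ‖x‖ ≤ R) ∧
    ∀ x, A.fSum α' β' x ≠ 0 → ‖x‖ ≤ R := by
  obtain ⟨R₁, -, h₁⟩ := (A.source_gSum α β).exists_radius
  obtain ⟨R₂, -, h₂⟩ := (A.source_fSum α β).exists_radius
  obtain ⟨R₃, -, h₃⟩ := (A.source_gSum α' β').exists_radius
  obtain ⟨R₄, -, h₄⟩ := (A.source_fSum α' β').exists_radius
  refine ⟨max (max R₁ R₂) (max R₃ R₄), fun x hx => ?_, fun x hx => ?_, fun x hx => ?_, fun x hx => ?_⟩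
  · exact (h₁ x hx).trans ((le_max_left _ _).trans (le_max_left _ _))
  · exact (h₂ x hx).trans ((le_max_right _ _).trans (le_max_left _ _))
  · exact (h₃ x hx).trans ((le_max_left _ _).trans (le_max_right _ _))
  · exact (h₄ x hx).trans ((le_max_right _ _).trans (le_max_right _ _))

/-- The projection has compact support, so the far field is governed by the multiplier term alone.
-/
lemma partnerVec_eq_multiplier_add (S : ℝ → Matrix (Fin 2) (Fin 2) ℝ) (α β : ℂ) :
    ∃ α' β' : ℂ, A.partnerVec S α β = fun ξ =>
      multiplier S (pair (A.gSum α β) (A.fSum α β)) ξ + pair (A.gSum α' β') (A.fSum α' β') ξ := by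
  refine ⟨-(A.gram S 0 1 * α + A.gram S 1 1 * β), A.gram S 0 0 * α + A.gram S 0 1 * β, ?_⟩
  have h : multiplier S (pair (A.gSum α β) (A.fSum α β)) = A.comb S ![0, 0, α, β] := by
    rw [pair_sum, multiplier_comb_zero]
  rw [h, pair_sum, partnerVec, comb_eq, comb_eq]
  funext ξ
  simp only [Matrix.cons_val, Pi.add_apply, Pi.smul_apply]
  module

/-- Cramer's rule. The determinant is, up to a factor `-i`, the Klein–Gordon norm of the mode vector
with coordinates `α`, `β`; for real data the second equation is the conjugate of the first. -/
lemma eq_zero_of_conj_pair {α β p q : ℂ} (h : conj α * β - conj β * α ≠ 0) (h₁ : α * p + β * q = 0)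
    (h₂ : conj α * p + conj β * q = 0) : p = 0 ∧ q = 0 := by
  constructor
  · refine (mul_eq_zero.1 (?_ : (conj α * β - conj β * α) * p = 0)).resolve_left h
    linear_combination β * h₂ - conj β * h₁
  · refine (mul_eq_zero.1 (?_ : (conj α * β - conj β * α) * q = 0)).resolve_left h
    linear_combination conj α * h₁ - α * h₂

variable {S : ℝ → Matrix (Fin 2) (Fin 2) ℝ}

lemma exists_unit_norm (hS : IsComplexStructure S) (hr : IsRigid S) :
    ∃ γ ∈ A.partner S, kleinGordon γ γ = 1 := by
  set d := A.gram S 0 0 * A.gram S 1 1 - A.gram S 0 1 ^ 2 with hd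
  have hd1 : d ≠ 1 := A.gram_det_ne_one hS hr
  have hdR : conj d = d := by simp [hd, gram_real]
  obtain ⟨r, hr⟩ := Complex.conj_eq_iff_real.1 hdR
  have hr1 : (1 - r : ℂ) ≠ 0 := by
    rw [← hr]
    exact sub_ne_zero.2 hd1.symm
  -- With `α = 1` and `β = i t` the mode vector has norm `2t`; `t` is chosen to cancel `1 - det G`,
  -- whatever its sign.
  refine ⟨A.partnerVec S 1 (((2 * (1 - r))⁻¹ : ℝ) * Complex.I),
    (A.mem_partner_iff hS _).2 ⟨_, _, rfl⟩, ?_⟩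
  rw [A.kleinGordon_partnerVec hS, ← hd, hr]
  simp only [map_one, map_mul, Complex.conj_ofReal, Complex.conj_I]
  push_cast
  field_simp
  linear_combination (-2 : ℂ) * Complex.I_sq

lemma exists_coordinates (hS : IsComplexStructure S) {γ : PhaseVec} (hγ : γ ∈ A.partner S)
    (h1 : kleinGordon γ γ = 1) :
    ∃ α β : ℂ, γ = A.partnerVec S α β ∧ conj α * β - conj β * α ≠ 0 := by
  obtain ⟨α, β, rfl⟩ := (A.mem_partner_iff hS _).1 hγ
  refine ⟨α, β, rfl, fun h => ?_⟩
  rw [A.kleinGordon_partnerVec hS, h] at h1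
  simp at h1

lemma integral_fSum_ne_zero {α β : ℂ} (h : conj α * β - conj β * α ≠ 0)
    (hi : ∃ i, ∫ x, A.f i x ≠ 0) : ∫ x, A.fSum α β x ≠ 0 := by
  intro h0
  rw [integral_fSum] at h0
  have h1 := congrArg conj h0
  simp only [map_add, map_mul, Complex.conj_ofReal, map_zero] at h1
  obtain ⟨e0, e1⟩ := eq_zero_of_conj_pair h h0 h1
  obtain ⟨i, hi⟩ := hi
  fin_cases i
  · exact hi (by exact_mod_cast e0)
  · exact hi (by exact_mod_cast e1)

lemma integral_gSum_ne_zero {α β : ℂ} (h : conj α * β - conj β * α ≠ 0)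
    (hi : ∃ i, ∫ x, A.g i x ≠ 0) : ∫ x, A.gSum α β x ≠ 0 := by
  intro h0
  rw [integral_gSum] at h0
  have h1 := congrArg conj h0
  simp only [map_add, map_mul, Complex.conj_ofReal, map_zero] at h1
  obtain ⟨e0, e1⟩ := eq_zero_of_conj_pair h h0 h1
  obtain ⟨i, hi⟩ := hi
  fin_cases i
  · exact hi (by exact_mod_cast e0)
  · exact hi (by exact_mod_cast e1)

/-- Otherwise conjugation makes both momentum components vanish, and the Darboux pairing could not
be `1`. -/
lemma exists_fourier_fSum_ne_zero {α β : ℂ} (h : conj α * β - conj β * α ≠ 0) :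
    ∃ ξ, 𝓕 (A.fSum α β) ξ ≠ 0 := by
  by_contra! h0
  have e : ∀ ξ, (A.basis 0 ξ).2 = 0 ∧ (A.basis 1 ξ).2 = 0 := by
    intro ξ
    have key : ∀ ξ, α * (A.basis 0 ξ).2 + β * (A.basis 1 ξ).2 = 0 := fun ξ => by
      rw [← h0 ξ]
      exact (congrArg Prod.snd (congrFun (A.pair_sum α β) ξ)).symm
    have h2 := congrArg conj (key (-ξ))
    simp only [(A.isRealVec_basis _).snd, map_add, map_mul, Complex.conj_conj, map_zero] at h2
    exact eq_zero_of_conj_pair h (key ξ) h2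
  have d01 : sympl (A.basis 0) (A.basis 1) = 1 := A.darboux
  rw [sympl_eq, integral_eq_zero_of_ae (ae_of_all _ fun ξ => by simp [symplDensity, e])] at d01
  exact zero_ne_one d01

lemma exists_fourier_gSum_ne_zero {α β : ℂ} (h : conj α * β - conj β * α ≠ 0) :
    ∃ ξ, 𝓕 (A.gSum α β) ξ ≠ 0 := by
  by_contra! h0
  have e : ∀ ξ, (A.basis 0 ξ).1 = 0 ∧ (A.basis 1 ξ).1 = 0 := by
    intro ξ
    have key : ∀ ξ, α * (A.basis 0 ξ).1 + β * (A.basis 1 ξ).1 = 0 := fun ξ => by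
      rw [← h0 ξ]
      exact (congrArg Prod.fst (congrFun (A.pair_sum α β) ξ)).symm
    have h2 := congrArg conj (key (-ξ))
    simp only [(A.isRealVec_basis _).fst, map_add, map_mul, Complex.conj_conj, map_zero] at h2
    exact eq_zero_of_conj_pair h (key ξ) h2
  have d01 : sympl (A.basis 0) (A.basis 1) = 1 := A.darboux
  rw [sympl_eq, integral_eq_zero_of_ae (ae_of_all _ fun ξ => by simp [symplDensity, e])] at d01
  exact zero_ne_one d01

end LocalMode

/-! ### Absence of compactly supported partner vectors -/

lemma FarRep.congr {u v h : Space → ℂ} {ρ : ℝ} (H : FarRep u h ρ) (e : ∀ ξ ≠ 0, v ξ = u ξ) :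
    FarRep v h ρ where
  continuousOn_symbol := H.1.congr e
  integrable φ := (H.2 φ).congr (by
    filter_upwards [ae_ne_zero] with ξ hξ
    rw [e ξ hξ])
  continuousOn := H.3
  equalsOn φ hc hs := by
    rw [← H.4 φ hc hs]
    refine integral_congr_ae ?_
    filter_upwards [ae_ne_zero] with ξ hξ
    rw [e ξ hξ]

/-- Any admissible multiplier expression in sources that vanishes as a distribution outside a ball
is represented there by zero. -/
lemma farRep_zero {σ τ : ℝ → ℝ} (hσ : IsAdmissible σ) (hτ : IsAdmissible τ) {g f p : Space → ℂ}
    (hg : Source g) (hf : Source f) (hp : Source p) {ρ : ℝ} {u : Space → ℂ}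
    (hu : u = fun ξ => (σ (waveNumber ξ) : ℂ) * 𝓕 g ξ + (τ (waveNumber ξ) : ℂ) * 𝓕 f ξ + 𝓕 p ξ)
    (h : EqualsOn u (fun _ => 0) (outside ρ)) : FarRep u (fun _ => 0) ρ where
  continuousOn_symbol := by
    have hc : ∀ {σ : ℝ → ℝ}, IsAdmissible σ →
        ContinuousOn (fun ξ : Space => (σ (waveNumber ξ) : ℂ)) {0}ᶜ := fun h =>
      Complex.continuous_ofReal.comp_continuousOn (continuousOn_comp_waveNumber h.continuousOn)
    rw [hu]
    exact (((hc hσ).mul (fourier_continuous hg.integrable).continuousOn).add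
      ((hc hτ).mul (fourier_continuous hf.integrable).continuousOn)).add
      (fourier_continuous hp.integrable).continuousOn
  integrable φ := by
    have hi : ∀ {σ : ℝ → ℝ} {f : Space → ℂ}, IsAdmissible σ → Source f →
        Integrable fun ξ => 𝓕 f ξ * ((σ (waveNumber ξ) : ℂ) * φ ξ) := fun hσ hf =>
      (hσ.integrable_mul_schwartz φ).bdd_mul (c := ∫ x, ‖_‖)
        (fourier_continuous hf.integrable).aestronglyMeasurable (ae_of_all _ (norm_fourier_le _))
    have hip : Integrable fun ξ => 𝓕 p ξ * φ ξ := φ.integrable.bdd_mul (c := ∫ x, ‖p x‖)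
      (fourier_continuous hp.integrable).aestronglyMeasurable (ae_of_all _ (norm_fourier_le p))
    refine (((hi hσ hg).add (hi hτ hf)).add hip).congr (ae_of_all _ fun ξ => ?_)
    simp only [hu, Pi.add_apply]
    ring
  continuousOn := continuousOn_const
  equalsOn := h

lemma rayAnalytic_of_add {a : ℝ} {u w p η : Space → ℂ} (hp : Source p) (hη : Source η)
    (h : RayAnalytic a fun ξ => u ξ * 𝓕 η ξ) (e : ∀ ξ, u ξ = w ξ + 𝓕 p ξ) :
    RayAnalytic a fun ξ => w ξ * 𝓕 η ξ := by
  refine (h.add (((hp.rayAnalytic a).mul (hη.rayAnalytic a)).const_mul (-1))).congr fun ξ _ => ?_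
  rw [e]
  ring

lemma isBigO_exp_recenter {h : Space → ℂ} {m : ℝ} (hm : 0 ≤ m) {x₀ : Space}
    (hh : h =O[cobounded Space] fun x => Real.exp (-m * ‖x - x₀‖)) :
    h =O[cobounded Space] fun x => Real.exp (-m * ‖x‖) := by
  refine hh.trans (IsBigO.of_bound (Real.exp (m * ‖x₀‖)) (Eventually.of_forall fun x => ?_))
  rw [Real.norm_of_nonneg (Real.exp_pos _).le, Real.norm_of_nonneg (Real.exp_pos _).le,
    ← Real.exp_add]
  refine Real.exp_le_exp.2 ?_
  have := norm_sub_norm_le x x₀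
  nlinarith

lemma isBigO_rpow_mono (x₀ : Space) {a b : ℝ} (h : a ≤ b) :
    (fun x => ‖x - x₀‖ ^ a) =O[cobounded Space] fun x => ‖x - x₀‖ ^ b := by
  refine IsBigO.of_bound 1 ?_
  filter_upwards [(tendsto_norm_sub_cobounded x₀).eventually_ge_atTop 1] with x hx
  rw [Real.norm_of_nonneg (by positivity), Real.norm_of_nonneg (by positivity), one_mul]
  exact Real.rpow_le_rpow_of_exponent_le hx h

namespace LocalMode

variable (A : LocalMode) {S : ℝ → Matrix (Fin 2) (Fin 2) ℝ}

/-- The partner mode has no nonzero compactly supported elements. -/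
lemma eq_zero_of_compactlySupported (hS : IsComplexStructure S) (hr : IsRigid S) {v : PhaseVec}
    (hv : v ∈ A.partner S) (hc : CompactlySupported v) : v = 0 := by
  obtain ⟨α, β, hαβ⟩ := (A.mem_partner_iff hS v).1 hv
  obtain ⟨α', β', hd⟩ := A.partnerVec_eq_multiplier_add S α β
  rw [← hαβ] at hd
  obtain ⟨ρ, h1, h2⟩ := hc
  obtain ⟨r, hr0, hrig⟩ := hr
  have hpos : 0 < 2 * Real.pi * r + 1 := by positivity
  -- The zero function decays at every rate; this one exceeds what a strip of half-width `r`
  -- requires.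
  have hO : (fun _ : Space => (0 : ℂ)) =O[cobounded Space]
      fun x => Real.exp (-(2 * Real.pi * r + 1) * ‖x‖) := isBigO_zero _ _
  have F1 := farRep_zero (hS.admissible 0 0) (hS.admissible 0 1) (A.source_gSum α β)
    (A.source_fSum α β) (A.source_gSum α' β') (by rw [hd]; rfl) h1
  have F2 := farRep_zero (hS.admissible 1 0) (hS.admissible 1 1) (A.source_gSum α β)
    (A.source_fSum α β) (A.source_fSum α' β') (by rw [hd]; rfl) h2
  obtain ⟨η, hη, hη0, hA⟩ := F1.rayAnalytic hO hpos (lt_add_one (2 * Real.pi * r))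
  obtain ⟨η', hη', hη0', hA'⟩ := F2.rayAnalytic hO hpos (lt_add_one (2 * Real.pi * r))
  have hz := hrig _ _ η η' (A.source_gSum α β) (A.source_fSum α β) hη hη0 hη' hη0'
    (rayAnalytic_of_add (A.source_gSum α' β') hη hA fun ξ => by rw [hd]; rfl)
    (rayAnalytic_of_add (A.source_fSum α' β') hη' hA' fun ξ => by rw [hd]; rfl)
  have hu : α • A.basis 0 + β • A.basis 1 = 0 := by
    rw [← A.pair_sum]
    funext ξ
    exact Prod.ext (hz.2 ξ) (hz.1 ξ)
  have hJ : multiplier S 0 = 0 := by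
    funext ξ
    simp [multiplier]
  have h0 : ∀ w, sympl 0 w = 0 := fun w => by simp [sympl]
  rw [hαβ, ← A.partnerVec_eq hS, hu, hJ, proj, h0, h0]
  simp

end LocalMode

/-! ### Far fields in the three vacua -/

lemma tendsto_three {ι : Type*} {l : Filter ι} {w p q r : ι → ℂ} {a b c P Q R : ℂ}
    (hp : Tendsto (fun x => w x * p x) l (𝓝 P)) (hq : Tendsto (fun x => w x * q x) l (𝓝 Q))
    (hr : Tendsto (fun x => w x * r x) l (𝓝 R)) :
    Tendsto (fun x => w x * (a * p x + b * q x + c * r x + 0)) l (𝓝 (a * P + b * Q + c * R)) := by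
  refine (((hp.const_mul a).add (hq.const_mul b)).add (hr.const_mul c)).congr fun x => ?_
  ring

lemma bunchDavies_far_field (A : LocalMode) {m H : ℝ} (hm : 0 < m) (hH : m < H) {γ : PhaseVec}
    (hγ : γ ∈ A.partner (symbolBD m H)) (h1 : kleinGordon γ γ = 1) :
    ∃ gp fp : Space → ℂ, FarField γ gp fp ∧ ∃ c d : ℂ,
      (∀ x₀ : Space, Tendsto (fun x => ((‖x - x₀‖ ^ (2 * muSq m H) : ℝ) : ℂ) * gp x)
        (cobounded Space) (𝓝 c)) ∧
      (∀ x₀ : Space, Tendsto (fun x => ((‖x - x₀‖ ^ (2 + muSq m H) : ℝ) : ℂ) * fp x)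
        (cobounded Space) (𝓝 d)) ∧
      ((∃ i, ∫ x, A.f i x ≠ 0) → c ≠ 0 ∧ d ≠ 0) := by
  have hs0 := muSq_pos hm hH
  have hs1 := muSq_lt_half hm hH
  have hB := bdCoeff_ne_zero hm hH
  set s := muSq m H with hs
  set B := bdCoeff m H with hBd
  obtain ⟨α, β, hαβ, hne⟩ := A.exists_coordinates (symbolBD_isComplexStructure hm hH) hγ h1
  obtain ⟨α', β', hd⟩ := A.partnerVec_eq_multiplier_add (symbolBD m H) α β
  obtain ⟨R, hR1, hR2, hR3, hR4⟩ := A.exists_common_radius α β α' β'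
  rw [← hαβ] at hd
  have hg := (A.source_gSum α β).integrable
  have hf := (A.source_fSum α β).integrable
  -- The values of `b` produce the symbols `k ^ (s - 1)`, `k⁻¹` and `k ^ (2s - 3)`, with kernels
  -- decaying like `r ^ (-(2 + s))`, `r ^ (-2)` and `r ^ (-2s)`; the symbol `k` gives `r ^ (-4)`.
  obtain ⟨C₁, hC₁, k₁⟩ := FarKernel.rpow (b := (1 - s) / 2) (by linarith) (by linarith)
  obtain ⟨C₂, hC₂, k₂⟩ := FarKernel.rpow (b := 1 / 2) (by norm_num) (by norm_num)
  obtain ⟨C₃, hC₃, k₃⟩ := FarKernel.rpow (b := (3 - 2 * s) / 2) (by linarith) (by linarith)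
  obtain ⟨C₄, hC₄, k₄⟩ := FarKernel.id
  rw [show -2 * ((1 - s) / 2) = s - 1 by ring, show 2 * ((1 - s) / 2) - 3 = -(2 + s) by ring] at k₁
  rw [show (-2 : ℝ) * (1 / 2) = -1 by norm_num, show (2 : ℝ) * (1 / 2) - 3 = -2 by norm_num] at k₂
  rw [show -2 * ((3 - 2 * s) / 2) = 2 * s - 3 by ring,
    show 2 * ((3 - 2 * s) / 2) - 3 = -(2 * s) by ring] at k₃
  have r1g := k₁.farRep hg hR1
  have r1f := k₁.farRep hf hR2
  have r2 := k₂.farRep hf hR2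
  have r3 := k₃.farRep hf hR2
  have r4 := k₄.farRep hg hR1
  have r5 := (FarRep.of_support (A.source_gSum α' β').integrable hR3).mono
    (show R ≤ R + 1 by linarith)
  have r6 := (FarRep.of_support (A.source_fSum α' β').integrable hR4).mono
    (show R ≤ R + 1 by linarith)
  have Fg := ((((r1g.const_mul B).add (r2.const_mul (-1))).add (r3.const_mul (-(B ^ 2)))).add
    r5).congr (v := fun ξ => (γ ξ).1) fun ξ hξ => by
      rw [hd]
      change (multiplier _ _ ξ).1 + _ = _
      rw [multiplier_symbolBD_fst hm hH _ hξ]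
      rfl
  have Ff := (((r4.const_mul 1).add (r1f.const_mul (-B))).add ((r1f.const_mul 0).add r6)).congr
    (v := fun ξ => (γ ξ).2) fun ξ hξ => by
      rw [hd]
      change (multiplier _ _ ξ).2 + _ = _
      rw [multiplier_symbolBD_snd hm hH _ hξ]
      simp only [pair, ← hBd, ← hs]
      push_cast
      ring
  -- Since `0 < s < 1/2`, the slowest kernels are `r ^ (-2s)` in the field and `r ^ (-(2 + s))` in
  -- the momentum. Both act on the momentum source, so both limits are multiples of its integral.
  refine ⟨_, _, ⟨R + 1, Fg.continuousOn, Ff.continuousOn, Fg.equalsOn, Ff.equalsOn⟩,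
    B * 0 + (-1) * 0 + (-(B ^ 2)) * (C₃ * ∫ y, A.fSum α β y),
    1 * 0 + (-B) * (C₁ * ∫ y, A.fSum α β y) + 0, fun x₀ => ?_, fun x₀ => ?_, fun hi => ?_⟩
  · exact tendsto_three
      (tendsto_rpow_mul_radialConv_zero (by linarith) (by linarith) hg hR1 x₀)
      (tendsto_rpow_mul_radialConv_zero (by linarith) (by linarith) hf hR2 x₀)
      (tendsto_rpow_mul_radialConv (by linarith) hf hR2 x₀)
  · have t1 := (tendsto_rpow_mul_radialConv_zero (C := C₄) (show 2 + s < 4 by linarith)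
      (by norm_num) hg hR1 x₀).const_mul 1
    have t2 := (tendsto_rpow_mul_radialConv (C := C₁) (show 0 ≤ 2 + s by linarith) hf hR2
      x₀).const_mul (-(B : ℂ))
    refine ((t1.add t2).add_const 0).congr fun x => ?_
    ring
  · have hI := A.integral_fSum_ne_zero hne hi
    have hB' : (B : ℂ) ≠ 0 := by exact_mod_cast hB
    have hC₁' : (C₁ : ℂ) ≠ 0 := by exact_mod_cast hC₁
    have hC₃' : (C₃ : ℂ) ≠ 0 := by exact_mod_cast hC₃
    constructor <;> simp [hI, hB', hC₁', hC₃']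

lemma minkowski_far_rep (A : LocalMode) (m : ℝ) {α β α' β' : ℂ} {γ : PhaseVec}
    (hd : γ = fun ξ => multiplier (symbolMink m) (pair (A.gSum α β) (A.fSum α β)) ξ +
      pair (A.gSum α' β') (A.fSum α' β') ξ) {K L : ℝ → ℝ}
    (hK : FarKernel (fun k => (√(k ^ 2 + m ^ 2))⁻¹) K) (hL : FarKernel (fun k => √(k ^ 2 + m ^ 2)) L) :
    ∃ ρ, FarRep (fun ξ => (γ ξ).1) (fun x => -1 * radialConv K (A.fSum α β) x) ρ ∧
      FarRep (fun ξ => (γ ξ).2) (radialConv L (A.gSum α β)) ρ := by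
  obtain ⟨R, hR1, hR2, hR3, hR4⟩ := A.exists_common_radius α β α' β'
  have r1 := hK.farRep (A.source_fSum α β).integrable hR2
  have r2 := hL.farRep (A.source_gSum α β).integrable hR1
  have r5 := (FarRep.of_support (A.source_gSum α' β').integrable hR3).mono
    (show R ≤ R + 1 by linarith)
  have r6 := (FarRep.of_support (A.source_fSum α' β').integrable hR4).mono
    (show R ≤ R + 1 by linarith)
  refine ⟨R + 1, ?_, ?_⟩
  · have := ((r1.const_mul (-1)).add r5).congr (v := fun ξ => (γ ξ).1) fun ξ _ => by
      rw [hd]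
      change (multiplier _ _ ξ).1 + _ = _
      rw [multiplier_symbolMink_fst]
      rfl
    simpa only [add_zero] using this
  · have := (r2.add r6).congr (v := fun ξ => (γ ξ).2) fun ξ _ => by
      rw [hd]
      change (multiplier _ _ ξ).2 + _ = _
      rw [multiplier_symbolMink_snd]
      rfl
    simpa only [add_zero] using this

lemma massless_far_field (A : LocalMode) {γ : PhaseVec}
    (hγ : γ ∈ A.partner (symbolMink 0)) (h1 : kleinGordon γ γ = 1) :
    ∃ gp fp : Space → ℂ, FarField γ gp fp ∧ ∃ c d : ℂ,
      (∀ x₀ : Space, Tendsto (fun x => ((‖x - x₀‖ ^ (2 : ℝ) : ℝ) : ℂ) * gp x)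
        (cobounded Space) (𝓝 c)) ∧
      (∀ x₀ : Space, Tendsto (fun x => ((‖x - x₀‖ ^ (4 : ℝ) : ℝ) : ℂ) * fp x)
        (cobounded Space) (𝓝 d)) ∧
      ((∃ i, ∫ x, A.f i x ≠ 0) → c ≠ 0) ∧ ((∃ i, ∫ x, A.g i x ≠ 0) → d ≠ 0) := by
  obtain ⟨α, β, hαβ, hne⟩ := A.exists_coordinates (symbolMink_isComplexStructure 0) hγ h1
  obtain ⟨α', β', hd⟩ := A.partnerVec_eq_multiplier_add (symbolMink 0) α β
  rw [← hαβ] at hd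
  obtain ⟨C₁, hC₁, k₁⟩ := FarKernel.rpow (b := 1 / 2) (by norm_num) (by norm_num)
  obtain ⟨C₂, hC₂, k₂⟩ := FarKernel.id
  rw [show (-2 : ℝ) * (1 / 2) = -1 by norm_num, show (2 : ℝ) * (1 / 2) - 3 = -2 by norm_num] at k₁
  have k₁' : FarKernel (fun k => (√(k ^ 2 + 0 ^ 2))⁻¹) fun r => C₁ * r ^ (-2 : ℝ) :=
    k₁.congr (fun k hk => by simp [Real.sqrt_sq (le_of_lt hk), Real.rpow_neg_one]) fun _ _ => rfl
  have k₂' : FarKernel (fun k => √(k ^ 2 + 0 ^ 2)) fun r => C₂ * r ^ (-4 : ℝ) :=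
    k₂.congr (fun k hk => by simp [Real.sqrt_sq (le_of_lt hk)]) fun _ _ => rfl
  obtain ⟨ρ, Fg, Ff⟩ := minkowski_far_rep A 0 hd k₁' k₂'
  obtain ⟨R, hR1, hR2, -, -⟩ := A.exists_common_radius α β α' β'
  refine ⟨_, _, ⟨ρ, Fg.continuousOn, Ff.continuousOn, Fg.equalsOn, Ff.equalsOn⟩,
    -1 * (C₁ * ∫ y, A.fSum α β y), C₂ * ∫ y, A.gSum α β y, fun x₀ => ?_, fun x₀ => ?_, fun hi => ?_,
    fun hi => ?_⟩
  · refine ((tendsto_rpow_mul_radialConv (C := C₁) (show (0 : ℝ) ≤ 2 by norm_num)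
      (A.source_fSum α β).integrable hR2 x₀).const_mul (-1)).congr fun x => ?_
    ring
  · exact tendsto_rpow_mul_radialConv (by norm_num) (A.source_gSum α β).integrable hR1 x₀
  · have hI := A.integral_fSum_ne_zero hne hi
    have hC₁' : (C₁ : ℂ) ≠ 0 := by exact_mod_cast hC₁
    simp [hI, hC₁']
  · have hI := A.integral_gSum_ne_zero hne hi
    have hC₂' : (C₂ : ℂ) ≠ 0 := by exact_mod_cast hC₂
    simp [hI, hC₂']

/-- Decay faster than `exp (-m r)` would give analyticity in a strip reaching past the branch point
of the square root, forcing a component of the mode vector to vanish. -/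
lemma massive_far_field (A : LocalMode) {m : ℝ} (hm : 0 < m) {γ : PhaseVec}
    (hγ : γ ∈ A.partner (symbolMink m)) (h1 : kleinGordon γ γ = 1) :
    ∃ gp fp : Space → ℂ, FarField γ gp fp ∧ ∀ x₀ : Space,
      gp =O[cobounded Space] (fun x => Real.exp (-m * ‖x - x₀‖)) ∧
      fp =O[cobounded Space] (fun x => Real.exp (-m * ‖x - x₀‖)) ∧
      ∀ m' : ℝ, m < m' →
        ¬ gp =O[cobounded Space] (fun x => Real.exp (-m' * ‖x - x₀‖)) ∧
        ¬ fp =O[cobounded Space] (fun x => Real.exp (-m' * ‖x - x₀‖)) := by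
  have hpi := Real.pi_pos
  obtain ⟨α, β, hαβ, hne⟩ := A.exists_coordinates (symbolMink_isComplexStructure m) hγ h1
  obtain ⟨α', β', hd⟩ := A.partnerVec_eq_multiplier_add (symbolMink m) α β
  rw [← hαβ] at hd
  obtain ⟨C₁, hC₁, k₁⟩ := FarKernel.inv_sqrt m
  obtain ⟨C₂, hC₂, k₂⟩ := FarKernel.sqrt m
  obtain ⟨ρ, Fg, Ff⟩ := minkowski_far_rep A m hd k₁ k₂
  obtain ⟨R, hR1, hR2, -, -⟩ := A.exists_common_radius α β α' β'
  have hdecay : ∀ (b C : ℝ), b < 3 / 2 → ∃ D, ∀ r ≥ 2 * m + 1,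
      |C * heatSuperposition b m r| ≤ D * Real.exp (-m * r) := by
    intro b C hb
    obtain ⟨D, hD⟩ := heatSuperposition_le_exp hb hm
    refine ⟨|C| * D, fun r hr => ?_⟩
    rw [abs_mul, mul_assoc]
    exact mul_le_mul_of_nonneg_left (hD r hr) (abs_nonneg _)
  obtain ⟨D₁, hD₁⟩ := hdecay (1 / 2) C₁ (by norm_num)
  obtain ⟨D₂, hD₂⟩ := hdecay (-1 / 2) C₂ (by norm_num)
  refine ⟨_, _, ⟨ρ, Fg.continuousOn, Ff.continuousOn, Fg.equalsOn, Ff.equalsOn⟩, fun x₀ =>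
    ⟨(radialConv_isBigO_exp hm.le hD₁ (A.source_fSum α β).integrable hR2 x₀).const_mul_left _,
      radialConv_isBigO_exp hm.le hD₂ (A.source_gSum α β).integrable hR1 x₀, fun m' hm' => ?_⟩⟩
  -- The half-width is chosen so that `2π` times it is the midpoint of `m` and `m'`: below the
  -- assumed decay rate, above the branch point.
  have hb1 : 2 * Real.pi * ((m + m') / (4 * Real.pi)) = (m + m') / 2 := by
    field_simp
    ring
  have hb2 : 2 * Real.pi * ((m + m') / (4 * Real.pi)) < m' := by
    rw [hb1]
    linarith
  have hb3 : m < 2 * Real.pi * ((m + m') / (4 * Real.pi)) := by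
    rw [hb1]
    linarith
  have hm0 : 0 < m' := hm.trans hm'
  constructor
  · intro hO
    obtain ⟨η, hη, hη0, hA⟩ := Fg.rayAnalytic (isBigO_exp_recenter hm0.le hO) hm0 hb2
    obtain ⟨ξ, hξ⟩ := A.exists_fourier_fSum_ne_zero hne
    refine hξ (fourier_eq_zero_of_inv_sqrt (A.source_fSum α β) hη hη0 hm hb3 ?_ ξ)
    have h2 := rayAnalytic_of_add (A.source_gSum α' β') hη hA fun ξ => by rw [hd]; rfl
    refine (h2.const_mul (-1)).congr fun ξ _ => ?_
    rw [multiplier_symbolMink_fst]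
    simp [pair]
  · intro hO
    obtain ⟨η, hη, hη0, hA⟩ := Ff.rayAnalytic (isBigO_exp_recenter hm0.le hO) hm0 hb2
    obtain ⟨ξ, hξ⟩ := A.exists_fourier_gSum_ne_zero hne
    refine hξ (fourier_eq_zero_of_sqrt (A.source_gSum α β) hη hη0 hm hb3 ?_ ξ)
    have h2 := rayAnalytic_of_add (A.source_fSum α' β') hη hA fun ξ => by rw [hd]; rfl
    refine h2.congr fun ξ _ => ?_
    rw [multiplier_symbolMink_snd]
    simp [pair]

end BDPartner

end

/-! ### Assembly of the three cases -/

open BDPartner in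
theorem proposition6 (A : LocalMode) :
    -- Bunch--Davies vacuum of a light field
    (∀ m H : ℝ, 0 < m → m < H →
      (∃ γ ∈ A.partner (symbolBD m H), kleinGordon γ γ = 1) ∧
      (∀ v ∈ A.partner (symbolBD m H), ¬ v =ᵐ[volume] 0 → ¬ CompactlySupported v) ∧
      (∀ γ ∈ A.partner (symbolBD m H), kleinGordon γ γ = 1 →
        ∃ gp fp : Space → ℂ, FarField γ gp fp ∧
          (∀ x₀ : Space,
            gp =O[cobounded Space] (fun x => ‖x - x₀‖ ^ (-2 * muSq m H)) ∧
            fp =O[cobounded Space] (fun x => ‖x - x₀‖ ^ (-1 - muSq m H)) ∧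
            fp =O[cobounded Space] (fun x => ‖x - x₀‖ ^ (-2 - muSq m H))) ∧
          ((∃ i, ∫ x, A.f i x ≠ 0) →
            ∃ c d : ℂ, c ≠ 0 ∧ d ≠ 0 ∧ ∀ x₀ : Space,
              Tendsto (fun x => ((‖x - x₀‖ ^ (2 * muSq m H) : ℝ) : ℂ) * gp x)
                (cobounded Space) (𝓝 c) ∧
              Tendsto (fun x => ((‖x - x₀‖ ^ (2 + muSq m H) : ℝ) : ℂ) * fp x)
                (cobounded Space) (𝓝 d)))) ∧
    -- Minkowski vacuum of a massless field
    ((∃ γ ∈ A.partner (symbolMink 0), kleinGordon γ γ = 1) ∧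
      (∀ γ ∈ A.partner (symbolMink 0), kleinGordon γ γ = 1 →
        ∃ gp fp : Space → ℂ, FarField γ gp fp ∧
          (∀ x₀ : Space,
            gp =O[cobounded Space] (fun x => ‖x - x₀‖ ^ (-2 : ℝ)) ∧
            fp =O[cobounded Space] (fun x => ‖x - x₀‖ ^ (-4 : ℝ))) ∧
          ((∃ i, ∫ x, A.f i x ≠ 0) → ∃ c : ℂ, c ≠ 0 ∧ ∀ x₀ : Space,
            Tendsto (fun x => ((‖x - x₀‖ ^ (2 : ℝ) : ℝ) : ℂ) * gp x) (cobounded Space) (𝓝 c)) ∧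
          ((∃ i, ∫ x, A.g i x ≠ 0) → ∃ d : ℂ, d ≠ 0 ∧ ∀ x₀ : Space,
            Tendsto (fun x => ((‖x - x₀‖ ^ (4 : ℝ) : ℝ) : ℂ) * fp x)
              (cobounded Space) (𝓝 d)))) ∧
    -- Minkowski vacuum of a massive field
    (∀ m : ℝ, 0 < m →
      (∃ γ ∈ A.partner (symbolMink m), kleinGordon γ γ = 1) ∧
      (∀ γ ∈ A.partner (symbolMink m), kleinGordon γ γ = 1 →
        ∃ gp fp : Space → ℂ, FarField γ gp fp ∧
          ∀ x₀ : Space,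
            gp =O[cobounded Space] (fun x => Real.exp (-m * ‖x - x₀‖)) ∧
            fp =O[cobounded Space] (fun x => Real.exp (-m * ‖x - x₀‖)) ∧
            ∀ m' : ℝ, m < m' →
              ¬ gp =O[cobounded Space] (fun x => Real.exp (-m' * ‖x - x₀‖)) ∧
              ¬ fp =O[cobounded Space] (fun x => Real.exp (-m' * ‖x - x₀‖)))) := by
  refine ⟨fun m H hm hH => ?_, ?_, fun m hm => ?_⟩
  · have hS := symbolBD_isComplexStructure hm hH
    have hr := symbolBD_isRigid hm hH
    refine ⟨A.exists_unit_norm hS hr, fun v hv hne hc => hne ?_, fun γ hγ h1 => ?_⟩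
    · rw [A.eq_zero_of_compactlySupported hS hr hv hc]
    · obtain ⟨gp, fp, hF, c, d, hc, hd, hi⟩ := bunchDavies_far_field A hm hH hγ h1
      have hf : ∀ x₀ : Space, fp =O[cobounded Space] fun x => ‖x - x₀‖ ^ (-2 - muSq m H) := fun x₀ => by
        have := isBigO_rpow_of_tendsto (hd x₀)
        rwa [neg_add'] at this
      refine ⟨gp, fp, hF, fun x₀ => ⟨?_, ?_, hf x₀⟩, fun h => ⟨c, d, (hi h).1, (hi h).2,
        fun x₀ => ⟨hc x₀, hd x₀⟩⟩⟩
      · have := isBigO_rpow_of_tendsto (hc x₀)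
        rwa [← neg_mul] at this
      · exact (hf x₀).trans (isBigO_rpow_mono x₀ (by linarith))
  · refine ⟨A.exists_unit_norm (symbolMink_isComplexStructure 0) symbolMink_zero_isRigid,
      fun γ hγ h1 => ?_⟩
    obtain ⟨gp, fp, hF, c, d, hc, hd, hf, hg⟩ := massless_far_field A hγ h1
    exact ⟨gp, fp, hF, fun x₀ => ⟨isBigO_rpow_of_tendsto (hc x₀), isBigO_rpow_of_tendsto (hd x₀)⟩,
      fun h => ⟨c, hf h, hc⟩, fun h => ⟨d, hg h, hd⟩⟩
  · exact ⟨A.exists_unit_norm (symbolMink_isComplexStructure m) (symbolMink_isRigid hm),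
      fun γ hγ h1 => massive_far_field A hm hγ h1⟩
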